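/- Work over $\mathbb{C}$. Let $X$ be a separated scheme of finite type over $\mathbb{C}$ and let $0<r_1<\cdots<r_s$ be integers; put $r_0=0$. **Cobordism groups.** Fix one of the following kinds of bundle data on a scheme $Y$: (F) a filtered vector bundle $E_1\subset\cdots\subset E_s$, with $E_i$ a subbundle of $E_{i+1}$ and $\operatorname{rank}E_i=r_i$; (G) a graded vector bundle $E_1\oplus\cdots\oplus E_s$ with $\operatorname{rank}E_i=r_i-r_{i-1}$; (L) an ordered list $(E_1,\dots,E_s)$ of vector bundles with $\operatorname{rank}E_i=r_i-r_{i-1}$; (0) no data. Let $\mathcal{M}_n(X)$ be the commutative monoid, under disjoint union of domains, of isomorphism classes $[f:Y\to X,E]$, where $Y$ is a smooth quasi-projective $\mathbb{C}$-scheme of pure dimension $n$, $f$ is a projective morphism and $E$ is bundle data on $Y$ of the fixed kind. Let $\mathcal{M}_n(X)^+$ be its group completion. A *double point relation* over $X$ arises from a smooth quasi-projective $W$ of pure dimension $n+1$, a projective morphism $g:W\to X\times\mathbb{P}^1$ and bundle data $E$ on $W$ such that, with $\pi=\mathrm{pr}_2\circ g$, the fibre $\pi^{-1}(0)$ is $A\cup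 B$ with $A,B\subset W$ smooth closed subschemes of codimension $1$ which intersect transversely in $D=A\cap B$ (each of them possibly empty or disconnected), together with a regular value $\zeta\in\mathbb{P}^1(\mathbb{C})$ of $\pi$; it is the element $$[\pi^{-1}(\zeta)]-[A]-[B]+[\mathbb{P}(\mathcal{O}_D\oplus N_{D/A})]\in\mathcal{M}_n(X)^+,$$ all four terms with the induced maps to $X$ and the bundle data induced from $E$. Let $\omega_n(X)$ be the quotient of $\mathcal{M}_n(X)^+$ by the subgroup generated by all double point relations, and let $\omega_*(X)=\bigoplus_{n\ge 0}\omega_n(X)$. Write $\omega_{*,r_1<\cdots<r_s}(X)$, $\omega_{*,\oplus_i(r_i-r_{i-1})}(X)$ and $\omega_{*,(r_i-r_{i-1})_i}(X)$ for the groups of the kinds (F), (G) and (L), and $\omega_*(\mathbb{C})$ for the group of kind (0) with $X=\operatorname{Spec}\mathbb{C}$. **Lemma (Filtration, gradation, and list: three in one).** The product $[Z]\cdot[Z']=[Z\times Z']$ makes $\omega_*(\mathbb{C})$ a commutative graded ring, and the product $[Z]\cdot[f:Y\to X,E]=[f\circ\mathrm{pr}_2:Z\times Y\to X,\ \mathrm{pr}_2^*E]$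 makes $\omega_{*,r_1<\cdots<r_s}(X)$, $\omega_{*,\oplus_i(r_i-r_{i-1})}(X)$ and $\omega_{*,(r_i-r_{i-1})_i}(X)$ graded $\omega_*(\mathbb{C})$-modules. With the convention $E_0=0$, the homomorphisms of monoids $$[f:Y\to X,\ E_1\subset\cdots\subset E_s]\ \longmapsto\ [f:Y\to X,\ E_1\oplus E_2/E_1\oplus\cdots\oplus E_s/E_{s-1}],$$ $$[f:Y\to X,\ V_1\oplus\cdots\oplus V_s]\ \longmapsto\ [f:Y\to X,\ (V_1,\dots,V_s)]$$ induce group isomorphisms $$\omega_{*,r_1<\cdots<r_s}(X)\ \xrightarrow{\ gr\ }\ \omega_{*,\oplus_i(r_i-r_{i-1})}(X)\ \xrightarrow{\ list\ }\ \omega_{*,(r_i-r_{i-1})_i}(X),$$ which are also isomorphisms of $\omega_*(\mathbb{C})$-modules. -/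

import Mathlib

open CategoryTheory CategoryTheory.Limits AlgebraicGeometry

noncomputable section

namespace DoublePoint

/-! ### Projective space, projective morphisms, quasi-projective schemes -/

/-- The base `Spec ℂ`. -/
abbrev SpecC : Scheme.{0} := Spec (CommRingCat.of ℂ)

/-- The standard grading of `ℤ[x₀, …, x_N]` by degree. -/
abbrev stdGrading (N : ℕ) : ℕ → Submodule ℤ (MvPolynomial (Fin (N + 1)) ℤ) :=
  MvPolynomial.homogeneousSubmodule (Fin (N + 1)) ℤ

instance (N : ℕ) : GradedRing (stdGrading N) :=
  MvPolynomial.gradedAlgebra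

/-- Projective `N`-space `ℙ^N_S` over a scheme `S`. -/
def ProjSpace (N : ℕ) (S : Scheme.{0}) : Scheme.{0} :=
  pullback (terminal.from S) (terminal.from (Proj (stdGrading N)))

/-- The projection `ℙ^N_S ⟶ S`. -/
def ProjSpace.toBase (N : ℕ) (S : Scheme.{0}) : ProjSpace N S ⟶ S :=
  pullback.fst _ _

/-- A morphism `f : Y ⟶ S` is projective if it factors as a closed immersion into some `ℙ^N_S`
followed by the projection. -/
def IsProjective {Y S : Scheme.{0}} (f : Y ⟶ S) : Prop :=
  ∃ (N : ℕ) (i : Y ⟶ ProjSpace N S), IsClosedImmersion i ∧ i ≫ ProjSpace.toBase N S = f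

/-- A scheme `Y` over `ℂ` is quasi-projective if it is a locally closed subscheme of some
`ℙ^N_ℂ`. -/
def IsQuasiProjective {Y : Scheme.{0}} (q : Y ⟶ SpecC) : Prop :=
  ∃ (N : ℕ) (i : Y ⟶ ProjSpace N SpecC), IsImmersion i ∧ i ≫ ProjSpace.toBase N SpecC = q

/-- The complex projective line. -/
abbrev P1 : Scheme.{0} := ProjSpace 1 SpecC

/-- The structure morphism of the projective line. -/
abbrev P1.toSpecC : P1 ⟶ SpecC := ProjSpace.toBase 1 SpecC

/-- Evaluation of polynomials in `x₀, x₁` at `(0, 1)`, with values in the global functions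
on `Spec ℂ`. -/
def evalZero : MvPolynomial (Fin 2) ℤ →+* Γ(SpecC, ⊤) :=
  MvPolynomial.eval₂Hom (Int.castRingHom _) ![0, 1]

lemma map_evalZero_irrelevant :
    (HomogeneousIdeal.irrelevant (stdGrading 1)).toIdeal.map evalZero = ⊤ := by
  rw [Ideal.eq_top_iff_one]
  have h : evalZero (MvPolynomial.X 1) = 1 := by simp [evalZero]
  rw [← h]
  refine Ideal.mem_map_of_mem _ ?_
  change (MvPolynomial.X 1 : MvPolynomial (Fin 2) ℤ) ∈
    HomogeneousIdeal.irrelevant (stdGrading 1)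
  rw [HomogeneousIdeal.mem_irrelevant_iff]
  change ((DirectSum.decompose (stdGrading 1) (MvPolynomial.X 1) 0 : stdGrading 1 0) :
    MvPolynomial (Fin 2) ℤ) = 0
  exact DirectSum.decompose_of_mem_ne (stdGrading 1)
    ((MvPolynomial.mem_homogeneousSubmodule 1 _).2 (MvPolynomial.isHomogeneous_X ℤ 1)) one_ne_zero

/-- The point `0 = [0 : 1]` of `ℙ¹(ℂ)`. -/
def P1.zero : SpecC ⟶ P1 :=
  pullback.lift (𝟙 SpecC)
    (Proj.fromOfGlobalSections (stdGrading 1) evalZero map_evalZero_irrelevant)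
    (terminal.hom_ext _ _)

/-! ### Vector bundles -/

/-- The structure sheaf as a module over itself. -/
def structureModule (Y : Scheme.{0}) : Y.Modules := SheafOfModules.unit Y.ringCatSheaf

/-- The free module `𝒪_Y ^ r`. -/
def freeModule (Y : Scheme.{0}) (r : ℕ) : Y.Modules :=
  SheafOfModules.free (R := Y.ringCatSheaf) (Fin r)

/-- A vector bundle of rank `r`: an `𝒪_Y`-module which is locally isomorphic to `𝒪_Y ^ r`. -/
def IsLocallyFreeOfRank {Y : Scheme.{0}} (r : ℕ) (E : Y.Modules) : Prop :=
  ∀ y : Y, ∃ U : Y.Opens, y ∈ U ∧ Nonempty (E.restrict U.ι ≅ freeModule U r)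

/-- The canonical map `𝒪_A ⟶ i_* 𝒪_D` of a morphism `i : D ⟶ A`. -/
def toPushforwardStructure {D A : Scheme.{0}} (i : D ⟶ A) :
    structureModule A ⟶ (Scheme.Modules.pushforward i).obj (structureModule D) :=
  SheafOfModules.unitToPushforwardObjUnit i.toRingCatSheafHom

/-- The conormal sheaf `I / I² = i^* I` of a closed immersion `i : D ⟶ A` with ideal sheaf `I`.
If `D` is a smooth divisor in the smooth scheme `A`, it is the dual of the normal
bundle `N_{D/A}`. -/
def conormal {D A : Scheme.{0}} (i : D ⟶ A) : D.Modules :=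
  (Scheme.Modules.pullback i).obj (kernel (toPushforwardStructure i))

/-- `u : P ⟶ D` is the bundle of rank one quotients of `F`: there is a universal
line bundle quotient `u^* F ⟶ L`. For a vector bundle `F` with dual `V`, this is the bundle
`ℙ(V)` of lines in `V`. -/
def IsBundleOfQuotientLines {P D : Scheme.{0}} (u : P ⟶ D) (F : D.Modules) : Prop :=
  ∃ (L : P.Modules) (q : (Scheme.Modules.pullback u).obj F ⟶ L),
    IsLocallyFreeOfRank 1 L ∧ Epi q ∧
    ∀ (T : Scheme.{0}) (v : T ⟶ D) (L' : T.Modules) (q' : (Scheme.Modules.pullback v).obj F ⟶ L'),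
      IsLocallyFreeOfRank 1 L' → Epi q' →
      ∃! w : T ⟶ P, ∃ (h : w ≫ u = v) (e : (Scheme.Modules.pullback w).obj L ≅ L'),
        q' = (Scheme.Modules.pullbackCongr h).inv.app F ≫
          (Scheme.Modules.pullbackComp w u).inv.app F ≫
            (Scheme.Modules.pullback w).map q ≫ e.hom

/-- `u : P ⟶ D` is the projective bundle `ℙ(𝒪_D ⊕ N_{D/A})` over the smooth divisor
`i : D ⟶ A`. (As `N_{D/A}` is a line bundle, the bundle of lines in `𝒪_D ⊕ N_{D/A}` and the bundle
of its rank one quotients are isomorphic over `D`, so that both conventions for `ℙ` agree.) -/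
def IsNormalProjectiveBundle {P D A : Scheme.{0}} (u : P ⟶ D) (i : D ⟶ A) : Prop :=
  IsBundleOfQuotientLines u (structureModule D ⊞ conormal i)

/-! ### Double point degenerations -/

/-- Let `W` be a scheme over `ℂ`, via `q`, and `π : W ⟶ ℙ¹` a morphism. This says that
`W` is smooth, quasi-projective, of pure dimension `n + 1`, and that the
fibre `π⁻¹(0)` is the union of the smooth divisors `A` and `B`, which intersect transversely (the
scheme `A ∩ B` is smooth of pure dimension `n - 1`, in particular empty if `n = 0`). -/
structure IsDoublePointDegeneration {W A B : Scheme.{0}} (q : W ⟶ SpecC) (n : ℕ) (π : W ⟶ P1)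
    (iA : A ⟶ W) (iB : B ⟶ W) : Prop where
  comp_toSpecC : π ≫ P1.toSpecC = q
  smooth : SmoothOfRelativeDimension (n + 1) q
  quasiProjective : IsQuasiProjective q
  closedA : IsClosedImmersion iA
  closedB : IsClosedImmersion iB
  smoothA : SmoothOfRelativeDimension n (iA ≫ q)
  smoothB : SmoothOfRelativeDimension n (iB ≫ q)
  fibre : (pullback.fst π P1.zero).ker = iA.ker ⊓ iB.ker
  transverse : IsEmpty (pullback iA iB : Scheme.{0}) ∨
    ∃ m, m + 1 = n ∧ SmoothOfRelativeDimension m (pullback.fst iA iB ≫ iA ≫ q)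

/-- `ζ : Spec ℂ ⟶ ℙ¹` is a `ℂ`-point of `ℙ¹` which is a regular value of `π : W ⟶ ℙ¹`: the
morphism `π` is smooth in a neighbourhood of the fibre `π⁻¹(ζ)`. -/
def IsRegularValue {W : Scheme.{0}} (π : W ⟶ P1) (ζ : SpecC ⟶ P1) : Prop :=
  ζ ≫ P1.toSpecC = 𝟙 SpecC ∧
    ∃ U : W.Opens, (∀ x, (pullback.fst π ζ) x ∈ U) ∧ Smooth (U.ι ≫ π)

/-! ### Bundle data -/

/-- A kind of bundle data on schemes: the data `Obj Y` on `Y`, and the relation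
`IsPullback j E' E` that `E'` is isomorphic to the pullback `j^* E`. -/
structure BundleKind where
  Obj : Scheme.{0} → Type 1
  IsPullback : ∀ {Y' Y : Scheme.{0}}, (Y' ⟶ Y) → Obj Y' → Obj Y → Prop

/-- No bundle data. -/
def noBundle : BundleKind where
  Obj _ := PUnit
  IsPullback _ _ _ := True

/-- Lists of vector bundles with ranks `d 0, d 1, …, d (s - 1)`. -/
structure BundleList {s : ℕ} (d : Fin s → ℕ) (Y : Scheme.{0}) where
  bundle : Fin s → Y.Modules
  locallyFree : ∀ i, IsLocallyFreeOfRank (d i) (bundle i)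

/-- Lists of vector bundles; an isomorphism is a list of isomorphisms. -/
def bundleLists {s : ℕ} (d : Fin s → ℕ) : BundleKind where
  Obj Y := BundleList d Y
  IsPullback j E' E :=
    ∀ i, Nonempty (E'.bundle i ≅ (Scheme.Modules.pullback j).obj (E.bundle i))

/-- Graded vector bundles `E = E₁ ⊕ ⋯ ⊕ E_s`: a module together with a direct sum decomposition
into vector bundles of ranks `d 0, d 1, …, d (s - 1)`. -/
structure GradedBundle {s : ℕ} (d : Fin s → ℕ) (Y : Scheme.{0}) where
  total : Y.Modules
  piece : Fin s → Y.Modules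
  incl : ∀ i, piece i ⟶ total
  isDirectSum : Nonempty (IsColimit (Cofan.mk total incl))
  locallyFree : ∀ i, IsLocallyFreeOfRank (d i) (piece i)

/-- Graded vector bundles; an isomorphism is an isomorphism of the total bundles which respects the
decompositions. -/
def gradedBundles {s : ℕ} (d : Fin s → ℕ) : BundleKind where
  Obj Y := GradedBundle d Y
  IsPullback j E' E :=
    ∃ (e : E'.total ≅ (Scheme.Modules.pullback j).obj E.total)
      (e' : ∀ i, E'.piece i ≅ (Scheme.Modules.pullback j).obj (E.piece i)),
      ∀ i, E'.incl i ≫ e.hom = (e' i).hom ≫ (Scheme.Modules.pullback j).map (E.incl i)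

/-- The successive differences `r_i - r_{i-1}`, with the convention `r_0 = 0`. -/
def differences {s : ℕ} (r : Fin s → ℕ) : Fin s → ℕ
  | ⟨0, h⟩ => r ⟨0, h⟩
  | ⟨k + 1, h⟩ => r ⟨k + 1, h⟩ - r ⟨k, Nat.lt_of_succ_lt h⟩

/-- The successive quotients `E_i / E_{i-1}` of a sequence `E₁ ⟶ E₂ ⟶ ⋯ ⟶ E_s`, with the
convention `E_0 = 0`. -/
def quotients {C : Type*} [Category* C] [Abelian C] {s : ℕ} (E : Fin s ⥤ C) : Fin s → C
  | ⟨0, h⟩ => E.obj ⟨0, h⟩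
  | ⟨k + 1, h⟩ => cokernel (E.map (homOfLE
      (show (⟨k, Nat.lt_of_succ_lt h⟩ : Fin s) ≤ ⟨k + 1, h⟩ from Nat.le_succ k)))

/-- Filtered vector bundles `E₁ ⊂ E₂ ⊂ ⋯ ⊂ E_s` with `rank E_i = r_i`: each `E_i` is a
vector bundle, and it is a subbundle of the next one, that is, the
quotients `E_i / E_{i-1}` are vector bundles as well. -/
structure FilteredBundle {s : ℕ} (r : Fin s → ℕ) (Y : Scheme.{0}) where
  step : Fin s ⥤ Y.Modules
  mono : ∀ {i j : Fin s} (h : i ⟶ j), Mono (step.map h)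
  locallyFree : ∀ i, IsLocallyFreeOfRank (r i) (step.obj i)
  quotientsLocallyFree : ∀ i, IsLocallyFreeOfRank (differences r i) (quotients step i)

/-- Filtered vector bundles; an isomorphism is an isomorphism of the sequences of inclusions. -/
def filteredBundles {s : ℕ} (r : Fin s → ℕ) : BundleKind where
  Obj Y := FilteredBundle r Y
  IsPullback j E' E := Nonempty (E'.step ≅ E.step ⋙ Scheme.Modules.pullback j)

/-- An operation which turns bundle data of one kind into bundle data of another kind, and which
is compatible with pullbacks and isomorphisms. -/
structure BundleKind.Hom (D D' : BundleKind) where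
  obj : ∀ {Y : Scheme.{0}}, D.Obj Y → D'.Obj Y
  isPullback : ∀ {Y' Y : Scheme.{0}} {j : Y' ⟶ Y} {E' : D.Obj Y'} {E : D.Obj Y},
    D.IsPullback j E' E → D'.IsPullback j (obj E') (obj E)

/-- The associated graded bundle `E₁ ⊕ E₂/E₁ ⊕ ⋯ ⊕ E_s/E_{s-1}` of a filtered bundle. -/
def FilteredBundle.gr {s : ℕ} {r : Fin s → ℕ} {Y : Scheme.{0}} (E : FilteredBundle r Y) :
    GradedBundle (differences r) Y where
  total := ∐ (quotients E.step)
  piece := quotients E.step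
  incl i := Sigma.ι (quotients E.step) i
  isDirectSum := ⟨coproductIsCoproduct _⟩
  locallyFree := E.quotientsLocallyFree

/-- The list of the graded pieces of a graded bundle. -/
def GradedBundle.list {s : ℕ} {d : Fin s → ℕ} {Y : Scheme.{0}} (E : GradedBundle d Y) :
    BundleList d Y where
  bundle := E.piece
  locallyFree := E.locallyFree

/-- Successive quotients are compatible with right exact functors and isomorphisms. -/
lemma quotients_iso {C C' : Type*} [Category* C] [Abelian C] [Category* C'] [Abelian C']
    (F : C ⥤ C') [F.PreservesZeroMorphisms] [PreservesFiniteColimits F] {s : ℕ}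
    {E' : Fin s ⥤ C'} {E : Fin s ⥤ C} (e : E' ≅ E ⋙ F) (i : Fin s) :
    Nonempty (quotients E' i ≅ F.obj (quotients E i)) := by
  obtain ⟨i, hi⟩ := i
  cases i with
  | zero => exact ⟨e.app _⟩
  | succ k =>
    exact ⟨cokernel.mapIso _ (F.map (E.map _)) (e.app _) (e.app _) (e.hom.naturality _) ≪≫
      (PreservesCokernel.iso F _).symm⟩

/-- Passage to the associated graded bundle. -/
def grHom {s : ℕ} (r : Fin s → ℕ) :
    BundleKind.Hom (filteredBundles r) (gradedBundles (differences r)) where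
  obj E := E.gr
  isPullback := by
    rintro Y' Y j E' E ⟨e⟩
    have h := quotients_iso (Scheme.Modules.pullback j) e
    refine ⟨Sigma.mapIso (fun i => (h i).some) ≪≫
      (PreservesCoproduct.iso (Scheme.Modules.pullback j) (quotients E.step)).symm,
      fun i => (h i).some, fun i => ?_⟩
    simp [FilteredBundle.gr, PreservesCoproduct.inv_hom]

/-- Passage from a graded bundle to the list of its pieces. -/
def listHom {s : ℕ} (d : Fin s → ℕ) : BundleKind.Hom (gradedBundles d) (bundleLists d) where
  obj E := E.list
  isPullback := by
    rintro Y' Y j E' E ⟨_, e', _⟩ i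
    exact ⟨e' i⟩

/-! ### Cobordism groups

In this section `X` is a scheme over `ℂ`, with structure morphism `p : X ⟶ Spec ℂ`. -/

/-- A smooth quasi-projective scheme `Y` of pure dimension `n` with a projective morphism
`f : Y ⟶ X` and with bundle data of the kind `D`. -/
structure Cycle (D : BundleKind) {X : Scheme.{0}} (p : X ⟶ SpecC) (n : ℕ) where
  Y : Scheme.{0}
  f : Y ⟶ X
  smooth : SmoothOfRelativeDimension n (f ≫ p)
  quasiProjective : IsQuasiProjective (f ≫ p)
  projective : IsProjective f
  E : D.Obj Y

namespace Cycle

variable {D D' D'' : BundleKind} {X : Scheme.{0}} {p : X ⟶ SpecC} {n : ℕ}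

/-- Along `j : c.Y ⟶ W`, the map to `X` and the bundle data of `c` are obtained from a
map `h : W ⟶ X` and bundle data `E` on `W`. -/
def IsRestriction (c : Cycle D p n) {W : Scheme.{0}} (j : c.Y ⟶ W) (h : W ⟶ X) (E : D.Obj W) :
    Prop :=
  c.f = j ≫ h ∧ D.IsPullback j c.E E

/-- Isomorphism of cycles. -/
def IsIsomorphic (a b : Cycle D p n) : Prop :=
  ∃ φ : a.Y ≅ b.Y, a.IsRestriction φ.hom b.f b.E

/-- `c` is the disjoint union of `a` and `b`. -/
def IsDisjointUnion (c a b : Cycle D p n) : Prop :=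
  ∃ (i : a.Y ⟶ c.Y) (j : b.Y ⟶ c.Y), Nonempty (IsColimit (BinaryCofan.mk i j)) ∧
    a.IsRestriction i c.f c.E ∧ b.IsRestriction j c.f c.E

/-- `c = [Z × Y ⟶ Y ⟶ X, pr₂^* E]` is the product of `z = [Z ⟶ Spec ℂ]` and of
`y = [Y ⟶ X, E]`. -/
def IsProduct {m k : ℕ} (c : Cycle D p k) (z : Cycle noBundle (𝟙 SpecC) n) (y : Cycle D p m) :
    Prop :=
  ∃ (p₁ : c.Y ⟶ z.Y) (p₂ : c.Y ⟶ y.Y), CategoryTheory.IsPullback p₁ p₂ z.f (y.f ≫ p) ∧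
    c.IsRestriction p₂ y.f y.E

/-- Transport of cycles along an operation on bundle data. -/
def map (F : BundleKind.Hom D D') (c : Cycle D p n) : Cycle D' p n where
  Y := c.Y
  f := c.f
  smooth := c.smooth
  quasiProjective := c.quasiProjective
  projective := c.projective
  E := F.obj c.E

lemma IsRestriction.map (F : BundleKind.Hom D D') {c : Cycle D p n} {W : Scheme.{0}}
    {j : c.Y ⟶ W} {h : W ⟶ X} {E : D.Obj W} (H : c.IsRestriction j h E) :
    (c.map F).IsRestriction j h (F.obj E) :=
  ⟨H.1, F.isPullback H.2⟩

end Cycle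

section Group

variable (D : BundleKind) {X : Scheme.{0}} (p : X ⟶ SpecC) (n : ℕ)

/-- The relations which define the monoid of isomorphism classes of cycles under disjoint
union. -/
inductive monoidRel : Multiset (Cycle D p n) → Multiset (Cycle D p n) → Prop
  | iso (a b : Cycle D p n) : a.IsIsomorphic b → monoidRel {a} {b}
  | add (c a b : Cycle D p n) : c.IsDisjointUnion a b → monoidRel {c} {a, b}
  | zero (c : Cycle D p n) : IsEmpty c.Y → monoidRel {c} 0

/-- The monoid `ℳ_n(X)` of isomorphism classes of cycles, with disjoint union as addition,
presented by the cycles as generators and with the isomorphisms, the disjoint unions and the empty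
cycle as relations. (As every finite family of cycles has a disjoint union, every
element is the class of a single cycle, and two cycles have the same class if and only if they are
isomorphic.) -/
abbrev CycleMonoid : Type 1 := (addConGen (monoidRel D p n)).Quotient

/-- The group completion `ℳ_n(X)⁺`. -/
abbrev CycleGroup : Type 1 := Algebra.GrothendieckAddGroup (CycleMonoid D p n)

variable {D p n}

/-- The class of a cycle in `ℳ_n(X)`. -/
def Cycle.cls (c : Cycle D p n) : CycleMonoid D p n :=
  (addConGen (monoidRel D p n)).mk' {c}

/-- The class of a cycle in `ℳ_n(X)⁺`. -/
def Cycle.clsPlus (c : Cycle D p n) : CycleGroup D p n :=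
  Algebra.GrothendieckAddGroup.of c.cls

/-- `Y_ζ - A - B + ℙ(π)` is a double point relation over `X`: there are a
scheme `W` with bundle data `E` and a projective morphism `g : W ⟶ X × ℙ¹` such that
`π = pr₂ ∘ g` is a double point degeneration over `0` with fibre `A ∪ B`, such that
`Y_ζ` is the fibre of `π` over a regular value `ζ`, and such that `ℙ(π)` is the
projective bundle `ℙ(𝒪_D ⊕ N_{D/A})` over `D = A ∩ B`, all of them with the induced maps
to `X` and with the induced bundle data. -/
def IsDoublePointRelation (Yζ A B P : Cycle D p n) : Prop :=
  ∃ (W : Scheme.{0}) (E : D.Obj W) (g : W ⟶ pullback p P1.toSpecC)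
    (ζ : SpecC ⟶ P1) (jζ : Yζ.Y ⟶ W) (iA : A.Y ⟶ W) (iB : B.Y ⟶ W) (u : P.Y ⟶ pullback iA iB),
    IsProjective g ∧
    IsDoublePointDegeneration (g ≫ pullback.fst _ _ ≫ p) n (g ≫ pullback.snd _ _) iA iB ∧
    IsRegularValue (g ≫ pullback.snd _ _) ζ ∧
    CategoryTheory.IsPullback jζ (Yζ.f ≫ p) (g ≫ pullback.snd _ _) ζ ∧
    IsNormalProjectiveBundle u (pullback.fst iA iB) ∧
    Yζ.IsRestriction jζ (g ≫ pullback.fst _ _) E ∧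
    A.IsRestriction iA (g ≫ pullback.fst _ _) E ∧
    B.IsRestriction iB (g ≫ pullback.fst _ _) E ∧
    P.IsRestriction (u ≫ pullback.fst iA iB ≫ iA) (g ≫ pullback.fst _ _) E

variable (D p n)

/-- The subgroup `ℛ_n(X)` generated by the double point relations. -/
def relationSubgroup : AddSubgroup (CycleGroup D p n) :=
  AddSubgroup.closure {x | ∃ Yζ A B P : Cycle D p n, IsDoublePointRelation Yζ A B P ∧
    x = Yζ.clsPlus - A.clsPlus - B.clsPlus + P.clsPlus}

/-- The double point cobordism group `ω_n(X) = ℳ_n(X)⁺ / ℛ_n(X)` for bundle data of the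
kind `D`. -/
abbrev CobordismGroup : Type 1 := CycleGroup D p n ⧸ relationSubgroup D p n

/-- The total double point cobordism group `ω_*(X) = ⨁ n, ω_n(X)`. -/
abbrev TotalCobordism : Type 1 := DirectSum ℕ (CobordismGroup D p)

variable {D p n}

/-- The class of a cycle in `ω_*(X)`. -/
def Cycle.cobordismClass (c : Cycle D p n) : TotalCobordism D p :=
  DirectSum.of (CobordismGroup D p) n (QuotientAddGroup.mk c.clsPlus)

variable {D' : BundleKind}

lemma addConGen_monoidRel_le (F : BundleKind.Hom D D') :
    addConGen (monoidRel D p n) ≤ AddCon.ker ((addConGen (monoidRel D' p n)).mk'.comp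
      (Multiset.mapAddMonoidHom (Cycle.map F))) := by
  refine AddCon.addConGen_le.2 fun x y h => ?_
  rw [AddCon.ker_rel]
  cases h with
  | iso a b h =>
    obtain ⟨φ, h⟩ := h
    exact (AddCon.eq _).2 (AddConGen.Rel.of _ _ (.iso _ _ ⟨φ, h.map F⟩))
  | add c a b h =>
    obtain ⟨i, j, hc, ha, hb⟩ := h
    exact (AddCon.eq _).2 (AddConGen.Rel.of _ _ (.add _ _ _ ⟨i, j, hc, ha.map F, hb.map F⟩))
  | zero c h => exact (AddCon.eq _).2 (AddConGen.Rel.of _ _ (.zero _ h))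

variable (p n)

/-- The homomorphism of monoids `ℳ_n(X) ⟶ ℳ'_n(X)`, `[Y ⟶ X, E] ↦ [Y ⟶ X, F(E)]`, induced by an
operation `F` on bundle data. -/
def CycleMonoid.map (F : BundleKind.Hom D D') : CycleMonoid D p n →+ CycleMonoid D' p n :=
  AddCon.lift _ _ (addConGen_monoidRel_le F)

/-- The induced homomorphism of group completions. -/
def CycleGroup.map (F : BundleKind.Hom D D') : CycleGroup D p n →+ CycleGroup D' p n :=
  Algebra.GrothendieckAddGroup.lift
    (Algebra.GrothendieckAddGroup.of.comp (CycleMonoid.map p n F))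

variable {p n}

lemma CycleMonoid.map_cls (F : BundleKind.Hom D D') (c : Cycle D p n) :
    CycleMonoid.map p n F c.cls = (c.map F).cls :=
  rfl

lemma CycleGroup.map_clsPlus (F : BundleKind.Hom D D') (c : Cycle D p n) :
    CycleGroup.map p n F c.clsPlus = (c.map F).clsPlus := by
  have h := Algebra.GrothendieckAddGroup.lift.symm_apply_apply
    (Algebra.GrothendieckAddGroup.of.comp (CycleMonoid.map p n F))
  exact DFunLike.congr_fun h c.cls

lemma relationSubgroup_le (F : BundleKind.Hom D D') :
    relationSubgroup D p n ≤ (relationSubgroup D' p n).comap (CycleGroup.map p n F) := by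
  refine (AddSubgroup.closure_le _).2 ?_
  rintro _ ⟨Yζ, A, B, P, ⟨W, E, g, ζ, jζ, iA, iB, u, h₁, h₂, h₃, h₄, h₅, hY, hA, hB, hP⟩, rfl⟩
  refine AddSubgroup.subset_closure ⟨Yζ.map F, A.map F, B.map F, P.map F,
    ⟨W, F.obj E, g, ζ, jζ, iA, iB, u, h₁, h₂, h₃, h₄, h₅, hY.map F, hA.map F, hB.map F,
      hP.map F⟩, ?_⟩
  simp only [map_add, map_sub, CycleGroup.map_clsPlus]

variable (p)

/-- The homomorphism `ω_*(X) ⟶ ω'_*(X)` of cobordism groups which is induced by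
`[Y ⟶ X, E] ↦ [Y ⟶ X, F(E)]`. -/
def TotalCobordism.map (F : BundleKind.Hom D D') : TotalCobordism D p →+ TotalCobordism D' p :=
  DirectSum.map fun n => QuotientAddGroup.map _ _ (CycleGroup.map p n F) (relationSubgroup_le F)

variable {p}

lemma TotalCobordism.map_cobordismClass (F : BundleKind.Hom D D') (c : Cycle D p n) :
    TotalCobordism.map p F c.cobordismClass = (c.map F).cobordismClass := by
  simp only [TotalCobordism.map, Cycle.cobordismClass, DirectSum.map_of, QuotientAddGroup.map_mk,
    CycleGroup.map_clsPlus]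

end Group

/-- The graded group `ω_*(ℂ)` of smooth projective schemes without bundle data. -/
abbrev PointCobordism : ℕ → Type 1 := CobordismGroup noBundle (𝟙 SpecC)

/-- The multiplication of the graded ring `ω_*(ℂ)` is given by the products of cycles,
`[Z] · [Z'] = [Z × Z']`. -/
def MulIsProduct [DirectSum.GSemiring PointCobordism] : Prop :=
  ∀ (n m : ℕ) (z : Cycle noBundle (𝟙 SpecC) n) (z' : Cycle noBundle (𝟙 SpecC) m),
    ∃ c : Cycle noBundle (𝟙 SpecC) (n + m),
      c.IsProduct z z' ∧ z.cobordismClass * z'.cobordismClass = c.cobordismClass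

/-- The action of the graded ring `ω_*(ℂ)` on `ω_*(X)` is given by the products of cycles,
`[Z] · [Y ⟶ X, E] = [Z × Y ⟶ Y ⟶ X, pr₂^* E]`. -/
def ActionIsProduct (D : BundleKind) {X : Scheme.{0}} (p : X ⟶ SpecC)
    [DirectSum.GSemiring PointCobordism]
    [DirectSum.Gmodule PointCobordism (CobordismGroup D p)] : Prop :=
  ∀ (n m : ℕ) (z : Cycle noBundle (𝟙 SpecC) n) (y : Cycle D p m),
    ∃ c : Cycle D p (n + m),
      c.IsProduct z y ∧ z.cobordismClass • y.cobordismClass = c.cobordismClass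

end DoublePoint

end

open DoublePoint

/-!
A filtered bundle `E₁ ⊂ ⋯ ⊂ E_s` is cobordant to the split filtration of its associated graded
bundle, so that the split filtration of a graded bundle is an inverse of `gr`.

The cobordism is `W = Y × ℙ¹` with `π⁻¹(∞) = Y`, `A = π⁻¹(0) = Y` and `B = ∅`: bundle data on `W`
have the same class when restricted to `Y × 0` and to `Y × ∞` (`class_withData_eq`). To use it, the
pullback of the filtration to `W` is modified along the divisor `Y × 0`. If `σ : M ⟶ M(Y × 0)` is
the canonical section, then the modification at the step `j` is the pushout of `E` along `σ` on the
truncated filtration `E₁ ⊂ ⋯ ⊂ E_j = E_j = ⋯`. Over `∞` the section `σ` is an isomorphism and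
nothing changes. Over `0` the section `σ` vanishes, and the pushout along zero splits the inclusion
`E_j ⊂ E_{j+1}` (`isSplitMono_modification`), keeps the quotients `E_i / E_{i-1}`
(`quotients_modification_iso`), and leaves split the steps which are split already
(`isSplitMono_stepMap_modification`). This is `exists_deformation`. Doing it for `j = 1, 2, …`
(`exists_split_steps`) one arrives at the split filtration (`class_split_gr`). The module `M(Y × 0)`
is glued by hand from `M` on the two open subschemes given by the coordinates of `ℙ¹`
(`TwistDatum`). That a modification is again filtered, that is, that its quotients are locally free,
can be checked on these open subschemes. The map `list` is bijective already on isomorphism classes,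
since a direct sum is determined by its summands (`gradedBundles_isPullback_iff`).

The products are well defined because a double point relation defined by `W` remains one after
taking the product with any `Y` or `Z`. Both cases are instances of
`isDoublePointRelation_of_isPullback`, about `W'` smooth over `W`: the four terms are compatible
with the flat base change `W' ⟶ W`. For the intersection `A ∩ B`, and for its conormal sheaf in `A`,
this follows from flatness (`comap_inf_of_flat`, `conormalPullbackIso`), and for `ℙ(𝒪 ⊕ N)` from the
description of its points by quotient line bundles (`IsNormalProjectiveBundle.of_isPullback`).
Products of quasi-projective schemes, and compositions of projective morphisms, require the Segre
embedding (`isClosedImmersion_segre`). This gives the biadditive `pairing`. Products of cycles are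
unique up to isomorphism (`Cycle.IsProduct.isIsomorphic`), hence the pairing is associative,
commutative and unital, and operations on bundle data which commute with pullbacks are linear over
`ω_*(ℂ)` (`TotalCobordism.map_smul`).
-/

noncomputable section

namespace DoublePoint

/-! ### Modules: sections, epimorphisms and pullbacks of free modules -/

section

open Scheme.Modules
variable {X Y Z : Scheme.{0}}

lemma mono_iff_injective {M N : Y.Modules} (φ : M ⟶ N) :
    Mono φ ↔ ∀ U, Function.Injective (φ.app U) := by
  constructor
  · intro h U
    have h1 : Mono ((toPresheaf Y).map φ) := inferInstance
    have h2 := (NatTrans.mono_iff_mono_app _).1 h1 (.op U)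
    exact (AddCommGrpCat.mono_iff_injective _).1 h2
  · intro h
    refine (toPresheaf Y).mono_of_mono_map ?_
    refine (NatTrans.mono_iff_mono_app _).2 fun U => (AddCommGrpCat.mono_iff_injective _).2
      (h U.unop)

lemma section_ext {M : Y.Modules} {U : Y.Opens} (s t : Γ(M, U))
    (h : ∀ x ∈ U, ∃ (V : Y.Opens) (hV : V ≤ U), x ∈ V ∧
      M.presheaf.map (homOfLE hV).op s = M.presheaf.map (homOfLE hV).op t) : s = t := by
  choose V hV hx e using h
  refine TopCat.Sheaf.eq_of_locally_eq' ⟨M.presheaf, M.isSheaf⟩ (fun x : U => V x.1 x.2) U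
    (fun x => homOfLE (hV x.1 x.2)) ?_ s t fun x => e x.1 x.2
  intro x hxU
  exact TopologicalSpace.Opens.mem_iSup.2 ⟨⟨x, hxU⟩, hx x hxU⟩

/-- Surjectivity of a morphism of modules on sections, locally. -/
def IsLocallySurj {M N : Y.Modules} (φ : M ⟶ N) : Prop :=
  ∀ (U : Y.Opens) (s : Γ(N, U)), ∀ x ∈ U, ∃ (V : Y.Opens) (hV : V ≤ U) (t : Γ(M, V)), x ∈ V ∧
    φ.app V t = N.presheaf.map (homOfLE hV).op s

lemma app_map {M N : Y.Modules} (φ : M ⟶ N) {U V : Y.Opens} (h : V ≤ U) (s : Γ(M, U)) :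
    φ.app V (M.presheaf.map (homOfLE h).op s) = N.presheaf.map (homOfLE h).op (φ.app U s) :=
  CategoryTheory.congr_fun (φ.mapPresheaf.naturality (homOfLE h).op) s

lemma IsLocallySurj.epi {M N : Y.Modules} {φ : M ⟶ N} (h : IsLocallySurj φ) : Epi φ := by
  refine ⟨fun {K} f g e => hom_ext _ _ fun U => ?_⟩
  ext s
  refine section_ext _ _ fun x hx => ?_
  obtain ⟨V, hV, t, hxV, ht⟩ := h U s x hx
  refine ⟨V, hV, hxV, ?_⟩
  rw [← app_map, ← app_map, ← ht]
  exact congr($(congrArg (fun k : M ⟶ K => k.app V) e) t)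

/-- An epimorphism is locally surjective, because the sheafification of its presheaf cokernel
vanishes. -/
lemma isLocallySurj_of_epi {M N : Y.Modules} (φ : M ⟶ N) [Epi φ] : IsLocallySurj φ := by
  intro U s x hx
  let adj := PresheafOfModules.sheafificationAdjunction (𝟙 Y.ringCatSheaf.obj)
  let Q := cokernel φ.val
  let S : Y.Modules := (PresheafOfModules.sheafification (𝟙 Y.ringCatSheaf.obj)).obj Q
  let η : Q ⟶ S.val := adj.unit.app Q
  let ψ : N ⟶ S := SheafOfModules.Hom.mk (cokernel.π φ.val ≫ η)
  have h0 : φ ≫ ψ = 0 := by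
    refine SheafOfModules.hom_ext ?_
    change φ.val ≫ cokernel.π φ.val ≫ η = 0
    simp
  have h1 : ψ = 0 := by
    rw [← cancel_epi φ, h0, comp_zero]
  have h2 : cokernel.π φ.val ≫ η = 0 := congrArg SheafOfModules.Hom.val h1
  have h3 : Presheaf.IsLocallyInjective (Opens.grothendieckTopology Y)
      ((PresheafOfModules.toPresheaf _).map η) := by
    have e : (PresheafOfModules.toPresheaf _).map η =
        CategoryTheory.toSheafify (Opens.grothendieckTopology Y) Q.presheaf :=
      PresheafOfModules.toPresheaf_map_sheafificationAdjunction_unit_app _ _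
    rw [e]
    exact ((GrothendieckTopology.W_iff_isLocallyBijective _ _).1
      ((Opens.grothendieckTopology Y).W_toSheafify Q.presheaf)).1
  have h5 : η.app (.op U) ((cokernel.π φ.val).app (.op U) s) = 0 :=
    congr($(congrArg (fun k : N.val ⟶ S.val => k.app (.op U)) h2) s)
  have h6 := h3.equalizerSieve_mem (X := .op U) ((cokernel.π φ.val).app (.op U) s) 0
    (by
      refine Eq.trans h5 ?_
      exact (map_zero _).symm)
  obtain ⟨V, i, hV, hxV⟩ := h6 x hx
  have h7 : (cokernel.π φ.val).app (.op V) (N.presheaf.map i.op s) = 0 := by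
    have := CategoryTheory.congr_fun
      (((PresheafOfModules.toPresheaf _).map (cokernel.π φ.val)).naturality i.op) s
    refine Eq.trans this ?_
    exact hV.trans (map_zero _)
  have h8 : (ShortComplex.mk φ.val (cokernel.π φ.val) (cokernel.condition _)).Exact :=
    ShortComplex.exact_cokernel _
  have h9 := h8.map (PresheafOfModules.evaluation _ (.op V))
  obtain ⟨t, ht⟩ := (ShortComplex.moduleCat_exact_iff _).1 h9 _ h7
  exact ⟨V, leOfHom i, t, hxV, ht⟩

/-- Inverse images of open sets form a final functor, as `⊤` is the inverse image of `⊤`. This is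
what makes the pullback of the structure sheaf the structure sheaf. -/
instance final_opensMap (f : X ⟶ Y) : (TopologicalSpace.Opens.map f.base).Final := by
  refine ⟨fun U => ?_⟩
  have : HasTerminal (StructuredArrow U (TopologicalSpace.Opens.map f.base)) := by
    refine IsTerminal.hasTerminal (X := StructuredArrow.mk (Y := (⊤ : TopologicalSpace.Opens Y))
      (homOfLE le_top)) ?_
    exact IsTerminal.ofUniqueHom (fun A => StructuredArrow.homMk (homOfLE le_top) rfl)
      (fun A m => by ext; rfl)
  exact isConnected_of_hasTerminal _

/-- A form of the instance in which the sites are not unfolded to those of a scheme. -/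
lemma isIso_pullbackObjUnitToUnit {C D : Type} [Category C] [Category D]
    {J : GrothendieckTopology C} {K : GrothendieckTopology D} {F : C ⥤ D}
    {S : Sheaf J RingCat.{0}} {R : Sheaf K RingCat.{0}} [Functor.IsContinuous F J K]
    (φ : S ⟶ (F.sheafPushforwardContinuous RingCat.{0} J K).obj R)
    [(SheafOfModules.pushforward.{0} φ).IsRightAdjoint] [F.Final] :
    IsIso (SheafOfModules.pullbackObjUnitToUnit φ) := inferInstance

/-- Free modules pull back to free modules. -/
def pullbackFreeIso (f : X ⟶ Y) (r : ℕ) :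
    (Scheme.Modules.pullback f).obj (freeModule Y r) ≅ freeModule X r :=
  haveI : (SheafOfModules.pushforward.{0} f.toRingCatSheafHom).IsRightAdjoint :=
    (pullbackPushforwardAdjunction f).isRightAdjoint
  SheafOfModules.pullbackObjFreeIso f.toRingCatSheafHom (Fin r)

/-- The structure sheaf pulls back to the structure sheaf. -/
def pullbackUnitIso (f : X ⟶ Y) :
    (Scheme.Modules.pullback f).obj (structureModule Y) ≅ structureModule X :=
  haveI : (SheafOfModules.pushforward.{0} f.toRingCatSheafHom).IsRightAdjoint :=
    (pullbackPushforwardAdjunction f).isRightAdjoint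
  @asIso _ _ _ _ (SheafOfModules.pullbackObjUnitToUnit f.toRingCatSheafHom)
    (isIso_pullbackObjUnitToUnit f.toRingCatSheafHom)

/-- Multiplication by a global function, as an endomorphism of the identity functor of the
category of modules. -/
def globalSMul (t : Γ(Y, ⊤)) : 𝟭 Y.Modules ⟶ 𝟭 Y.Modules where
  app M := SheafOfModules.Hom.mk (PresheafOfModules.homMk (M₁ := M.val) (M₂ := M.val)
    { app U := M.smul (Y.presheaf.map (homOfLE le_top).op t)
      naturality := fun U V i => by
        have := map_comp_smul (M := M) i.unop (Y.presheaf.map (homOfLE le_top).op t)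
        rw [← CategoryTheory.comp_apply, ← Functor.map_comp] at this
        exact this.symm }
    (fun U r m => by
      exact smul_comm (M := Γ(Y, U.unop)) (N := Γ(Y, U.unop)) (α := Γ(M, U.unop)) _ r m))
  naturality M N φ := by
    refine hom_ext _ _ fun U => ?_
    ext s
    exact (φ.app_smul _ _).symm

lemma globalSMul_app_app (t : Γ(Y, ⊤)) (M : Y.Modules) (U : Y.Opens) (s : Γ(M, U)) :
    ((globalSMul t).app M).app U s = Y.presheaf.map (homOfLE (le_top : U ≤ ⊤)).op t •
      (show Γ(M, U) from s) := rfl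

lemma pushforward_globalSMul (f : X ⟶ Y) (t : Γ(Y, ⊤)) (M : X.Modules) :
    (pushforward f).map ((globalSMul (f.appTop t)).app M) =
      (globalSMul t).app ((pushforward f).obj M) := by
  refine hom_ext _ _ fun U => ?_
  ext s
  change X.presheaf.map (homOfLE (le_top : f ⁻¹ᵁ U ≤ ⊤)).op (f.appTop t) •
    (show Γ(M, f ⁻¹ᵁ U) from s) =
    (f.app U) (Y.presheaf.map (homOfLE (le_top : U ≤ ⊤)).op t) • (show Γ(M, f ⁻¹ᵁ U) from s)
  congr 1
  exact (CategoryTheory.congr_fun (f.naturality (homOfLE le_top).op) t).symm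

lemma pullback_globalSMul (f : X ⟶ Y) (t : Γ(Y, ⊤)) (M : Y.Modules) :
    (Scheme.Modules.pullback f).map ((globalSMul t).app M) =
      (globalSMul (f.appTop t)).app ((Scheme.Modules.pullback f).obj M) := by
  apply ((pullbackPushforwardAdjunction f).homEquiv _ _).injective
  rw [Adjunction.homEquiv_unit, Adjunction.homEquiv_unit, pushforward_globalSMul]
  have h1 := (pullbackPushforwardAdjunction f).unit.naturality ((globalSMul t).app M)
  have h2 := (globalSMul t).naturality ((pullbackPushforwardAdjunction f).unit.app M)
  exact h1.symm.trans h2.symm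

end

/-! ### Restriction to open subschemes and local freeness -/

section

open Scheme.Modules
variable {X Y Z : Scheme.{0}}

instance (f : X ⟶ Y) [IsOpenImmersion f] : (restrictFunctor f).PreservesMonomorphisms where
  preserves φ hφ := (mono_iff_injective _).2 fun U => (mono_iff_injective φ).1 hφ (f ''ᵁ U)

instance preservesLimits_restrictFunctor (f : X ⟶ Y) [IsOpenImmersion f] :
    PreservesLimits (restrictFunctor f) := by
  have : PreservesLimits (restrictFunctor f ⋙ toPresheaf X) := by
    have e : restrictFunctor f ⋙ toPresheaf X ≅
      toPresheaf Y ⋙ (Functor.whiskeringLeft _ _ Ab).obj f.opensFunctor.op := Iso.refl _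
    have : PreservesLimits ((Functor.whiskeringLeft _ _ Ab).obj f.opensFunctor.op) := inferInstance
    have := comp_preservesLimits (toPresheaf Y)
      ((Functor.whiskeringLeft _ _ Ab).obj f.opensFunctor.op)
    exact preservesLimits_of_natIso e.symm
  have : HasLimits (TopCat.Presheaf Ab.{0} X) := inferInstanceAs (HasLimits (_ ⥤ _))
  have : ReflectsLimits (toPresheaf X) := reflectsLimits_of_reflectsIsomorphisms
  exact preservesLimits_of_reflects_of_preserves _ (toPresheaf X)

instance (f : X ⟶ Y) [IsOpenImmersion f] : (restrictFunctor f).Additive := by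
  have := preservesBinaryBiproducts_of_preservesBinaryProducts (restrictFunctor f)
  exact Functor.additive_of_preservesBinaryBiproducts _

lemma mono_of_restrict {M N : Y.Modules} (φ : M ⟶ N)
    (h : ∀ y : Y, ∃ (V : Scheme.{0}) (j : V ⟶ Y) (_ : IsOpenImmersion j),
      y ∈ j.opensRange ∧ Mono ((restrictFunctor j).map φ)) : Mono φ := by
  refine (mono_iff_injective φ).2 fun U s t hst => section_ext _ _ fun x hx => ?_
  obtain ⟨V, j, _, ⟨z, rfl⟩, hm⟩ := h x
  refine ⟨j ''ᵁ (j ⁻¹ᵁ U), j.image_preimage_le U, ⟨z, hx, rfl⟩, ?_⟩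
  apply (mono_iff_injective _).1 hm (j ⁻¹ᵁ U)
  change φ.app _ _ = φ.app _ _
  rw [app_map, app_map, hst]

/-- Pullback and restriction to open subschemes commute. -/
def pullbackRestrictIso {U V : Scheme.{0}} (f : X ⟶ Y) (j : U ⟶ X) (k : V ⟶ Y) (g : U ⟶ V)
    [IsOpenImmersion j] [IsOpenImmersion k] (h : j ≫ f = g ≫ k) :
    Scheme.Modules.pullback f ⋙ restrictFunctor j ≅
      restrictFunctor k ⋙ Scheme.Modules.pullback g :=
  Functor.isoWhiskerLeft _ (restrictFunctorIsoPullback j) ≪≫ pullbackComp j f ≪≫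
    pullbackCongr h ≪≫ (pullbackComp g k).symm ≪≫
      Functor.isoWhiskerRight (restrictFunctorIsoPullback k).symm _

/-- Free modules restrict to free modules. -/
def restrictFreeIso (j : X ⟶ Y) [IsOpenImmersion j] (r : ℕ) :
    (freeModule Y r).restrict j ≅ freeModule X r :=
  (restrictFunctorIsoPullback j).app _ ≪≫ pullbackFreeIso j r

/-- Local freeness can be tested on arbitrary open immersions instead of open subschemes. -/
lemma isLocallyFree_iff {r : ℕ} {E : Y.Modules} : IsLocallyFreeOfRank r E ↔
    ∀ y : Y, ∃ (V : Scheme.{0}) (j : V ⟶ Y) (_ : IsOpenImmersion j),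
      y ∈ j.opensRange ∧ Nonempty (E.restrict j ≅ freeModule V r) := by
  constructor
  · intro h y
    obtain ⟨U, hy, ⟨e⟩⟩ := h y
    exact ⟨U, U.ι, inferInstance, by simpa using hy, ⟨e⟩⟩
  · intro h y
    obtain ⟨V, j, _, hy, ⟨e⟩⟩ := h y
    refine ⟨j.opensRange, hy, ⟨?_⟩⟩
    have hh : j.isoOpensRange.inv ≫ j = j.opensRange.ι := by simp
    exact (restrictFunctorCongr hh).symm.app E ≪≫
      (restrictFunctorComp j.isoOpensRange.inv j).app E ≪≫
        (restrictFunctor j.isoOpensRange.inv).mapIso e ≪≫ restrictFreeIso _ _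

lemma IsLocallyFreeOfRank.of_iso {r : ℕ} {E E' : Y.Modules} (h : IsLocallyFreeOfRank r E)
    (e : E ≅ E') : IsLocallyFreeOfRank r E' := fun y => by
  obtain ⟨U, hy, ⟨i⟩⟩ := h y
  exact ⟨U, hy, ⟨(restrictFunctor U.ι).mapIso e.symm ≪≫ i⟩⟩

lemma IsLocallyFreeOfRank.pullback {r : ℕ} {E : Y.Modules} (h : IsLocallyFreeOfRank r E)
    (f : X ⟶ Y) : IsLocallyFreeOfRank r ((Scheme.Modules.pullback f).obj E) := fun x => by
  obtain ⟨U, hy, ⟨i⟩⟩ := h (f x)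
  exact ⟨f ⁻¹ᵁ U, hy, ⟨(pullbackRestrictIso f (f ⁻¹ᵁ U).ι U.ι (f ∣_ U) (by simp)).app E ≪≫
    (Scheme.Modules.pullback _).mapIso i ≪≫ pullbackFreeIso _ _⟩⟩

lemma IsLocallyFreeOfRank.of_restrict {r : ℕ} {E : Y.Modules}
    (h : ∀ y : Y, ∃ (V : Scheme.{0}) (j : V ⟶ Y) (_ : IsOpenImmersion j),
      y ∈ j.opensRange ∧ IsLocallyFreeOfRank r (E.restrict j)) : IsLocallyFreeOfRank r E := by
  refine isLocallyFree_iff.2 fun y => ?_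
  obtain ⟨V, j, _, ⟨z, rfl⟩, h⟩ := h y
  obtain ⟨W, k, _, ⟨w, rfl⟩, ⟨e⟩⟩ := isLocallyFree_iff.1 h z
  exact ⟨W, k ≫ j, inferInstance, ⟨w, by simp⟩, ⟨(restrictFunctorComp k j).app E ≪≫ e⟩⟩

/-- A morphism which is a split monomorphism locally. -/
def IsLocallySplitMono {M N : Y.Modules} (φ : M ⟶ N) : Prop :=
  ∀ y : Y, ∃ (V : Scheme.{0}) (j : V ⟶ Y) (_ : IsOpenImmersion j),
      y ∈ j.opensRange ∧ IsSplitMono ((restrictFunctor j).map φ)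

lemma IsLocallySplitMono.mono {M N : Y.Modules} {φ : M ⟶ N} (h : IsLocallySplitMono φ) : Mono φ :=
  mono_of_restrict φ fun y => by
    obtain ⟨V, j, hj, hy, hi⟩ := h y
    exact ⟨V, j, hj, hy, inferInstance⟩

lemma isSplitMono_map_iff_of_natIso {C D : Type*} [Category* C] [Category* D] {F G : C ⥤ D}
    (e : F ≅ G) {A B : C} (f : A ⟶ B) (h : IsSplitMono (F.map f)) : IsSplitMono (G.map f) := by
  obtain ⟨⟨r, hr⟩⟩ := h
  refine ⟨⟨e.inv.app B ≫ r ≫ e.hom.app A, ?_⟩⟩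
  rw [e.inv.naturality_assoc, reassoc_of% hr]
  simp

lemma IsLocallySplitMono.pullback {M N : Y.Modules} {φ : M ⟶ N} (h : IsLocallySplitMono φ)
    (f : X ⟶ Y) : IsLocallySplitMono ((Scheme.Modules.pullback f).map φ) := by
  intro x
  obtain ⟨V, j, hj, hy, hi⟩ := h (f x)
  refine ⟨Limits.pullback f j, Limits.pullback.fst f j, inferInstance, ?_, ?_⟩
  · rw [Scheme.Hom.opensRange_pullbackFst]
    exact hy
  · exact isSplitMono_map_iff_of_natIso
      (pullbackRestrictIso f (Limits.pullback.fst f j) j (Limits.pullback.snd f j)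
        Limits.pullback.condition).symm φ
      (inferInstanceAs (IsSplitMono ((Scheme.Modules.pullback _).map ((restrictFunctor j).map φ))))

end

/-! ### Extensions of vector bundles -/

section

open Scheme.Modules
variable {X Y Z : Scheme.{0}}

/-- The additive map `s ↦ s • b` on sections. -/
def smulSection {B : Y.Modules} {U : Y.Opens} (b : Γ(B, U)) : Γ(Y, U) →+ Γ(B, U) :=
  AddMonoidHom.mk' (fun s => s • b) (fun s t => add_smul s t b)

/-- The morphism from the structure sheaf of an open subscheme which is given by a section. -/
def restrictUnitDesc (j : X ⟶ Y) [IsOpenImmersion j] {B : Y.Modules} (b : Γ(B, j ''ᵁ ⊤)) :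
    (structureModule Y).restrict j ⟶ B.restrict j :=
  SheafOfModules.Hom.mk (PresheafOfModules.homMk
    (M₁ := ((structureModule Y).restrict j).val) (M₂ := (B.restrict j).val)
    { app U := AddCommGrpCat.ofHom (smulSection
        (B.presheaf.map (homOfLE (Scheme.Hom.image_mono j (le_top : U.unop ≤ ⊤))).op b))
      naturality := fun U V i => by
        ext s
        refine Eq.trans ?_ (map_smul (M := B) (j.opensFunctor.map i.unop) (s : Γ(Y, j ''ᵁ U.unop))
          (B.presheaf.map (homOfLE (Scheme.Hom.image_mono j le_top)).op b)).symm
        rw [← CategoryTheory.comp_apply, ← Functor.map_comp]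
        rfl }
    (fun U (r : Γ(X, U.unop)) (m : Γ(Y, j ''ᵁ U.unop)) =>
      mul_smul (α := Γ(Y, j ''ᵁ U.unop)) (β := Γ(B, j ''ᵁ U.unop))
        ((j.appIso U.unop).inv r) m _))

lemma unit_hom_app {B : Y.Modules} (c : structureModule Y ⟶ B) (U : Y.Opens) (s : Γ(Y, U)) :
    c.app U s = s • c.app U (1 : Γ(Y, U)) := by
  have := c.app_smul s (1 : Γ(Y, U))
  refine Eq.trans ?_ this
  congr 1
  exact (mul_one s).symm

lemma map_app_one {B : Y.Modules} (c : structureModule Y ⟶ B) {U V : Y.Opens} (h : V ≤ U) :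
    B.presheaf.map (homOfLE h).op (c.app U (1 : Γ(Y, U))) = c.app V (1 : Γ(Y, V)) :=
  (app_map c h (1 : Γ(Y, U))).symm.trans
    (congrArg (c.app V) (map_one (Y.presheaf.map (homOfLE h).op).hom))

/-- A finite family of global sections of a quotient lifts locally. -/
lemma exists_lift_unit {B C : Y.Modules} (p : B ⟶ C) [Epi p] {r : ℕ}
    (c : Fin r → (structureModule Y ⟶ C)) (y : Y) :
    ∃ V : Y.Opens, y ∈ V ∧ ∀ i, ∃ b : (structureModule Y).restrict V.ι ⟶ B.restrict V.ι,
      b ≫ (restrictFunctor V.ι).map p = (restrictFunctor V.ι).map (c i) := by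
  have key := fun i => isLocallySurj_of_epi p ⊤ ((c i).app ⊤ (1 : Γ(Y, ⊤))) y trivial
  choose V hV t hy ht using key
  refine ⟨Finset.univ.inf V, ?_, fun i => ?_⟩
  · rw [← SetLike.mem_coe, TopologicalSpace.Opens.coe_finset_inf]
    simpa using hy
  set W := Finset.univ.inf V
  have hW : W.ι ''ᵁ ⊤ ≤ V i := by
    rw [Scheme.Opens.ι_image_top]
    exact Finset.inf_le (Finset.mem_univ i)
  refine ⟨restrictUnitDesc W.ι (B.presheaf.map (homOfLE hW).op (t i)), hom_ext _ _ fun U => ?_⟩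
  ext s
  have key (s : Γ(Y, W.ι ''ᵁ U)) : p.app (W.ι ''ᵁ U) (s •
      B.presheaf.map (homOfLE (Scheme.Hom.image_mono W.ι le_top)).op
        (B.presheaf.map (homOfLE hW).op (t i))) = (c i).app (W.ι ''ᵁ U) s := by
    rw [Hom.app_smul, app_map, app_map, ht, unit_hom_app (c i) _ s]
    rw [map_app_one, map_app_one, map_app_one]
  exact key s

lemma exists_section_of_free {B C : Y.Modules} (p : B ⟶ C) [Epi p] {r : ℕ}
    (e : C ≅ freeModule Y r) (y : Y) :
    ∃ V : Y.Opens, y ∈ V ∧ ∃ b : C.restrict V.ι ⟶ B.restrict V.ι,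
      b ≫ (restrictFunctor V.ι).map p = 𝟙 _ := by
  let ι : Fin r → (structureModule Y ⟶ freeModule Y r) := fun i => SheafOfModules.ιFree i
  obtain ⟨V, hy, h⟩ := exists_lift_unit p (fun i => ι i ≫ e.inv) y
  choose b hb using h
  refine ⟨V, hy, ?_⟩
  let hc : IsColimit (Cofan.mk (freeModule Y r) ι) :=
      coproductIsCoproduct (C := Y.Modules) (fun _ : Fin r => structureModule Y)
  let hd := isColimitCofanMkObjOfIsColimit (restrictFunctor V.ι) _ _ hc
  refine ⟨(restrictFunctor V.ι).map e.hom ≫ Cofan.IsColimit.desc hd b, ?_⟩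
  have : Cofan.IsColimit.desc hd b ≫ (restrictFunctor V.ι).map p =
      (restrictFunctor V.ι).map e.inv := by
    refine Cofan.IsColimit.hom_ext hd _ _ fun i => ?_
    rw [Cofan.IsColimit.fac_assoc, hb]
    exact Functor.map_comp _ _ _
  rw [Category.assoc, this, ← Functor.map_comp, e.hom_inv_id, CategoryTheory.Functor.map_id]

lemma nonempty_splitting_of_section {C : Type*} [Category* C] [Abelian C]
    {A B Q : C} (f : A ⟶ B) [Mono f]
    (p : B ⟶ Q) (w : f ≫ p = 0) (hp : IsColimit (CokernelCofork.ofπ p w))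
    (s : Q ⟶ B) (hs : s ≫ p = 𝟙 _) : Nonempty (ShortComplex.mk f p w).Splitting := by
  have : Epi p := Cofork.IsColimit.epi hp
  have hS : (ShortComplex.mk f p w).ShortExact := by
    refine ShortComplex.ShortExact.mk' ?_ inferInstance inferInstance
    exact ShortComplex.exact_of_g_is_cokernel _ hp
  exact ⟨ShortComplex.Splitting.ofExactOfSection _ hS.exact s hs inferInstance⟩

/-- The direct sum of the free modules of ranks `a` and `c` is free of rank `a + c`. -/
def freeAddIso (a c : ℕ) : freeModule Y a ⊞ freeModule Y c ≅ freeModule Y (a + c) := by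
  let ι (n : ℕ) (i : Fin n) : structureModule Y ⟶ freeModule Y n := SheafOfModules.ιFree i
  let hc (n : ℕ) : IsColimit (Cofan.mk (freeModule Y n) (ι n)) :=
      coproductIsCoproduct (C := Y.Modules) (fun _ : Fin n => structureModule Y)
  have h₁ (i) : ι a i ≫ Cofan.IsColimit.desc (hc a) (fun i => ι (a + c) (Fin.castAdd c i)) = _ :=
    Cofan.IsColimit.fac (hc a) _ i
  have h₂ (i) : ι c i ≫ Cofan.IsColimit.desc (hc c) (fun i => ι (a + c) (Fin.natAdd a i)) = _ :=
    Cofan.IsColimit.fac (hc c) _ i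
  have h₃ (i) : ι (a + c) i ≫ Cofan.IsColimit.desc (hc (a + c))
      (Fin.addCases (fun i => ι _ i ≫ biprod.inl) (fun i => ι _ i ≫ biprod.inr)) = _ :=
    Cofan.IsColimit.fac (hc (a + c)) _ i
  refine ⟨biprod.desc (Cofan.IsColimit.desc (hc a) fun i => ι _ (Fin.castAdd c i))
    (Cofan.IsColimit.desc (hc c) fun i => ι _ (Fin.natAdd a i)),
    Cofan.IsColimit.desc (hc (a + c)) (Fin.addCases (fun i => ι _ i ≫ biprod.inl)
      (fun i => ι _ i ≫ biprod.inr)), ?_, ?_⟩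
  · refine biprod.hom_ext' _ _ ?_ ?_
    · refine Cofan.IsColimit.hom_ext (hc a) _ _ fun i => ?_
      change ι a i ≫ _ = ι a i ≫ _
      rw [biprod.inl_desc_assoc, reassoc_of% (h₁ i), h₃, Fin.addCases_left, Category.comp_id]
    · refine Cofan.IsColimit.hom_ext (hc c) _ _ fun i => ?_
      change ι c i ≫ _ = ι c i ≫ _
      rw [biprod.inr_desc_assoc, reassoc_of% (h₂ i), h₃, Fin.addCases_right, Category.comp_id]
  · refine Cofan.IsColimit.hom_ext (hc (a + c)) _ _ fun i => ?_
    change ι (a + c) i ≫ _ = ι (a + c) i ≫ _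
    rw [reassoc_of% (h₃ i), Category.comp_id]
    refine Fin.addCases (fun i => ?_) (fun i => ?_) i
    · rw [Fin.addCases_left, Category.assoc, biprod.inl_desc, h₁]
    · rw [Fin.addCases_right, Category.assoc, biprod.inr_desc, h₂]

/-- A short exact sequence of modules splits locally if its last term is a vector bundle. -/
lemma exists_splitting {A B : Y.Modules} (f : A ⟶ B) [Mono f] {r : ℕ}
    (h : IsLocallyFreeOfRank r (cokernel f)) (y : Y) :
    ∃ (V : Scheme.{0}) (j : V ⟶ Y) (_ : IsOpenImmersion j), y ∈ j.opensRange ∧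
      ∃ w, Nonempty (ShortComplex.mk ((restrictFunctor j).map f)
        ((restrictFunctor j).map (cokernel.π f)) w).Splitting := by
  obtain ⟨U, hy, ⟨e⟩⟩ := h y
  obtain ⟨V, hV, b, hb⟩ := exists_section_of_free ((restrictFunctor U.ι).map (cokernel.π f)) e
    ⟨y, hy⟩
  have w : (restrictFunctor (V.ι ≫ U.ι)).map f ≫
    (restrictFunctor (V.ι ≫ U.ι)).map (cokernel.π f) = 0 := by
    rw [← Functor.map_comp, cokernel.condition, Functor.map_zero]
  refine ⟨V, V.ι ≫ U.ι, inferInstance, ⟨⟨⟨y, hy⟩, hV⟩, rfl⟩, w, ?_⟩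
  let α := restrictFunctorComp V.ι U.ι
  refine nonempty_splitting_of_section _ _ w ?_ (α.hom.app _ ≫ b ≫ α.inv.app _) ?_
  · exact isColimitCoforkMapOfIsColimit' (restrictFunctor (V.ι ≫ U.ι))
      (cokernel.condition f) (cokernelIsCokernel f)
  · have := α.inv.naturality (cokernel.π f)
    rw [Category.assoc, Category.assoc, ← this]
    erw [reassoc_of% hb]
    simp

lemma isLocallySplitMono_of_cokernel {A B : Y.Modules} (f : A ⟶ B) [Mono f] {r : ℕ}
    (h : IsLocallyFreeOfRank r (cokernel f)) : IsLocallySplitMono f := fun y => by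
  obtain ⟨V, j, hj, hy, w, ⟨σ⟩⟩ := exists_splitting f h y
  exact ⟨V, j, hj, hy, ⟨⟨σ.r, σ.f_r⟩⟩⟩

lemma IsLocallyFreeOfRank.restrict {r : ℕ} {E : Y.Modules} (h : IsLocallyFreeOfRank r E)
    (j : X ⟶ Y) [IsOpenImmersion j] : IsLocallyFreeOfRank r (E.restrict j) :=
  (h.pullback j).of_iso ((restrictFunctorIsoPullback j).symm.app E)

/-- Two vector bundles are simultaneously trivial near any point. -/
lemma IsLocallyFreeOfRank.exists_trivial₂ {a c : ℕ} {A C : Y.Modules}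
    (hA : IsLocallyFreeOfRank a A) (hC : IsLocallyFreeOfRank c C) (y : Y) :
    ∃ (V : Scheme.{0}) (j : V ⟶ Y) (_ : IsOpenImmersion j), y ∈ j.opensRange ∧
      Nonempty (A.restrict j ≅ freeModule V a) ∧ Nonempty (C.restrict j ≅ freeModule V c) := by
  obtain ⟨U, hy, ⟨e⟩⟩ := hA y
  obtain ⟨V, hV, ⟨e'⟩⟩ := hC.restrict U.ι ⟨y, hy⟩
  exact ⟨V, V.ι ≫ U.ι, inferInstance, ⟨⟨⟨y, hy⟩, hV⟩, rfl⟩,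
    ⟨(restrictFunctorComp V.ι U.ι).app A ≪≫ (restrictFunctor V.ι).mapIso e ≪≫ restrictFreeIso _ _⟩,
    ⟨(restrictFunctorComp V.ι U.ι).app C ≪≫ e'⟩⟩

lemma IsLocallyFreeOfRank.biprod {a c : ℕ} {A C : Y.Modules}
    (hA : IsLocallyFreeOfRank a A) (hC : IsLocallyFreeOfRank c C) :
    IsLocallyFreeOfRank (a + c) (A ⊞ C) := by
  refine isLocallyFree_iff.2 fun y => ?_
  obtain ⟨V, j, _, hy, ⟨e⟩, ⟨e'⟩⟩ := hA.exists_trivial₂ hC y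
  have : PreservesBinaryBiproducts (restrictFunctor j) :=
    preservesBinaryBiproducts_of_preservesBinaryProducts (restrictFunctor j)
  exact ⟨V, j, inferInstance, hy, ⟨(restrictFunctor j).mapBiprod A C ≪≫ biprod.mapIso e e' ≪≫
    freeAddIso a c⟩⟩

/-- An extension of vector bundles is a vector bundle. -/
lemma IsLocallyFreeOfRank.extension {A B : Y.Modules} (f : A ⟶ B) [Mono f] {a r : ℕ}
    (hA : IsLocallyFreeOfRank a A) (h : IsLocallyFreeOfRank r (cokernel f)) :
    IsLocallyFreeOfRank (a + r) B := by
  refine .of_restrict fun y => ?_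
  obtain ⟨V, j, hj, hy, w, ⟨σ⟩⟩ := exists_splitting f h y
  exact ⟨V, j, hj, hy, ((hA.restrict j).biprod (h.restrict j)).of_iso σ.isoBinaryBiproduct.symm⟩

end

/-! ### Modifications of filtrations and split filtrations -/

section

section Category
variable {C C' : Type*} [Category* C] [Category* C']

/-- The cokernels of the two parallel maps of a pushout square agree. -/
def cokernelIsoOfIsPushout [HasZeroMorphisms C] {K L M N : C} {f : K ⟶ L} {g : K ⟶ M}
    {a : L ⟶ N} {b : M ⟶ N} (h : IsPushout f g a b) [HasCokernel f] [HasCokernel b] :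
    cokernel f ≅ cokernel b where
  hom := cokernel.desc f (a ≫ cokernel.π b) (by rw [h.w_assoc, cokernel.condition, comp_zero])
  inv := cokernel.desc b (h.desc (cokernel.π f) 0 (by simp)) (by simp)
  hom_inv_id := by ext; simp
  inv_hom_id := by
    ext
    apply h.hom_ext <;> simp

lemma isSplitMono_of_isPushout {K L M N : C} {f : K ⟶ L} {g : K ⟶ M}
    {a : L ⟶ N} {b : M ⟶ N} (h : IsPushout f g a b) [IsSplitMono f] : IsSplitMono b :=
  ⟨⟨h.desc (retraction f ≫ g) (𝟙 _) (by simp), by simp⟩⟩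

variable {s : ℕ}

lemma isIso_map_of_le (E : Fin s ⥤ C) {i j : Fin s} (h : i ⟶ j) (h' : j ≤ i) :
    IsIso (E.map h) :=
  ⟨E.map (homOfLE h'), by rw [← E.map_comp]; exact E.map_id _,
    by rw [← E.map_comp]; exact E.map_id _⟩

/-- The step `E_k ⟶ E_{k+1}`. -/
abbrev stepMap (E : Fin s ⥤ C) (k : ℕ) (h : k + 1 < s) :
    E.obj ⟨k, Nat.lt_of_succ_lt h⟩ ⟶ E.obj ⟨k + 1, h⟩ :=
  E.map (homOfLE (Nat.le_succ k))

/-- All steps of `E` are monomorphisms if the successive ones are. -/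
lemma mono_map_of_stepMap (E : Fin s ⥤ C) (hE : ∀ k h, Mono (stepMap E k h)) {i j : Fin s}
    (h : i ⟶ j) : Mono (E.map h) := by
  obtain ⟨i, hi⟩ := i
  obtain ⟨j, hj⟩ := j
  obtain ⟨d, rfl⟩ := Nat.exists_eq_add_of_le (show i ≤ j from h.le)
  induction d with
  | zero =>
    have : h = 𝟙 _ := rfl
    rw [this, E.map_id]
    infer_instance
  | succ d ih =>
    have h1 := ih (Nat.lt_of_succ_lt hj) (homOfLE (Nat.le_add_right i d))
    have : E.map h = E.map (homOfLE (Nat.le_add_right i d)) ≫ stepMap E (i + d) hj := by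
      rw [← E.map_comp]
      rfl
    rw [this]
    have := hE (i + d) hj
    exact mono_comp _ _

/-- The functor `i ↦ min i j`. -/
def minFunctor (j : Fin s) : Fin s ⥤ Fin s :=
  Monotone.functor (f := fun i => min i j) fun _ _ h => min_le_min_right j h

/-- The truncation `E₁ → ⋯ → E_j = E_j = ⋯ = E_j`, as a part of `E`. -/
def truncate (j : Fin s) (E : Fin s ⥤ C) : minFunctor j ⋙ E ⟶ E where
  app i := E.map (homOfLE (min_le_left i j))
  naturality _ _ _ := by
    simp only [Functor.comp_map, ← E.map_comp]
    rfl

/-- A natural transformation from the identity functor, applied to the truncation of `E`. -/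
def truncateTwist {T : C ⥤ C} (σ : 𝟭 C ⟶ T) (j : Fin s) (E : Fin s ⥤ C) :
    minFunctor j ⋙ E ⟶ (minFunctor j ⋙ E) ⋙ T where
  app _ := σ.app _
  naturality _ _ _ := σ.naturality _

variable [HasPushouts C] [HasPushouts C']

/-- The elementary modification of the filtered object `E` along its step `E_j` and along
`σ : 𝟭 ⟶ T`: the pushout of `E` along `σ : E_{min(·, j)} ⟶ T E_{min(·, j)}`. -/
def modification {T : C ⥤ C} (σ : 𝟭 C ⟶ T) (j : Fin s) (E : Fin s ⥤ C) : Fin s ⥤ C :=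
  pushout (truncate j E) (truncateTwist σ j E)

lemma modification_isPushout {T : C ⥤ C} (σ : 𝟭 C ⟶ T) (j : Fin s) (E : Fin s ⥤ C) :
    IsPushout (truncate j E) (truncateTwist σ j E)
      (pushout.inl _ _ : E ⟶ modification σ j E) (pushout.inr _ _) :=
  IsPushout.of_hasPushout _ _

/-- Modifications are compatible with functors which preserve pushouts. -/
def modificationIso {T : C ⥤ C} {T' : C' ⥤ C'} (σ : 𝟭 C ⟶ T) (σ' : 𝟭 C' ⟶ T') (j : Fin s)
    (G : C ⥤ C') [PreservesColimitsOfShape WalkingSpan G] (e : T ⋙ G ≅ G ⋙ T')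
    (he : ∀ M, G.map (σ.app M) ≫ e.hom.app M = σ'.app (G.obj M))
    (E : Fin s ⥤ C) (E' : Fin s ⥤ C') (i : E ⋙ G ≅ E') :
    modification σ j E ⋙ G ≅ modification σ' j E' := by
  have h := (modification_isPushout σ j E).map ((Functor.whiskeringRight (Fin s) C C').obj G)
  let a : minFunctor j ⋙ E ⋙ G ≅ minFunctor j ⋙ E' := Functor.isoWhiskerLeft (minFunctor j) i
  let b : ((minFunctor j ⋙ E) ⋙ T) ⋙ G ≅ (minFunctor j ⋙ E') ⋙ T' :=
    Functor.isoWhiskerLeft (minFunctor j ⋙ E) e ≪≫ Functor.isoWhiskerRight a T'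
  refine IsPushout.isoIsPushout _ _ (inl := i.inv ≫ Functor.whiskerRight (pushout.inl _ _) G)
    (inr := b.inv ≫ Functor.whiskerRight (pushout.inr _ _) G) ?_ (modification_isPushout σ' j E')
  refine h.of_iso a i b (Iso.refl _) ?_ ?_ ?_ ?_
  · ext k
    exact i.hom.naturality _
  · ext k
    dsimp [a, b, truncateTwist]
    rw [reassoc_of% he]
    exact (σ'.naturality _).symm
  · simp
  · simp

/-- Modification along an isomorphism changes nothing. -/
def modificationIsoSelf {T : C ⥤ C} (σ : 𝟭 C ⟶ T) (j : Fin s) (E : Fin s ⥤ C)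
    (h : ∀ k, IsIso (σ.app (E.obj k))) : E ≅ modification σ j E :=
  have : IsIso (truncateTwist σ j E) := by
    have (k : Fin s) : IsIso ((truncateTwist σ j E).app k) := h _
    exact NatIso.isIso_of_isIso_app _
  @asIso _ _ _ _ (pushout.inl _ _ : E ⟶ modification σ j E)
    ((modification_isPushout σ j E).isIso_inl_of_isIso this)

/-- The pushout squares which define a modification along an endomorphism of the identity
functor, and their naturality. -/
lemma exists_modification_square (σ : 𝟭 C ⟶ 𝟭 C) (j : Fin s) (E : Fin s ⥤ C) :
    ∃ (a : ∀ k, E.obj k ⟶ (modification σ j E).obj k)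
      (b : ∀ k, E.obj (min k j) ⟶ (modification σ j E).obj k),
      (∀ k, IsPushout (E.map (homOfLE (min_le_left k j))) (σ.app (E.obj (min k j)) :) (a k) (b k)) ∧
      (∀ k l (h : k ⟶ l), a k ≫ (modification σ j E).map h = E.map h ≫ a l) ∧
      (∀ k l (h : k ⟶ l), b k ≫ (modification σ j E).map h =
        E.map (homOfLE (min_le_min_right j h.le)) ≫ b l) :=
  ⟨(pushout.inl (truncate j E) (truncateTwist σ j E)).app,
    (pushout.inr (truncate j E) (truncateTwist σ j E)).app,
    fun k => (modification_isPushout σ j E).map ((evaluation (Fin s) C).obj k),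
    fun _ _ h => ((pushout.inl (truncate j E) (truncateTwist σ j E)).naturality h).symm,
    fun _ _ h => ((pushout.inr (truncate j E) (truncateTwist σ j E)).naturality h).symm⟩

/-- The steps of the modification along an endomorphism of the identity functor are pushouts of
the steps of the original object, as long as they do not jump over `j`. In particular the successive
quotients do not change. -/
lemma exists_isPushout_modification (σ : 𝟭 C ⟶ 𝟭 C) (j : Fin s) (E : Fin s ⥤ C) {k l : Fin s}
    (h : k ⟶ l) (hj : l ≤ j ∨ j ≤ k) :
    ∃ a b, IsPushout (E.map h) a b ((modification σ j E).map h) := by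
  obtain ⟨a, b, H, ha, hb⟩ := exists_modification_square σ j E
  obtain hj | hj := hj
  -- Up to the step `j`, the truncation is all of `E`, and the modification is isomorphic to `E`.
  · have hk := isIso_map_of_le E (homOfLE (min_le_left k j)) (le_min le_rfl (h.le.trans hj))
    have hl := isIso_map_of_le E (homOfLE (min_le_left l j)) (le_min le_rfl hj)
    have hbk : IsIso (b k) := (H k).isIso_inr_of_isIso
    have hbl : IsIso (b l) := (H l).isIso_inr_of_isIso
    refine ⟨inv (E.map (homOfLE (min_le_left k j))) ≫ b k,
      inv (E.map (homOfLE (min_le_left l j))) ≫ b l, IsPushout.of_vert_isIso ⟨?_⟩⟩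
    rw [Category.assoc, hb, ← cancel_epi (E.map (homOfLE (min_le_left k j))),
      IsIso.hom_inv_id_assoc, ← E.map_comp_assoc]
    have : homOfLE (min_le_left k j) ≫ h =
      homOfLE (min_le_min_right j h.le) ≫ homOfLE (min_le_left l j) := rfl
    rw [this, E.map_comp_assoc, IsIso.hom_inv_id_assoc]
  -- From the step `j` on, the truncation is constant, and the squares can be pasted.
  · have hE := isIso_map_of_le E (homOfLE (min_le_min_right j h.le))
      (by rw [min_eq_right hj, min_eq_right (hj.trans h.le)])
    have h1 := (IsPushout.of_horiz_isIso (f := E.map (homOfLE (min_le_min_right j h.le)))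
      (inr := E.map (homOfLE (min_le_min_right j h.le)))
      (CommSq.mk (σ.naturality _))).paste_horiz (H l)
    refine ⟨a k, a l, IsPushout.of_left ?_ (ha k l h).symm (H k)⟩
    have h2 : homOfLE (min_le_left k j) ≫ h =
      homOfLE (min_le_min_right j h.le) ≫ homOfLE (min_le_left l j) := rfl
    rw [hb, ← E.map_comp, h2, E.map_comp]
    exact h1

/-- Modification along zero splits the inclusion of `E_j` into the later steps: the pushout of
`E_j ⟶ E_l` along zero is `E_j ⊕ E_l / E_j`. -/
lemma isSplitMono_modification [HasZeroMorphisms C] (σ : 𝟭 C ⟶ 𝟭 C) (hσ : ∀ M, σ.app M = 0)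
    (j : Fin s) (E : Fin s ⥤ C) {l : Fin s} (h : j ⟶ l) :
    IsSplitMono ((modification σ j E).map h) := by
  obtain ⟨a, b, H, ha, hb⟩ := exists_modification_square σ j E
  have hj := isIso_map_of_le E (homOfLE (min_le_left j j)) (le_min le_rfl le_rfl)
  have hbj : IsIso (b j) := (H j).isIso_inr_of_isIso
  have hE := isIso_map_of_le E (homOfLE (min_le_min_right j h.le))
      (by rw [min_eq_right le_rfl, min_eq_right h.le])
  let ρ : (modification σ j E).obj l ⟶ E.obj (min j j) :=
    (H l).desc 0 (inv (E.map (homOfLE (min_le_min_right j h.le)))) (by rw [hσ]; simp)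
  refine ⟨⟨ρ ≫ b j, ?_⟩⟩
  rw [← cancel_epi (b j), reassoc_of% (hb j l h), (H l).inr_desc_assoc]
  simp

end Category

section Abelian
variable {C : Type*} [Category* C] [Abelian C] {s : ℕ}

/-- Modification does not change the associated graded object. -/
lemma quotients_modification_iso (σ : 𝟭 C ⟶ 𝟭 C) (j : Fin s) (E : Fin s ⥤ C) (i : Fin s) :
    Nonempty (quotients (modification σ j E) i ≅ quotients E i) := by
  obtain ⟨i, hi⟩ := i
  cases i with
  | zero =>
    obtain ⟨a, b, H, -⟩ := exists_modification_square σ j E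
    have hm := isIso_map_of_le E (homOfLE (min_le_left ⟨0, hi⟩ j)) (le_min le_rfl (Nat.zero_le _))
    have hj : IsIso (b ⟨0, hi⟩) := (H ⟨0, hi⟩).isIso_inr_of_isIso
    exact ⟨(asIso (b ⟨0, hi⟩)).symm ≪≫ @asIso _ _ _ _ _ hm⟩
  | succ k =>
    obtain ⟨a, b, h⟩ := exists_isPushout_modification σ j E (k := ⟨k, Nat.lt_of_succ_lt hi⟩)
      (l := ⟨k + 1, hi⟩) (homOfLE (Nat.le_succ k)) (by
        rcases j with ⟨j, hj⟩
        simp only [Fin.mk_le_mk]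
        omega)
    exact ⟨(cokernelIsoOfIsPushout h).symm⟩

lemma exists_isPushout_stepMap_modification (σ : 𝟭 C ⟶ 𝟭 C) (j : Fin s) (E : Fin s ⥤ C) (k : ℕ)
    (h : k + 1 < s) : ∃ a b, IsPushout (stepMap E k h) a b (stepMap (modification σ j E) k h) :=
  exists_isPushout_modification σ j E _ (by
    rcases j with ⟨j, hj⟩
    simp only [Fin.mk_le_mk]
    omega)

lemma mono_stepMap_modification (σ : 𝟭 C ⟶ 𝟭 C) (j : Fin s) (E : Fin s ⥤ C) (k : ℕ)
    (h : k + 1 < s) [Mono (stepMap E k h)] : Mono (stepMap (modification σ j E) k h) := by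
  obtain ⟨a, b, H⟩ := exists_isPushout_stepMap_modification σ j E k h
  exact Abelian.mono_inr_of_isColimit _ _ H.isColimit

lemma isSplitMono_stepMap_modification (σ : 𝟭 C ⟶ 𝟭 C) (j : Fin s) (E : Fin s ⥤ C) (k : ℕ)
    (h : k + 1 < s) [IsSplitMono (stepMap E k h)] :
    IsSplitMono (stepMap (modification σ j E) k h) := by
  obtain ⟨a, b, H⟩ := exists_isPushout_stepMap_modification σ j E k h
  exact isSplitMono_of_isPushout H

/-- The projection `E_i ⟶ E_i / E_{i-1}`. -/
def quotientMap (E : Fin s ⥤ C) : ∀ i, E.obj i ⟶ quotients E i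
  | ⟨0, _⟩ => 𝟙 _
  | ⟨_ + 1, _⟩ => cokernel.π _

/-- The filtered object `V₁ ⊂ V₁ ⊕ V₂ ⊂ ⋯` of a family. -/
def splitFiltration (V : Fin s → C) : Fin s ⥤ C where
  obj k := ∐ fun i : {i // i ≤ k} => V i
  map {k l} h := Sigma.desc fun i => Sigma.ι (fun i : {i // i ≤ l} => V i) ⟨i, i.2.trans h.le⟩
  map_id k := by ext; simp
  map_comp f g := by ext; simp

/-- The inclusion of a summand. -/
def splitFiltration.ι (V : Fin s → C) {i k : Fin s} (h : i ≤ k) :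
    V i ⟶ (splitFiltration V).obj k :=
  Sigma.ι (fun i : {i // i ≤ k} => V i) ⟨i, h⟩

lemma splitFiltration.hom_ext (V : Fin s → C) {k : Fin s} {M : C}
    {f g : (splitFiltration V).obj k ⟶ M}
    (h : ∀ i (hi : i ≤ k), splitFiltration.ι V hi ≫ f = splitFiltration.ι V hi ≫ g) : f = g :=
  Sigma.hom_ext _ _ fun i => h i.1 i.2

/-- The morphism given by its components. -/
def splitFiltration.desc (V : Fin s → C) {k : Fin s} {M : C} (f : ∀ i, i ≤ k → (V i ⟶ M)) :
    (splitFiltration V).obj k ⟶ M :=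
  Sigma.desc fun i => f i.1 i.2

@[simp]
lemma splitFiltration.ι_desc (V : Fin s → C) {k : Fin s} {M : C} (f : ∀ i, i ≤ k → (V i ⟶ M))
    {i : Fin s} (h : i ≤ k) : splitFiltration.ι V h ≫ splitFiltration.desc V f = f i h :=
  Sigma.ι_desc _ _

@[simp]
lemma splitFiltration.ι_desc_assoc (V : Fin s → C) {k : Fin s} {M N : C}
    (f : ∀ i, i ≤ k → (V i ⟶ M)) {i : Fin s} (h : i ≤ k) (g : M ⟶ N) :
    splitFiltration.ι V h ≫ splitFiltration.desc V f ≫ g = f i h ≫ g := by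
  rw [← Category.assoc, splitFiltration.ι_desc]

@[simp]
lemma splitFiltration.ι_map (V : Fin s → C) {i k l : Fin s} (h : i ≤ k) (h' : k ⟶ l) :
    splitFiltration.ι V h ≫ (splitFiltration V).map h' = splitFiltration.ι V (h.trans h'.le) :=
  Sigma.ι_desc _ _

@[simp]
lemma splitFiltration.ι_map_assoc (V : Fin s → C) {i k l : Fin s} (h : i ≤ k) (h' : k ⟶ l) {M : C}
    (g : (splitFiltration V).obj l ⟶ M) :
    splitFiltration.ι V h ≫ (splitFiltration V).map h' ≫ g =
      splitFiltration.ι V (h.trans h'.le) ≫ g := by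
  rw [← Category.assoc, splitFiltration.ι_map]

/-- The steps of the split filtration are split exact. -/
lemma splitFiltration_splitting (V : Fin s → C) (k : ℕ) (h : k + 1 < s) :
    ∃ (p : (splitFiltration V).obj ⟨k + 1, h⟩ ⟶ V ⟨k + 1, h⟩) (w : _ = _),
      splitFiltration.ι V le_rfl ≫ p = 𝟙 _ ∧
        Nonempty (ShortComplex.mk (stepMap (splitFiltration V) k h) p w).Splitting := by
  classical
  let p : (splitFiltration V).obj ⟨k + 1, h⟩ ⟶ V ⟨k + 1, h⟩ :=
    splitFiltration.desc V fun i _ => if hi : i = ⟨k + 1, h⟩ then eqToHom (by rw [hi]) else 0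
  have hp (i : Fin s) (hi : i ≤ ⟨k, Nat.lt_of_succ_lt h⟩) : i ≠ ⟨k + 1, h⟩ := by
    rintro rfl
    exact absurd hi (by simp)
  refine ⟨p, splitFiltration.hom_ext V fun i hi => ?_, by simp [p],
    ⟨⟨splitFiltration.desc V fun i _ =>
    if hi : i ≤ ⟨k, Nat.lt_of_succ_lt h⟩ then splitFiltration.ι V hi else 0,
    splitFiltration.ι V le_rfl, ?_, ?_, ?_⟩⟩⟩
  · simp [p, hp i hi]
  · refine splitFiltration.hom_ext V fun i hi => ?_
    simp [hi]
  · simp [p]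
  · refine splitFiltration.hom_ext V fun i hi => ?_
    by_cases hik : i = ⟨k + 1, h⟩
    · subst hik
      simp [p]
    · have : i ≤ ⟨k, Nat.lt_of_succ_lt h⟩ := by
        obtain ⟨i, _⟩ := i
        simp only [Fin.mk_le_mk, Fin.mk.injEq] at hi hik ⊢
        omega
      simp [p, hik, this]

lemma mono_stepMap_splitFiltration (V : Fin s → C) (k h) :
    Mono (stepMap (splitFiltration V) k h) := by
  obtain ⟨p, w, -, ⟨σ⟩⟩ := splitFiltration_splitting V k h
  exact (σ.shortExact).mono_f

lemma isIso_splitFiltration_ι (V : Fin s → C) (h : 0 < s) :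
    IsIso (splitFiltration.ι V (le_refl (⟨0, h⟩ : Fin s))) := by
  have hz (i : Fin s) (hi : i ≤ ⟨0, h⟩) : i = ⟨0, h⟩ := le_antisymm hi (Nat.zero_le _)
  refine ⟨splitFiltration.desc V fun i hi => eqToHom (by rw [hz i hi]), by simp,
    splitFiltration.hom_ext V fun i hi => ?_⟩
  obtain rfl := hz i hi
  simp

lemma quotients_splitFiltration_iso (V : Fin s → C) (i : Fin s) :
    Nonempty (quotients (splitFiltration V) i ≅ V i) := by
  obtain ⟨i, hi⟩ := i
  cases i with
  | zero =>
    exact ⟨(@asIso _ _ _ _ _ (isIso_splitFiltration_ι V hi)).symm⟩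
  | succ k =>
    obtain ⟨p, w, -, ⟨σ⟩⟩ := splitFiltration_splitting V k hi
    exact ⟨IsColimit.coconePointUniqueUpToIso (cokernelIsCokernel _) σ.gIsCokernel⟩

/-- A filtered object all steps of which split is the split filtration of its quotients: sections of
the projections `E_i ⟶ E_i / E_{i-1}` define a comparison morphism, which is an isomorphism by
induction over the steps and the five lemma. -/
lemma nonempty_splitFiltration_iso (E : Fin s ⥤ C) (hE : ∀ k h, IsSplitMono (stepMap E k h)) :
    Nonempty (splitFiltration (quotients E) ≅ E) := by
  have hs (i : Fin s) : ∃ σ : quotients E i ⟶ E.obj i, σ ≫ quotientMap E i = 𝟙 _ := by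
    obtain ⟨i, hi⟩ := i
    cases i with
    | zero => exact ⟨𝟙 _, Category.comp_id _⟩
    | succ k =>
      have := hE k hi
      let S := ShortComplex.mk (stepMap E k hi) (cokernel.π _) (cokernel.condition _)
      have hS : S.Exact := ShortComplex.exact_cokernel _
      have : Epi S.g := inferInstanceAs (Epi (cokernel.π _))
      let σ := ShortComplex.Splitting.ofExactOfRetraction S hS (retraction (stepMap E k hi))
        (IsSplitMono.id _) this
      exact ⟨σ.s, σ.s_g⟩
  choose σ hσ using hs
  let φ : splitFiltration (quotients E) ⟶ E :=
    { app k := splitFiltration.desc _ fun i hi => σ i ≫ E.map (homOfLE hi)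
      naturality k l h := splitFiltration.hom_ext _ fun i hi => by
        rw [splitFiltration.ι_map_assoc, splitFiltration.ι_desc, splitFiltration.ι_desc_assoc,
          Category.assoc, ← E.map_comp]
        rfl }
  have hι {i k : Fin s} (hi : i ≤ k) :
      splitFiltration.ι (quotients E) hi ≫ φ.app k = σ i ≫ E.map (homOfLE hi) :=
    splitFiltration.ι_desc (quotients E) (fun i hi => σ i ≫ E.map (homOfLE hi)) hi
  have hφ (k : ℕ) (hk : k < s) : IsIso (φ.app ⟨k, hk⟩) := by
    induction k with
    | zero =>
      have h1 := isIso_splitFiltration_ι (quotients E) hk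
      have h2 := hι (le_refl (⟨0, hk⟩ : Fin s))
      have h3 : σ ⟨0, hk⟩ = 𝟙 _ := (Category.comp_id _).symm.trans (hσ ⟨0, hk⟩)
      have h4 : IsIso (σ ⟨0, hk⟩) := by rw [h3]; exact IsIso.id (E.obj ⟨0, hk⟩)
      have h5 := isIso_map_of_le E (homOfLE (le_refl (⟨0, hk⟩ : Fin s))) le_rfl
      have h6 : IsIso (splitFiltration.ι (quotients E) (le_refl (⟨0, hk⟩ : Fin s)) ≫
        φ.app ⟨0, hk⟩) := by rw [h2]; infer_instance
      exact IsIso.of_isIso_comp_left (splitFiltration.ι (quotients E) (le_refl (⟨0, hk⟩ : Fin s))) _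
    | succ k ih =>
      have h1 := ih (Nat.lt_of_succ_lt hk)
      obtain ⟨p, w, hp, ⟨τ⟩⟩ := splitFiltration_splitting (quotients E) k hk
      have := hE k hk
      let S := ShortComplex.mk (stepMap E k hk) (cokernel.π _) (cokernel.condition _)
      have hS : S.ShortExact := ShortComplex.ShortExact.mk' (ShortComplex.exact_cokernel _)
        (inferInstanceAs (Mono (stepMap E k hk))) (inferInstanceAs (Epi (cokernel.π _)))
      have hc : φ.app ⟨k + 1, hk⟩ ≫ quotientMap E ⟨k + 1, hk⟩ = p := by
        refine splitFiltration.hom_ext _ fun i hi => ?_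
        rw [reassoc_of% (hι hi)]
        by_cases hik : i = ⟨k + 1, hk⟩
        · subst hik
          have : E.map (homOfLE hi) = 𝟙 _ := E.map_id _
          rw [hp, this, Category.id_comp, hσ]
        · have hik' : i ≤ ⟨k, Nat.lt_of_succ_lt hk⟩ := by
            obtain ⟨i, _⟩ := i
            simp only [Fin.mk_le_mk, Fin.mk.injEq] at hi hik ⊢
            omega
          have e1 : E.map (homOfLE hi) = E.map (homOfLE hik') ≫ stepMap E k hk := by
            rw [← E.map_comp]; rfl
          have e2 : splitFiltration.ι (quotients E) hi = splitFiltration.ι (quotients E) hik' ≫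
            stepMap (splitFiltration (quotients E)) k hk := (splitFiltration.ι_map _ _ _).symm
          have e3 : stepMap E k hk ≫ quotientMap E ⟨k + 1, hk⟩ = 0 := cokernel.condition _
          rw [e1, e2, Category.assoc, Category.assoc, e3, w, comp_zero, comp_zero, comp_zero]
      let Φ : ShortComplex.mk _ p w ⟶ S :=
        { τ₁ := φ.app ⟨k, Nat.lt_of_succ_lt hk⟩
          τ₂ := φ.app ⟨k + 1, hk⟩
          τ₃ := 𝟙 _
          comm₁₂ := (φ.naturality _).symm
          comm₂₃ := hc.trans (Category.comp_id _).symm }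
      exact ShortComplex.isIso₂_of_shortExact_of_isIso₁₃' Φ τ.shortExact hS h1
        (inferInstanceAs (IsIso (𝟙 _)))
  exact ⟨@asIso _ _ _ _ φ (@NatIso.isIso_of_isIso_app _ _ _ _ _ _ φ fun k => hφ k.1 k.2)⟩

/-- Split filtrations are compatible with functors which preserve finite coproducts. -/
def splitFiltrationIso {C' : Type*} [Category* C'] [Abelian C'] (F : C ⥤ C')
    [PreservesFiniteColimits F] {V' : Fin s → C'} {V : Fin s → C} (e : ∀ i, V' i ≅ F.obj (V i)) :
    splitFiltration V' ≅ splitFiltration V ⋙ F :=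
  have h₀ (k : Fin s) (i : {i // i ≤ k}) : Sigma.ι (fun i : {i // i ≤ k} => V' i) i ≫
      (Sigma.mapIso (fun i : {i // i ≤ k} => e i) ≪≫
        (PreservesCoproduct.iso F (fun i : {i // i ≤ k} => V i)).symm).hom =
      (e i).hom ≫ F.map (Sigma.ι (fun i : {i // i ≤ k} => V i) i) := by
    simp [PreservesCoproduct.inv_hom]
  let a (k : Fin s) : (splitFiltration V').obj k ≅ F.obj ((splitFiltration V).obj k) :=
    Sigma.mapIso (fun i : {i // i ≤ k} => e i) ≪≫
      (PreservesCoproduct.iso F (fun i : {i // i ≤ k} => V i)).symm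
  have h (k i : Fin s) (hi : i ≤ k) : splitFiltration.ι V' hi ≫ (a k).hom =
      (e i).hom ≫ F.map (splitFiltration.ι V hi) := h₀ k ⟨i, hi⟩
  NatIso.ofComponents a fun {k l} h' => by
    refine splitFiltration.hom_ext _ fun i hi => ?_
    rw [splitFiltration.ι_map_assoc, h, reassoc_of% (h k i hi), Functor.comp_map, ← F.map_comp,
      splitFiltration.ι_map]

end Abelian

end

/-! ### Kinds of bundle data with pullbacks -/

section

open Scheme.Modules
variable {X Y Z : Scheme.{0}}

/-- A sequence of modules is a filtered bundle if its steps are monomorphisms and its quotients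
are vector bundles. -/
def IsFiltered {s : ℕ} (r : Fin s → ℕ) (S : Fin s ⥤ Y.Modules) : Prop :=
  (∀ k h, Mono (stepMap S k h)) ∧ ∀ i, IsLocallyFreeOfRank (differences r i) (quotients S i)

lemma FilteredBundle.isFiltered {s : ℕ} {r : Fin s → ℕ} (E : FilteredBundle r Y) :
    IsFiltered r E.step :=
  ⟨fun _ _ => E.mono _, E.quotientsLocallyFree⟩

lemma IsFiltered.locallyFree {s : ℕ} {r : Fin s → ℕ} (hr : Monotone r) {S : Fin s ⥤ Y.Modules}
    (hS : IsFiltered r S) (i : Fin s) : IsLocallyFreeOfRank (r i) (S.obj i) := by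
  obtain ⟨i, hi⟩ := i
  induction i with
  | zero => exact hS.2 ⟨0, hi⟩
  | succ k ih =>
    have := hS.1 k hi
    have h1 := (ih (Nat.lt_of_succ_lt hi)).extension (stepMap S k hi) (hS.2 ⟨k + 1, hi⟩)
    have h2 : r ⟨k, Nat.lt_of_succ_lt hi⟩ + differences r ⟨k + 1, hi⟩ = r ⟨k + 1, hi⟩ :=
      Nat.add_sub_of_le (hr (Nat.le_succ k))
    rwa [h2] at h1

/-- The filtered bundle of a filtered sequence of modules. -/
def IsFiltered.bundle {s : ℕ} {r : Fin s → ℕ} {S : Fin s ⥤ Y.Modules}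
    (hS : IsFiltered r S) (hr : Monotone r) : FilteredBundle r Y where
  step := S
  mono := mono_map_of_stepMap S hS.1
  locallyFree := hS.locallyFree hr
  quotientsLocallyFree := hS.2

lemma IsFiltered.of_iso {s : ℕ} {r : Fin s → ℕ} {S S' : Fin s ⥤ Y.Modules}
    (hS : IsFiltered r S) (e : S' ≅ S) : IsFiltered r S' := by
  refine ⟨fun k h => ?_, fun i => ?_⟩
  · have := hS.1 k h
    have : Mono (stepMap S' k h ≫ e.hom.app _) := by
      rw [e.hom.naturality]
      infer_instance
    exact mono_of_mono _ (e.hom.app _)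
  · obtain ⟨j⟩ := quotients_iso (𝟭 _) (E' := S') (E := S) e i
    exact (hS.2 i).of_iso j.symm

lemma IsFiltered.pullback {s : ℕ} {r : Fin s → ℕ} {S : Fin s ⥤ Y.Modules}
    (hS : IsFiltered r S) (f : X ⟶ Y) : IsFiltered r (S ⋙ Scheme.Modules.pullback f) := by
  refine ⟨fun k h => ?_, fun i => ?_⟩
  · have := hS.1 k h
    exact ((isLocallySplitMono_of_cokernel (stepMap S k h) (hS.2 ⟨k + 1, h⟩)).pullback f).mono
  · obtain ⟨j⟩ := quotients_iso (Scheme.Modules.pullback f)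
      (Iso.refl (S ⋙ Scheme.Modules.pullback f)) i
    exact ((hS.2 i).pullback f).of_iso j.symm

instance (f : X ⟶ Y) [IsOpenImmersion f] : PreservesColimits (restrictFunctor f) := by
  exact preservesColimits_of_natIso (restrictFunctorIsoPullback f).symm

lemma IsFiltered.of_restrict {s : ℕ} {r : Fin s → ℕ} {S : Fin s ⥤ Y.Modules}
    (h : ∀ y : Y, ∃ (V : Scheme.{0}) (j : V ⟶ Y) (_ : IsOpenImmersion j),
      y ∈ j.opensRange ∧ IsFiltered r (S ⋙ restrictFunctor j)) : IsFiltered r S := by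
  refine ⟨fun k hk => mono_of_restrict _ fun y => ?_, fun i => .of_restrict fun y => ?_⟩
  · obtain ⟨V, j, hj, hy, H⟩ := h y
    exact ⟨V, j, hj, hy, H.1 k hk⟩
  · obtain ⟨V, j, hj, hy, H⟩ := h y
    obtain ⟨e⟩ := quotients_iso (restrictFunctor j) (Iso.refl (S ⋙ restrictFunctor j)) i
    exact ⟨V, j, hj, hy, (H.2 i).of_iso e⟩

lemma IsFiltered.modification {s : ℕ} {r : Fin s → ℕ} {S : Fin s ⥤ Y.Modules}
    (hS : IsFiltered r S) (σ : 𝟭 Y.Modules ⟶ 𝟭 Y.Modules) (j : Fin s) :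
    IsFiltered r (modification σ j S) := by
  refine ⟨fun k h => ?_, fun i => ?_⟩
  · have := hS.1 k h
    exact mono_stepMap_modification σ j S k h
  · obtain ⟨e⟩ := quotients_modification_iso σ j S i
    exact (hS.2 i).of_iso e.symm

lemma isFiltered_splitFiltration {s : ℕ} {r : Fin s → ℕ} {V : Fin s → Y.Modules}
    (hV : ∀ i, IsLocallyFreeOfRank (differences r i) (V i)) : IsFiltered r (splitFiltration V) :=
  ⟨mono_stepMap_splitFiltration V, fun i =>
    (hV i).of_iso (quotients_splitFiltration_iso V i).some.symm⟩

/-- Kinds of bundle data for which pullbacks exist and have the expected formal properties: they are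
functorial, and `k^* (j^* E)` is determined up to isomorphism by `(k ≫ j)^* E`. -/
structure BundleKind.IsGeometric (D : BundleKind) : Prop where
  exists_pullback : ∀ {Y' Y : Scheme.{0}} (j : Y' ⟶ Y) (E : D.Obj Y), ∃ E', D.IsPullback j E' E
  id : ∀ {Y : Scheme.{0}} (E : D.Obj Y), D.IsPullback (𝟙 Y) E E
  comp : ∀ {Y'' Y' Y : Scheme.{0}} {k : Y'' ⟶ Y'} {j : Y' ⟶ Y} {E'' : D.Obj Y''} {E' : D.Obj Y'}
    {E : D.Obj Y}, D.IsPullback k E'' E' → D.IsPullback j E' E → D.IsPullback (k ≫ j) E'' E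
  cancel : ∀ {Y'' Y' Y : Scheme.{0}} {k : Y'' ⟶ Y'} {j : Y' ⟶ Y} {E'' : D.Obj Y''} {E' : D.Obj Y'}
    {E : D.Obj Y}, D.IsPullback (k ≫ j) E'' E → D.IsPullback j E' E → D.IsPullback k E'' E'

lemma isGeometric_noBundle : noBundle.IsGeometric where
  exists_pullback _ _ := ⟨⟨⟩, trivial⟩
  id _ := trivial
  comp _ _ := trivial
  cancel _ _ := trivial

lemma isGeometric_bundleLists {s : ℕ} (d : Fin s → ℕ) : (bundleLists d).IsGeometric where
  exists_pullback j E := ⟨⟨fun i => (Scheme.Modules.pullback j).obj (E.bundle i),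
    fun i => (E.locallyFree i).pullback j⟩, fun _ => ⟨Iso.refl _⟩⟩
  id _ _ := ⟨(pullbackId _).symm.app _⟩
  comp {_ _ _ k j _ _ _} h h' i := ⟨(h i).some ≪≫ (Scheme.Modules.pullback k).mapIso (h' i).some ≪≫
    (pullbackComp k j).app _⟩
  cancel {_ _ _ k j _ _ _} h h' i := ⟨(h i).some ≪≫ (pullbackComp k j).symm.app _ ≪≫
    ((Scheme.Modules.pullback k).mapIso (h' i).some).symm⟩

lemma gradedBundles_isPullback_iff {s : ℕ} {d : Fin s → ℕ} (j : X ⟶ Y) (E' : GradedBundle d X)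
    (E : GradedBundle d Y) : (gradedBundles d).IsPullback j E' E ↔
      (bundleLists d).IsPullback j E'.list E.list := by
  refine ⟨(listHom d).isPullback, fun h => ?_⟩
  let e' (i) : E'.piece i ≅ (Scheme.Modules.pullback j).obj (E.piece i) := (h i).some
  obtain ⟨hE⟩ := E.isDirectSum
  obtain ⟨hE'⟩ := E'.isDirectSum
  let H := isColimitCofanMkObjOfIsColimit (Scheme.Modules.pullback j) _ _ hE
  refine ⟨⟨Cofan.IsColimit.desc hE' fun i => (e' i).hom ≫
    (Scheme.Modules.pullback j).map (E.incl i),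
    Cofan.IsColimit.desc H fun i => (e' i).inv ≫ E'.incl i, ?_, ?_⟩, e', fun i => ?_⟩
  · refine Cofan.IsColimit.hom_ext hE' _ _ fun i => ?_
    rw [Cofan.IsColimit.fac_assoc, Category.assoc]
    erw [Cofan.IsColimit.fac H]
    simp
  · refine Cofan.IsColimit.hom_ext H _ _ fun i => ?_
    rw [Cofan.IsColimit.fac_assoc, Category.assoc]
    erw [Cofan.IsColimit.fac hE']
    simp
  · exact Cofan.IsColimit.fac hE' _ i

/-- The graded bundle of a list of bundles. -/
def BundleList.graded {s : ℕ} {d : Fin s → ℕ} (E : BundleList d Y) : GradedBundle d Y where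
  total := ∐ E.bundle
  piece := E.bundle
  incl := Sigma.ι E.bundle
  isDirectSum := ⟨coproductIsCoproduct _⟩
  locallyFree := E.locallyFree

/-- The direct sum of a list of bundles. -/
def gradedHom {s : ℕ} (d : Fin s → ℕ) : BundleKind.Hom (bundleLists d) (gradedBundles d) where
  obj := BundleList.graded
  isPullback h := (gradedBundles_isPullback_iff _ _ _).2 h

lemma isGeometric_gradedBundles {s : ℕ} (d : Fin s → ℕ) : (gradedBundles d).IsGeometric where
  exists_pullback j E := by
    obtain ⟨L, hL⟩ := (isGeometric_bundleLists d).exists_pullback j E.list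
    exact ⟨L.graded, (gradedBundles_isPullback_iff _ _ _).2 hL⟩
  id E := (gradedBundles_isPullback_iff _ _ _).2 ((isGeometric_bundleLists d).id _)
  comp h h' := (gradedBundles_isPullback_iff _ _ _).2 ((isGeometric_bundleLists d).comp
    ((gradedBundles_isPullback_iff _ _ _).1 h) ((gradedBundles_isPullback_iff _ _ _).1 h'))
  cancel h h' := (gradedBundles_isPullback_iff _ _ _).2 ((isGeometric_bundleLists d).cancel
    ((gradedBundles_isPullback_iff _ _ _).1 h) ((gradedBundles_isPullback_iff _ _ _).1 h'))

lemma isGeometric_filteredBundles {s : ℕ} {r : Fin s → ℕ} (hr : Monotone r) :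
    (filteredBundles r).IsGeometric where
  exists_pullback j E := ⟨(E.isFiltered.pullback j).bundle hr, ⟨Iso.refl _⟩⟩
  id E := ⟨Functor.isoWhiskerLeft E.step (pullbackId _).symm⟩
  comp {_ _ _ k j _ _ _} := fun ⟨h⟩ ⟨h'⟩ =>
    ⟨h ≪≫ Functor.isoWhiskerRight h' _ ≪≫ Functor.isoWhiskerLeft _ (pullbackComp k j)⟩
  cancel {_ _ _ k j _ _ _} := fun ⟨h⟩ ⟨h'⟩ =>
    ⟨h ≪≫ Functor.isoWhiskerLeft _ (pullbackComp k j).symm ≪≫ (Functor.isoWhiskerRight h' _).symm⟩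

/-- The split filtered bundle of a graded bundle. -/
def splitHom {s : ℕ} {r : Fin s → ℕ} (hr : Monotone r) :
    BundleKind.Hom (gradedBundles (differences r)) (filteredBundles r) where
  obj E := (isFiltered_splitFiltration E.locallyFree).bundle hr
  isPullback {_ _ j _ _} := fun ⟨_, e', _⟩ => ⟨splitFiltrationIso (Scheme.Modules.pullback j) e'⟩

end

/-! ### Twisting by an effective divisor -/

section

open Scheme.Modules

section Category
variable {C D : Type*} [Category* C] [Category* D]

/-- Two functors `F` and `G` under the identity functor. They describe a gluing construction: the
objects to be glued are the `F M` and the `G M`, along the morphisms `τ` and `η`. -/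
structure GluingDatum (C : Type*) [Category* C] where
  F : C ⥤ C
  G : C ⥤ C
  τ : ∀ M, M ⟶ F.obj M
  η : ∀ M, M ⟶ G.obj M
  τ_naturality : ∀ {M N} (f : M ⟶ N), f ≫ τ N = τ M ≫ F.map f
  η_naturality : ∀ {M N} (f : M ⟶ N), f ≫ η N = η M ≫ G.map f

namespace GluingDatum
variable (Δ : GluingDatum C) [HasPullbacks C]

lemma exists_twist : ∃ (T : C ⥤ C) (a : ∀ M, T.obj M ⟶ Δ.F.obj M) (b : ∀ M, T.obj M ⟶ Δ.G.obj M),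
    (∀ M, IsPullback (a M) (b M) (Δ.η (Δ.F.obj M)) (Δ.G.map (Δ.τ M))) ∧
    (∀ M N (f : M ⟶ N), T.map f ≫ a N = a M ≫ Δ.F.map f) ∧
    (∀ M N (f : M ⟶ N), T.map f ≫ b N = b M ≫ Δ.G.map f) := by
  have H (M : C) := IsPullback.of_hasPullback (Δ.η (Δ.F.obj M)) (Δ.G.map (Δ.τ M))
  have w {M N : C} (f : M ⟶ N) : (pullback.fst (Δ.η (Δ.F.obj M)) (Δ.G.map (Δ.τ M)) ≫ Δ.F.map f) ≫
      Δ.η (Δ.F.obj N) = (pullback.snd (Δ.η (Δ.F.obj M)) (Δ.G.map (Δ.τ M)) ≫ Δ.G.map f) ≫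
        Δ.G.map (Δ.τ N) := by
    rw [Category.assoc, Δ.η_naturality, reassoc_of% (H M).w, Category.assoc,
      ← Functor.map_comp, ← Functor.map_comp, Δ.τ_naturality]
  exact ⟨{
    obj M := pullback (Δ.η (Δ.F.obj M)) (Δ.G.map (Δ.τ M))
    map {M N} f := (H N).lift _ _ (w f)
    map_id M := (H M).hom_ext (by simp) (by simp)
    map_comp {_ _ P} f g := (H P).hom_ext (by simp) (by simp) },
    fun M => pullback.fst _ _, fun M => pullback.snd _ _, H,
    fun M N f => (H N).lift_fst _ _ _, fun M N f => (H N).lift_snd _ _ _⟩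

/-- The functor `M ↦ F M ×_{G F M} G M`, where `G M ⟶ G F M` is given by `τ`. -/
def twist : C ⥤ C := Δ.exists_twist.choose

/-- The first projection. -/
def fst (M : C) : Δ.twist.obj M ⟶ Δ.F.obj M := Δ.exists_twist.choose_spec.choose M

/-- The second projection. -/
def snd (M : C) : Δ.twist.obj M ⟶ Δ.G.obj M := Δ.exists_twist.choose_spec.choose_spec.choose M

lemma isPullback (M : C) :
    IsPullback (Δ.fst M) (Δ.snd M) (Δ.η (Δ.F.obj M)) (Δ.G.map (Δ.τ M)) :=
  Δ.exists_twist.choose_spec.choose_spec.choose_spec.1 M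

lemma fst_naturality {M N : C} (f : M ⟶ N) : Δ.twist.map f ≫ Δ.fst N = Δ.fst M ≫ Δ.F.map f :=
  Δ.exists_twist.choose_spec.choose_spec.choose_spec.2.1 M N f

lemma snd_naturality {M N : C} (f : M ⟶ N) : Δ.twist.map f ≫ Δ.snd N = Δ.snd M ≫ Δ.G.map f :=
  Δ.exists_twist.choose_spec.choose_spec.choose_spec.2.2 M N f

/-- The canonical section of the twist, with components `τ` and `η`. -/
def sec (M : C) : M ⟶ Δ.twist.obj M :=
  (Δ.isPullback M).lift (Δ.τ M) (Δ.η M) (Δ.η_naturality _)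

lemma sec_fst (M : C) : Δ.sec M ≫ Δ.fst M = Δ.τ M := (Δ.isPullback M).lift_fst _ _ _

lemma sec_snd (M : C) : Δ.sec M ≫ Δ.snd M = Δ.η M := (Δ.isPullback M).lift_snd _ _ _

lemma sec_naturality {M N : C} (f : M ⟶ N) : f ≫ Δ.sec N = Δ.sec M ≫ Δ.twist.map f := by
  apply (Δ.isPullback N).hom_ext
  · rw [Category.assoc, Category.assoc, fst_naturality, sec_fst, reassoc_of% (Δ.sec_fst M),
      Δ.τ_naturality]
  · rw [Category.assoc, Category.assoc, snd_naturality, sec_snd, reassoc_of% (Δ.sec_snd M),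
      Δ.η_naturality]

/-- The canonical sections, as a natural transformation. -/
def twistSection : 𝟭 C ⟶ Δ.twist where
  app M := Δ.sec M
  naturality _ _ f := Δ.sec_naturality f

variable (R : C ⥤ D) [PreservesLimitsOfShape WalkingCospan R]

lemma isIso_map_twistSection (h : ∀ M, IsIso (R.map (Δ.η M))) (M : C) :
    IsIso (R.map (Δ.sec M)) := by
  have h0 := h (Δ.F.obj M)
  have h1 := ((Δ.isPullback M).map R).isIso_snd_of_isIso
  have h2 := h M
  have h3 : R.map (Δ.sec M) ≫ R.map (Δ.snd M) = R.map (Δ.η M) := by rw [← R.map_comp, sec_snd]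
  exact IsIso.of_isIso_fac_right h3

lemma isIso_map_fst (h : ∀ M, IsIso (R.map (Δ.G.map (Δ.τ M)))) (M : C) :
    IsIso (R.map (Δ.fst M)) := by
  have h0 := h M
  exact ((Δ.isPullback M).map R).isIso_fst_of_isIso

end GluingDatum
end Category

variable {W Y : Scheme.{0}}

/-- Two open subschemes `U₀`, `U₁` of `W` and a function `t` on `U₀` which is invertible
on `U₀ ∩ U₁`. If `U₀` and `U₁` cover `W`, this is an effective divisor, given by `t = 0`
in `U₀` and empty in `U₁`; it is a generalized one, as `t` may be a zero divisor. -/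
structure TwistDatum (W : Scheme.{0}) where
  U₀ : W.Opens
  U₁ : W.Opens
  t : Γ(U₀, ⊤)
  isUnit : IsUnit ((U₀ : Scheme).presheaf.map (homOfLE (le_top : U₀.ι ⁻¹ᵁ U₁ ≤ ⊤)).op t)

namespace TwistDatum
variable (Δ : TwistDatum W)

/-- Restriction to an open subscheme, followed by direct image. -/
abbrev localize (U : W.Opens) : W.Modules ⥤ W.Modules :=
  restrictFunctor U.ι ⋙ pushforward U.ι

/-- The unit of the adjunction between restriction and direct image. -/
def toLocalize (U : W.Opens) (M : W.Modules) : M ⟶ (localize U).obj M :=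
  (restrictAdjunction U.ι).unit.app M

lemma toLocalize_naturality (U : W.Opens) {M N : W.Modules} (f : M ⟶ N) :
    f ≫ toLocalize U N = toLocalize U M ≫ (localize U).map f :=
  (restrictAdjunction U.ι).unit.naturality f

/-- The sections of the twist `M(D)` by the divisor are the pairs of a section `m₀` over `U₀` and
a section `m₁` over `U₁` with `m₀ = t m₁`. -/
def gluingDatum : GluingDatum W.Modules where
  F := localize Δ.U₀
  G := localize Δ.U₁
  τ M := toLocalize Δ.U₀ M ≫ (pushforward Δ.U₀.ι).map ((globalSMul Δ.t).app (M.restrict Δ.U₀.ι))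
  η M := toLocalize Δ.U₁ M
  τ_naturality {M N} f := by
    rw [← Category.assoc, toLocalize_naturality, Category.assoc, Category.assoc]
    congr 1
    have h3 := congrArg (pushforward Δ.U₀.ι).map
      ((globalSMul Δ.t).naturality ((restrictFunctor Δ.U₀.ι).map f))
    exact ((pushforward Δ.U₀.ι).map_comp _ _).symm.trans
      (h3.trans ((pushforward Δ.U₀.ι).map_comp _ _))
  η_naturality f := toLocalize_naturality _ f

/-- The twist `M ↦ M(D)` by the divisor. -/
abbrev twist : W.Modules ⥤ W.Modules := Δ.gluingDatum.twist

/-- The canonical section `M ⟶ M(D)`. -/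
abbrev twistSection : 𝟭 W.Modules ⟶ Δ.twist := Δ.gluingDatum.twistSection

/-- The counit of the adjunction. -/
def ofLocalize (U : W.Opens) (M : W.Modules) :
    (restrictFunctor U.ι).obj ((localize U).obj M) ⟶ (restrictFunctor U.ι).obj M :=
  (restrictAdjunction U.ι).counit.app ((restrictFunctor U.ι).obj M)

lemma map_toLocalize_ofLocalize (U : W.Opens) (M : W.Modules) :
    (restrictFunctor U.ι).map (toLocalize U M) ≫ ofLocalize U M = 𝟙 _ :=
  (restrictAdjunction U.ι).left_triangle_components M

instance isIso_ofLocalize (U : W.Opens) (M : W.Modules) : IsIso (ofLocalize U M) :=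
  inferInstanceAs (IsIso ((restrictAdjunction U.ι).counit.app ((restrictFunctor U.ι).obj M)))

instance (U : W.Opens) (M : W.Modules) : IsIso ((restrictFunctor U.ι).map (toLocalize U M)) :=
  IsIso.of_isIso_fac_right (map_toLocalize_ofLocalize U M)

/-- Over `U₁`, the twist is the identity. -/
def twistIso₁ : Δ.twist ⋙ restrictFunctor Δ.U₁.ι ≅ restrictFunctor Δ.U₁.ι ⋙ 𝟭 _ :=
  haveI (M : W.Modules) : IsIso ((restrictFunctor Δ.U₁.ι).map (Δ.twistSection.app M)) :=
    Δ.gluingDatum.isIso_map_twistSection _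
      (fun M => inferInstanceAs (IsIso ((restrictFunctor Δ.U₁.ι).map (toLocalize Δ.U₁ M)))) M
  haveI : IsIso (Functor.whiskerRight Δ.twistSection (restrictFunctor Δ.U₁.ι)) :=
    @NatIso.isIso_of_isIso_app _ _ _ _ _ _ _ this
  (asIso (Functor.whiskerRight Δ.twistSection (restrictFunctor Δ.U₁.ι))).symm

/-- Over `U₁`, the canonical section is the identity. -/
lemma map_twistSection_twistIso₁ (M : W.Modules) :
    (restrictFunctor Δ.U₁.ι).map (Δ.twistSection.app M) ≫ Δ.twistIso₁.hom.app M = 𝟙 _ :=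
  congrArg (fun x => NatTrans.app x M) Δ.twistIso₁.inv_hom_id

lemma isIso_map_homOfLE (M : W.Modules) {U V : W.Opens} (h : U ≤ V) (h' : V ≤ U) :
    IsIso (M.presheaf.map (homOfLE h).op) := by
  obtain rfl := le_antisymm h h'
  have : (homOfLE h).op = 𝟙 _ := rfl
  rw [this, CategoryTheory.Functor.map_id]
  infer_instance

lemma isIso_τ_app (M : W.Modules) (V : W.Opens) (h₀ : V ≤ Δ.U₀) (h₁ : V ≤ Δ.U₁) :
    IsIso ((Δ.gluingDatum.τ M).app V) := by
  have e1 : IsIso ((toLocalize Δ.U₀ M).app V) := by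
    refine isIso_map_homOfLE M (Δ.U₀.ι.image_preimage_le V) ?_
    rw [Scheme.Hom.image_preimage_eq_opensRange_inf]
    simpa using h₀
  have e2 : IsIso (((pushforward Δ.U₀.ι).map ((globalSMul Δ.t).app
    (M.restrict Δ.U₀.ι))).app V) := by
    have hu : IsUnit ((M.restrict Δ.U₀.ι).smul ((Δ.U₀ : Scheme).presheaf.map
        (homOfLE (le_top : Δ.U₀.ι ⁻¹ᵁ V ≤ ⊤)).op Δ.t)) := by
      refine IsUnit.map _ ?_
      have := Δ.isUnit.map ((Δ.U₀ : Scheme).presheaf.map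
        (homOfLE (show Δ.U₀.ι ⁻¹ᵁ V ≤ Δ.U₀.ι ⁻¹ᵁ Δ.U₁ from fun x hx => h₁ hx)).op).hom
      have e : (homOfLE (le_top : Δ.U₀.ι ⁻¹ᵁ V ≤ ⊤)).op =
        (homOfLE (le_top : Δ.U₀.ι ⁻¹ᵁ Δ.U₁ ≤ ⊤)).op ≫
        (homOfLE (show Δ.U₀.ι ⁻¹ᵁ V ≤ Δ.U₀.ι ⁻¹ᵁ Δ.U₁ from fun x hx => h₁ hx)).op := rfl
      rw [e, Functor.map_comp]
      exact this
    exact (isUnit_iff_isIso _).1 hu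
  exact @IsIso.comp_isIso _ _ _ _ _ _ _ e1 e2

lemma isIso_restrict_τ (M : W.Modules) :
    IsIso ((restrictFunctor Δ.U₀.ι).map (Δ.gluingDatum.G.map (Δ.gluingDatum.τ M))) := by
  rw [Hom.isIso_iff_isIso_app]
  intro V
  refine Δ.isIso_τ_app M (Δ.U₁.ι ''ᵁ Δ.U₁.ι ⁻¹ᵁ Δ.U₀.ι ''ᵁ V) ?_ ?_
  · exact (Scheme.Hom.image_preimage_le _ _).trans (Scheme.Opens.ι_image_le _ _)
  · exact Scheme.Opens.ι_image_le _ _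

/-- The comparison of the twist with the identity over `U₀`, given by the first component. -/
def twistHom₀ (M : W.Modules) :
    (restrictFunctor Δ.U₀.ι).obj (Δ.twist.obj M) ⟶ (restrictFunctor Δ.U₀.ι).obj M :=
  (restrictFunctor Δ.U₀.ι).map (Δ.gluingDatum.fst M) ≫ ofLocalize Δ.U₀ M

lemma isIso_twistHom₀ (M : W.Modules) : IsIso (Δ.twistHom₀ M) :=
  @IsIso.comp_isIso _ _ _ _ _ _ _ (Δ.gluingDatum.isIso_map_fst _ Δ.isIso_restrict_τ M)
    (isIso_ofLocalize _ _)

lemma ofLocalize_naturality (U : W.Opens) {M N : W.Modules} (f : M ⟶ N) :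
    (restrictFunctor U.ι).map ((localize U).map f) ≫ ofLocalize U N =
      ofLocalize U M ≫ (restrictFunctor U.ι).map f :=
  (restrictAdjunction U.ι).counit.naturality ((restrictFunctor U.ι).map f)

lemma twistHom₀_naturality {M N : W.Modules} (f : M ⟶ N) :
    (restrictFunctor Δ.U₀.ι).map (Δ.twist.map f) ≫ Δ.twistHom₀ N =
      Δ.twistHom₀ M ≫ (restrictFunctor Δ.U₀.ι).map f := by
  have h1 : (restrictFunctor Δ.U₀.ι).map (Δ.twist.map f) ≫
      (restrictFunctor Δ.U₀.ι).map (Δ.gluingDatum.fst N) =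
    (restrictFunctor Δ.U₀.ι).map (Δ.gluingDatum.fst M) ≫
      (restrictFunctor Δ.U₀.ι).map ((localize Δ.U₀).map f) :=
    ((restrictFunctor Δ.U₀.ι).map_comp _ _).symm.trans
      ((congrArg (restrictFunctor Δ.U₀.ι).map (Δ.gluingDatum.fst_naturality f)).trans
        ((restrictFunctor Δ.U₀.ι).map_comp _ _))
  unfold twistHom₀
  refine (Category.assoc _ _ _).symm.trans ((congrArg (· ≫ ofLocalize Δ.U₀ N) h1).trans ?_)
  refine (Category.assoc _ _ _).trans (Eq.trans ?_ (Category.assoc _ _ _).symm)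
  exact congrArg ((restrictFunctor Δ.U₀.ι).map (Δ.gluingDatum.fst M) ≫ ·)
    (ofLocalize_naturality Δ.U₀ f)

/-- Over `U₀`, the twist is isomorphic to the identity. -/
def twistIso₀ : Δ.twist ⋙ restrictFunctor Δ.U₀.ι ≅ restrictFunctor Δ.U₀.ι ⋙ 𝟭 _ :=
  NatIso.ofComponents (fun M => @asIso _ _ _ _ (Δ.twistHom₀ M) (Δ.isIso_twistHom₀ M))
    fun f => Δ.twistHom₀_naturality f

lemma pushforward_counit_smul (U : W.Opens) (t : Γ(U, ⊤)) (M : W.Modules) :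
    (restrictFunctor U.ι).map ((pushforward U.ι).map ((globalSMul t).app (M.restrict U.ι))) ≫
      ofLocalize U M = ofLocalize U M ≫ (globalSMul t).app (M.restrict U.ι) :=
  (restrictAdjunction U.ι).counit.naturality ((globalSMul t).app ((restrictFunctor U.ι).obj M))

/-- Over `U₀`, the canonical section is the multiplication by `t`. -/
lemma map_twistSection_twistIso₀ (M : W.Modules) :
    (restrictFunctor Δ.U₀.ι).map (Δ.twistSection.app M) ≫ Δ.twistIso₀.hom.app M =
      (globalSMul Δ.t).app ((restrictFunctor Δ.U₀.ι).obj M) := by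
  have h2 : (restrictFunctor Δ.U₀.ι).map (Δ.gluingDatum.sec M) ≫
      (restrictFunctor Δ.U₀.ι).map (Δ.gluingDatum.fst M) =
        (restrictFunctor Δ.U₀.ι).map (toLocalize Δ.U₀ M) ≫ (restrictFunctor Δ.U₀.ι).map
          ((pushforward Δ.U₀.ι).map ((globalSMul Δ.t).app (M.restrict Δ.U₀.ι))) :=
    ((restrictFunctor Δ.U₀.ι).map_comp _ _).symm.trans
      ((congrArg (restrictFunctor Δ.U₀.ι).map (Δ.gluingDatum.sec_fst M)).trans
        ((restrictFunctor Δ.U₀.ι).map_comp _ _))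
  have h3 : (restrictFunctor Δ.U₀.ι).map (Δ.gluingDatum.sec M) ≫ Δ.twistHom₀ M =
      (globalSMul Δ.t).app (M.restrict Δ.U₀.ι) := by
    unfold twistHom₀
    refine (Category.assoc _ _ _).symm.trans ((congrArg (· ≫ ofLocalize Δ.U₀ M) h2).trans ?_)
    refine (Category.assoc _ _ _).trans ?_
    refine (congrArg ((restrictFunctor Δ.U₀.ι).map (toLocalize Δ.U₀ M) ≫ ·)
      (pushforward_counit_smul Δ.U₀ Δ.t M)).trans ?_
    refine (Category.assoc _ _ _).symm.trans ?_
    refine (congrArg (· ≫ (globalSMul Δ.t).app (M.restrict Δ.U₀.ι))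
      (map_toLocalize_ofLocalize Δ.U₀ M)).trans ?_
    exact Category.id_comp _
  exact h3

end TwistDatum

end

/-! ### Modification of a filtered bundle along a divisor -/

section

open Scheme.Modules
variable {W Y : Scheme.{0}}

lemma globalSMul_zero_app (M : Y.Modules) : (globalSMul (0 : Γ(Y, ⊤))).app M = 0 := by
  refine hom_ext _ _ fun U => ?_
  ext s
  rw [globalSMul_app_app, map_zero]
  exact zero_smul Γ(Y, U) (show Γ(M, U) from s)

namespace TwistDatum
variable (Δ : TwistDatum W) {s : ℕ} {r : Fin s → ℕ}

/-- Over `U₀`, the modification along the divisor is the modification along `t`. -/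
def modificationIso₀ (j : Fin s) (S : Fin s ⥤ W.Modules) :
    modification Δ.twistSection j S ⋙ restrictFunctor Δ.U₀.ι ≅
      modification (globalSMul Δ.t) j (S ⋙ restrictFunctor Δ.U₀.ι) :=
  modificationIso Δ.twistSection (globalSMul Δ.t) j (restrictFunctor Δ.U₀.ι) Δ.twistIso₀
    Δ.map_twistSection_twistIso₀ S _ (Iso.refl _)

/-- Over `U₁`, the modification along the divisor changes nothing. -/
def modificationIso₁ (j : Fin s) (S : Fin s ⥤ W.Modules) :
    modification Δ.twistSection j S ⋙ restrictFunctor Δ.U₁.ι ≅ S ⋙ restrictFunctor Δ.U₁.ι :=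
  modificationIso Δ.twistSection (𝟙 (𝟭 _)) j (restrictFunctor Δ.U₁.ι) Δ.twistIso₁
    Δ.map_twistSection_twistIso₁ S _ (Iso.refl _) ≪≫
    (modificationIsoSelf (𝟙 (𝟭 _)) j _ fun _ => inferInstanceAs (IsIso (𝟙 _))).symm

/-- Modification along the divisor preserves filtered bundles: both over `U₀` and over `U₁` it is a
modification along an endomorphism of the identity functor. -/
lemma isFiltered_modification (hΔ : Δ.U₀ ⊔ Δ.U₁ = ⊤) (j : Fin s) {S : Fin s ⥤ W.Modules}
    (hS : IsFiltered r S) : IsFiltered r (modification Δ.twistSection j S) := by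
  have hr (U : W.Opens) : IsFiltered r (S ⋙ restrictFunctor U.ι) :=
    (hS.pullback U.ι).of_iso (Functor.isoWhiskerLeft S (restrictFunctorIsoPullback U.ι))
  refine .of_restrict fun w => ?_
  obtain hw | hw : w ∈ Δ.U₀ ∨ w ∈ Δ.U₁ := by
    have : w ∈ Δ.U₀ ⊔ Δ.U₁ := hΔ ▸ trivial
    exact this
  · exact ⟨_, Δ.U₀.ι, inferInstance, by simpa using hw,
      ((hr Δ.U₀).modification (globalSMul Δ.t) j).of_iso (Δ.modificationIso₀ j S)⟩
  · exact ⟨_, Δ.U₁.ι, inferInstance, by simpa using hw, (hr Δ.U₁).of_iso (Δ.modificationIso₁ j S)⟩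

/-- The pullback of a modification along a morphism to `U₀`. -/
def modificationPullback₀ (j : Fin s) (S : Fin s ⥤ W.Modules) (i : Y ⟶ Δ.U₀) (f : Y ⟶ W)
    (h : i ≫ Δ.U₀.ι = f) (E : Fin s ⥤ Y.Modules) (e : E ≅ S ⋙ Scheme.Modules.pullback f) :
    modification (globalSMul (i.appTop Δ.t)) j E ≅
      modification Δ.twistSection j S ⋙ Scheme.Modules.pullback f :=
  let a : restrictFunctor Δ.U₀.ι ⋙ Scheme.Modules.pullback i ≅ Scheme.Modules.pullback f :=
    Functor.isoWhiskerRight (restrictFunctorIsoPullback _) _ ≪≫ pullbackComp i Δ.U₀.ι ≪≫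
      pullbackCongr h
  (modificationIso (globalSMul Δ.t) (globalSMul (i.appTop Δ.t)) j (Scheme.Modules.pullback i)
    (Iso.refl _) (fun M => (Category.comp_id _).trans (pullback_globalSMul i Δ.t M)) _ E
      (Functor.isoWhiskerLeft S a ≪≫ e.symm)).symm ≪≫
  (Functor.isoWhiskerRight (Δ.modificationIso₀ j S) (Scheme.Modules.pullback i)).symm ≪≫
    Functor.isoWhiskerLeft (modification Δ.twistSection j S) a

/-- The pullback of a modification along a morphism to `U₁`. -/
def modificationPullback₁ (j : Fin s) (S : Fin s ⥤ W.Modules) (i : Y ⟶ Δ.U₁) (f : Y ⟶ W)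
    (h : i ≫ Δ.U₁.ι = f) : S ⋙ Scheme.Modules.pullback f ≅
      modification Δ.twistSection j S ⋙ Scheme.Modules.pullback f :=
  let a : restrictFunctor Δ.U₁.ι ⋙ Scheme.Modules.pullback i ≅ Scheme.Modules.pullback f :=
    Functor.isoWhiskerRight (restrictFunctorIsoPullback _) _ ≪≫ pullbackComp i Δ.U₁.ι ≪≫
      pullbackCongr h
  (Functor.isoWhiskerLeft S a).symm ≪≫
    (Functor.isoWhiskerRight (Δ.modificationIso₁ j S) (Scheme.Modules.pullback i)).symm ≪≫
    Functor.isoWhiskerLeft (modification Δ.twistSection j S) a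

end TwistDatum

end

/-! ### Evaluation of homogeneous fractions -/

section

open HomogeneousLocalization

section Algebra
variable {N : ℕ} {R R' : Type*} [CommRing R] [CommRing R']

/-- Evaluation of integral polynomials. -/
def coordEval (a : Fin (N + 1) → R) : MvPolynomial (Fin (N + 1)) ℤ →+* R :=
  MvPolynomial.eval₂Hom (Int.castRingHom R) a

@[simp]
lemma coordEval_X (a : Fin (N + 1) → R) (i : Fin (N + 1)) :
    coordEval a (MvPolynomial.X i) = a i := by
  simp [coordEval]

lemma map_coordEval (φ : R →+* R') (a : Fin (N + 1) → R) (p : MvPolynomial (Fin (N + 1)) ℤ) :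
    φ (coordEval a p) = coordEval (fun k => φ (a k)) p := by
  have : φ.comp (coordEval a) = coordEval (fun k => φ (a k)) :=
    MvPolynomial.ringHom_ext (by simp) (by simp)
  exact congr($this p)

lemma coordEval_smul (c : R) (a : Fin (N + 1) → R) {m : ℕ} {p : MvPolynomial (Fin (N + 1)) ℤ}
    (hp : p ∈ stdGrading N m) : coordEval (fun k => c * a k) p = c ^ m * coordEval a p := by
  rw [MvPolynomial.mem_homogeneousSubmodule] at hp
  simp only [coordEval, MvPolynomial.coe_eval₂Hom, MvPolynomial.eval₂_eq', Finset.mul_sum]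
  refine Finset.sum_congr rfl fun d hd => ?_
  have := hp (MvPolynomial.mem_support_iff.1 hd)
  rw [Finsupp.weight_apply, Finsupp.sum_fintype _ _ (by simp)] at this
  simp only [mul_pow, Finset.prod_mul_distrib, Finset.prod_pow_eq_pow_sum]
  simp only [Pi.one_apply, smul_eq_mul, mul_one] at this
  rw [this]
  ring

lemma X_mem_stdGrading (i : Fin (N + 1)) : MvPolynomial.X i ∈ stdGrading N 1 :=
  MvPolynomial.isHomogeneous_X ℤ i

/-- Evaluation of homogeneous fractions. -/
def awayEval {f : MvPolynomial (Fin (N + 1)) ℤ} (a : Fin (N + 1) → R)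
    (hf : IsUnit (coordEval a f)) : Away (stdGrading N) f →+* R :=
  (Localization.awayLift (coordEval a) f hf).comp (algebraMap _ (Localization.Away f))

lemma awayEval_mk {f : MvPolynomial (Fin (N + 1)) ℤ} (a : Fin (N + 1) → R)
    (hf : IsUnit (coordEval a f)) {d : ℕ} (hd : f ∈ stdGrading N d) (n : ℕ)
    (x : MvPolynomial (Fin (N + 1)) ℤ) (hx : x ∈ stdGrading N (n • d)) :
    awayEval a hf (Away.mk _ hd n x hx) * coordEval a f ^ n = coordEval a x := by
  have h1 : algebraMap _ (Localization.Away f) (Away.mk _ hd n x hx) =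
    Localization.mk x ⟨f ^ n, by use n⟩ := Away.val_mk _ n hd x hx
  have h2 : Localization.mk x ⟨f ^ n, by use n⟩ * algebraMap _ (Localization.Away f) (f ^ n) =
      algebraMap _ (Localization.Away f) x := by
    rw [← Localization.mk_one_eq_algebraMap, ← Localization.mk_one_eq_algebraMap,
      Localization.mk_mul,
      Localization.mk_eq_mk_iff, Localization.r_iff_exists]
    exact ⟨1, by simp; ring⟩
  have h3 := congrArg (Localization.awayLift (coordEval a) f hf) h2
  rw [map_mul] at h3
  have h4 (y) : Localization.awayLift (coordEval a) f hf (algebraMap _ (Localization.Away f) y) =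
    coordEval a y := IsLocalization.Away.lift_eq _ _ _
  rw [h4, h4, map_pow] at h3
  rw [awayEval, RingHom.comp_apply, h1, h3]

lemma eq_awayEval {f : MvPolynomial (Fin (N + 1)) ℤ} (a : Fin (N + 1) → R)
    (hf : IsUnit (coordEval a f)) {d : ℕ} (hd : f ∈ stdGrading N d)
    (φ : Away (stdGrading N) f →+* R)
    (h : ∀ n x hx, φ (Away.mk _ hd n x hx) * coordEval a f ^ n = coordEval a x) :
    φ = awayEval a hf := by
  ext z
  obtain ⟨n, x, hx, rfl⟩ := Away.mk_surjective _ hd z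
  rw [← (hf.pow n).mul_left_inj, awayEval_mk, h]

lemma comp_awayEval {f : MvPolynomial (Fin (N + 1)) ℤ} (a : Fin (N + 1) → R)
    (hf : IsUnit (coordEval a f)) {d : ℕ} (hd : f ∈ stdGrading N d) (φ : R →+* R')
    (hf' : IsUnit (coordEval (fun k => φ (a k)) f)) :
    φ.comp (awayEval a hf) = awayEval (fun k => φ (a k)) hf' :=
  eq_awayEval _ _ hd _ fun n x hx => by
    rw [RingHom.comp_apply, ← map_coordEval, ← map_pow, ← map_mul, awayEval_mk, map_coordEval]

lemma awayEval_smul {f : MvPolynomial (Fin (N + 1)) ℤ} (a : Fin (N + 1) → R)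
    (hf : IsUnit (coordEval a f)) {d : ℕ} (hd : f ∈ stdGrading N d) (c : R)
    (hc : IsUnit c) (hf' : IsUnit (coordEval (fun k => c * a k) f)) :
    awayEval (fun k => c * a k) hf' = awayEval a hf := by
  refine eq_awayEval _ _ hd _ fun n x hx => ?_
  rw [← (hc.pow (n • d)).mul_right_inj, ← coordEval_smul c a hx,
    ← awayEval_mk _ hf' hd n x hx, coordEval_smul c a hd, mul_pow, smul_eq_mul]
  ring

lemma awayEval_awayMap {f g x : MvPolynomial (Fin (N + 1)) ℤ} (a : Fin (N + 1) → R)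
    {d e : ℕ} (hd : f ∈ stdGrading N d) (hg : g ∈ stdGrading N e) (hx : x = f * g)
    (hf : IsUnit (coordEval a f)) (hx' : IsUnit (coordEval a x)) :
    (awayEval a hx').comp (awayMap (stdGrading N) hg hx) = awayEval a hf := by
  refine eq_awayEval _ _ hd _ fun n y hy => ?_
  have hu : IsUnit (coordEval a g ^ n) := by
    rw [hx, map_mul] at hx'
    exact (isUnit_of_mul_isUnit_right hx').pow n
  have := awayEval_mk a hx' (hx ▸ SetLike.mul_mem_graded hd hg) n (y * g ^ n)
    (by rw [smul_add]; exact SetLike.mul_mem_graded hy (SetLike.pow_mem_graded n hg))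
  have e1 : coordEval a x = coordEval a f * coordEval a g := by rw [hx, map_mul]
  rw [map_mul, map_pow, e1, mul_pow, ← mul_assoc] at this
  rw [RingHom.comp_apply, awayMap_mk]
  exact hu.mul_left_inj.1 this

/-- The coordinate `X_k / X_i`. -/
def coord (i k : Fin (N + 1)) : Away (stdGrading N) (MvPolynomial.X i) :=
  Away.mk _ (X_mem_stdGrading i) 1 (MvPolynomial.X k) (X_mem_stdGrading k)

lemma awayEval_coord (a : Fin (N + 1) → R) {i : Fin (N + 1)} (k : Fin (N + 1))
    (hf : IsUnit (coordEval a (MvPolynomial.X i))) : awayEval a hf (coord i k) * a i = a k := by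
  have := awayEval_mk a hf (X_mem_stdGrading i) 1 (MvPolynomial.X k) (X_mem_stdGrading k)
  rw [pow_one, coordEval_X, coordEval_X] at this
  exact this

lemma coord_self (i : Fin (N + 1)) : coord i i = 1 := by
  apply val_injective
  rw [coord, Away.val_mk, val_one, ← Localization.mk_one, Localization.mk_eq_mk_iff,
    Localization.r_iff_exists]
  exact ⟨1, by simp⟩

/-- Homogeneous fractions are polynomials in the coordinates. -/
lemma mk_eq_coordEval (i : Fin (N + 1)) (n : ℕ) (x : MvPolynomial (Fin (N + 1)) ℤ)
    (hx : x ∈ stdGrading N (n • 1)) :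
    Away.mk _ (X_mem_stdGrading i) n x hx = coordEval (coord i) x := by
  apply val_injective
  have h1 : (coordEval (coord i) x).val = coordEval (fun k => (coord i k).val) x :=
    map_coordEval (algebraMap (Away (stdGrading N) (MvPolynomial.X i))
      (Localization.Away (MvPolynomial.X i : MvPolynomial (Fin (N + 1)) ℤ))) (coord i) x
  have h2 (k : Fin (N + 1)) : algebraMap (MvPolynomial (Fin (N + 1)) ℤ)
      (Localization.Away (MvPolynomial.X i : MvPolynomial (Fin (N + 1)) ℤ)) (MvPolynomial.X k) =
      algebraMap (MvPolynomial (Fin (N + 1)) ℤ) (Localization.Away (MvPolynomial.X i))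
        (MvPolynomial.X i) * (coord i k).val := by
    rw [coord, Away.val_mk, ← Localization.mk_one_eq_algebraMap,
      ← Localization.mk_one_eq_algebraMap,
      Localization.mk_mul, Localization.mk_eq_mk_iff, Localization.r_iff_exists]
    exact ⟨1, by simp⟩
  have h3 : algebraMap (MvPolynomial (Fin (N + 1)) ℤ)
      (Localization.Away (MvPolynomial.X i : MvPolynomial (Fin (N + 1)) ℤ)) x =
      algebraMap (MvPolynomial (Fin (N + 1)) ℤ) (Localization.Away (MvPolynomial.X i))
        (MvPolynomial.X i) ^ (n • 1) *
        coordEval (fun k => (coord i k).val) x := by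
    rw [← coordEval_smul _ _ hx, ← funext h2, ← map_coordEval]
    congr 1
    have : coordEval (MvPolynomial.X) = RingHom.id (MvPolynomial (Fin (N + 1)) ℤ) :=
      MvPolynomial.ringHom_ext (by simp) (by simp)
    exact congr($this x).symm
  have hu : IsUnit (algebraMap (MvPolynomial (Fin (N + 1)) ℤ)
      (Localization.Away (MvPolynomial.X i : MvPolynomial (Fin (N + 1)) ℤ)) (MvPolynomial.X i)) :=
    IsLocalization.Away.algebraMap_isUnit _
  rw [h1, ← (hu.pow (n • 1)).mul_right_inj, ← h3, Away.val_mk, ← map_pow,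
    ← Localization.mk_one_eq_algebraMap, ← Localization.mk_one_eq_algebraMap,
    Localization.mk_mul, Localization.mk_eq_mk_iff, Localization.r_iff_exists]
  exact ⟨1, by simp⟩

lemma away_hom_ext {i : Fin (N + 1)} {φ ψ : Away (stdGrading N) (MvPolynomial.X i) →+* R}
    (h : ∀ k, φ (coord i k) = ψ (coord i k)) : φ = ψ := by
  ext z
  obtain ⟨n, x, hx, rfl⟩ := Away.mk_surjective _ (X_mem_stdGrading i) z
  rw [mk_eq_coordEval, map_coordEval, map_coordEval, funext h]

lemma isUnit_coordEval_map_coord {i : Fin (N + 1)} (φ : Away (stdGrading N)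
    (MvPolynomial.X i) →+* R) :
    IsUnit (coordEval (fun k => φ (coord i k)) (MvPolynomial.X i)) := by
  rw [coordEval_X, coord_self, map_one]
  exact isUnit_one

lemma eq_awayEval_coord {i : Fin (N + 1)} (φ : Away (stdGrading N) (MvPolynomial.X i) →+* R) :
    φ = awayEval (fun k => φ (coord i k)) (isUnit_coordEval_map_coord φ) := by
  refine away_hom_ext fun k => ?_
  have := awayEval_coord (fun k => φ (coord i k)) k (isUnit_coordEval_map_coord φ)
  simpa [coord_self] using this.symm

end Algebra

end

/-! ### Morphisms to projective space given by coordinates -/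

section

open HomogeneousLocalization

variable {N : ℕ} {X Y : Scheme.{0}}

/-- The standard affine open subscheme `x_i ≠ 0` of projective space. -/
abbrev chart (i : Fin (N + 1)) :
    Spec (CommRingCat.of (Away (stdGrading N) (MvPolynomial.X i))) ⟶ Proj (stdGrading N) :=
  Proj.awayι (stdGrading N) (MvPolynomial.X i) (X_mem_stdGrading i) one_pos

/-- The morphism to projective space with homogeneous coordinates `a`, the `i`-th of which is
invertible. -/
def pt (a : Fin (N + 1) → Γ(X, ⊤)) (i : Fin (N + 1)) (hi : IsUnit (a i)) :
    X ⟶ Proj (stdGrading N) :=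
  X.toSpecΓ ≫ Spec.map (CommRingCat.ofHom (awayEval a ((coordEval_X a i).symm ▸ hi))) ≫ chart i

lemma comp_pt (f : Y ⟶ X) (a : Fin (N + 1) → Γ(X, ⊤)) (i : Fin (N + 1)) (hi : IsUnit (a i)) :
    f ≫ pt a i hi = pt (fun k => f.appTop (a k)) i (hi.map f.appTop.hom) := by
  rw [pt, pt, Scheme.toSpecΓ_naturality_assoc, ← Spec.map_comp_assoc]
  congr 4
  apply CommRingCat.hom_ext
  exact comp_awayEval a _ (X_mem_stdGrading i) f.appTop.hom _

lemma pt_index (a : Fin (N + 1) → Γ(X, ⊤)) (i j : Fin (N + 1)) (hi : IsUnit (a i))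
    (hj : IsUnit (a j)) : pt a i hi = pt a j hj := by
  have hi' : IsUnit (coordEval a (MvPolynomial.X i)) := (coordEval_X a i).symm ▸ hi
  have hj' : IsUnit (coordEval a (MvPolynomial.X j)) := (coordEval_X a j).symm ▸ hj
  have hu : IsUnit (coordEval a (MvPolynomial.X i * MvPolynomial.X j)) := by
    rw [map_mul]; exact hi'.mul hj'
  rw [pt, pt]
  rw [← awayEval_awayMap a (X_mem_stdGrading i) (X_mem_stdGrading j) rfl hi' hu,
    ← awayEval_awayMap a (X_mem_stdGrading j) (X_mem_stdGrading i) (mul_comm _ _) hj' hu,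
    CommRingCat.ofHom_comp, CommRingCat.ofHom_comp, Spec.map_comp, Spec.map_comp, Category.assoc,
    Category.assoc, Proj.SpecMap_awayMap_awayι, Proj.SpecMap_awayMap_awayι]

lemma pt_smul (a b : Fin (N + 1) → Γ(X, ⊤)) (i : Fin (N + 1)) (hi : IsUnit (a i))
    (hb : IsUnit (b i)) (c : Γ(X, ⊤)) (hc : IsUnit c) (h : ∀ k, b k = c * a k) :
    pt b i hb = pt a i hi := by
  obtain rfl := funext h
  rw [pt, pt, awayEval_smul a _ (X_mem_stdGrading i) c hc]

lemma chart_eq_pt (i : Fin (N + 1)) (f : X ⟶ Spec (CommRingCat.of (Away (stdGrading N)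
    (MvPolynomial.X i)))) :
    f ≫ chart i = pt (fun k => (f.appTop.hom.comp (Scheme.ΓSpecIso _).inv.hom) (coord i k)) i
      (by rw [coord_self, map_one]; exact isUnit_one) := by
  rw [pt, ← eq_awayEval_coord, ← Category.assoc X.toSpecΓ]
  congr 1
  have : CommRingCat.ofHom (f.appTop.hom.comp (Scheme.ΓSpecIso (CommRingCat.of
      (Away (stdGrading N) (MvPolynomial.X i)))).inv.hom) =
        (Scheme.ΓSpecIso _).inv ≫ f.appTop := rfl
  rw [this, Spec.map_comp, ← Category.assoc, ← Scheme.toSpecΓ_naturality, Category.assoc]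
  simp

lemma pt_preimage_basicOpen (a : Fin (N + 1) → Γ(X, ⊤)) (i j : Fin (N + 1)) (hi : IsUnit (a i)) :
    pt a i hi ⁻¹ᵁ Proj.basicOpen (stdGrading N) (MvPolynomial.X j) = X.basicOpen (a j) := by
  have hi' : IsUnit (coordEval a (MvPolynomial.X i)) := (coordEval_X a i).symm ▸ hi
  rw [pt, Scheme.Hom.comp_preimage, Scheme.Hom.comp_preimage, Proj.awayι_preimage_basicOpen
    (stdGrading N) (X_mem_stdGrading i) one_pos (X_mem_stdGrading j) one_pos]
  erw [SpecMap_preimage_basicOpen]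
  rw [Scheme.toSpecΓ_preimage_basicOpen]
  have h : Away.isLocalizationElem (X_mem_stdGrading i) (X_mem_stdGrading j) = coord i j := by
    apply val_injective
    rw [coord, Away.val_mk, Away.val_mk]
    simp
  rw [h]
  rw [← awayEval_coord a j hi', Scheme.basicOpen_mul, Scheme.basicOpen_of_isUnit _ hi, inf_top_eq]
  rfl

lemma isUnit_of_pt_eq (a b : Fin (N + 1) → Γ(X, ⊤)) (i j : Fin (N + 1)) (hi : IsUnit (a i))
    (hj : IsUnit (b j)) (h : pt a i hi = pt b j hj) : IsUnit (b i) := by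
  have h1 : X.basicOpen (b i) = ⊤ := by
    rw [← pt_preimage_basicOpen b j i hj, ← h, pt_preimage_basicOpen,
      Scheme.basicOpen_of_isUnit _ hi]
  have h2 (U : X.Opens) (hU : U ≤ ⊤) (hU' : U = ⊤)
      (h : IsUnit (X.presheaf.map (homOfLE hU).op (b i))) : IsUnit (b i) := by
    subst hU'
    simpa [show homOfLE hU = 𝟙 _ from rfl] using h
  exact h2 _ (X.basicOpen_le _) h1 (X.toRingedSpace.isUnit_res_basicOpen (b i))

lemma exists_smul_of_pt_eq (a b : Fin (N + 1) → Γ(X, ⊤)) (i j : Fin (N + 1)) (hi : IsUnit (a i))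
    (hj : IsUnit (b j)) (h : pt a i hi = pt b j hj) : ∃ c, IsUnit c ∧ ∀ k, b k = c * a k := by
  have hb := isUnit_of_pt_eq a b i j hi hj h
  rw [pt_index b j i hj hb, pt, pt, ← Category.assoc, ← Category.assoc, cancel_mono] at h
  have h1 := congrArg (fun f => (Scheme.ΓSpecIso _).inv ≫ f.appTop) h
  simp only [Scheme.Hom.comp_appTop, Scheme.toSpecΓ_appTop, Scheme.ΓSpecIso_naturality,
    Iso.inv_hom_id_assoc] at h1
  have h2 := congrArg CommRingCat.Hom.hom h1
  rw [CommRingCat.hom_ofHom, CommRingCat.hom_ofHom] at h2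
  obtain ⟨u, hu⟩ := id hi
  have hbi (k) := awayEval_coord b k ((coordEval_X b i).symm ▸ hb)
  have hai (k) := awayEval_coord a k ((coordEval_X a i).symm ▸ hi)
  refine ⟨b i * ↑u⁻¹, hb.mul u⁻¹.isUnit, fun k => ?_⟩
  rw [← hbi k, ← h2, ← hai k]
  linear_combination (-(awayEval a _ (coord i k)) * b i) * u.inv_mul +
    (awayEval a _ (coord i k)) * b i * ↑u⁻¹ * hu

end

/-! ### The Segre embedding -/

section

open HomogeneousLocalization

variable {N M : ℕ} {T T' : Scheme.{0}}

/-- The coordinates of a morphism to a standard affine open subscheme of projective space. -/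
def coords (i : Fin (N + 1)) (u : T ⟶ Spec (CommRingCat.of (Away (stdGrading N)
    (MvPolynomial.X i)))) (k : Fin (N + 1)) : Γ(T, ⊤) :=
  (u.appTop.hom.comp (Scheme.ΓSpecIso _).inv.hom) (coord i k)

lemma coords_self (i : Fin (N + 1)) (u : T ⟶ Spec (CommRingCat.of (Away (stdGrading N)
    (MvPolynomial.X i)))) : coords i u i = 1 := by
  rw [coords, coord_self, map_one]

lemma comp_chart (i : Fin (N + 1)) (u : T ⟶ Spec (CommRingCat.of (Away (stdGrading N)
    (MvPolynomial.X i)))) :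
    u ≫ chart i = pt (coords i u) i (by rw [coords_self]; exact isUnit_one) :=
  chart_eq_pt i u

lemma coords_comp (i : Fin (N + 1)) (h : T' ⟶ T) (u : T ⟶ Spec (CommRingCat.of (Away (stdGrading N)
    (MvPolynomial.X i)))) (k) : coords i (h ≫ u) k = h.appTop (coords i u k) := by
  rw [coords, Scheme.Hom.comp_appTop]
  rfl

/-- The covering of projective space by the standard affine open subschemes. -/
def chartCover (N : ℕ) : (Proj (stdGrading N)).OpenCover :=
  (Proj.affineOpenCoverOfIrrelevantLESpan (stdGrading N) (fun i : Fin (N + 1) => MvPolynomial.X i)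
    X_mem_stdGrading (fun _ => one_pos) (by
      refine (HomogeneousIdeal.toIdeal_irrelevant_le _).2 fun d hd x hx => ?_
      change x ∈ Ideal.span _
      rw [← Set.image_univ, MvPolynomial.mem_ideal_span_X_image]
      intro m hm
      have := hx (MvPolynomial.mem_support_iff.1 hm)
      by_contra! h
      have h0 : m = 0 := by ext i; simpa using h i
      rw [h0, map_zero] at this
      omega)).openCover

/-- Products of coordinates. -/
def prodCoords {K : ℕ} (e : Fin (N + 1) × Fin (M + 1) ≃ Fin (K + 1)) (a : Fin (N + 1) → Γ(T, ⊤))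
    (b : Fin (M + 1) → Γ(T, ⊤)) (k : Fin (K + 1)) : Γ(T, ⊤) :=
  a (e.symm k).1 * b (e.symm k).2

lemma pt_prodCoords_eq {K : ℕ} (e : Fin (N + 1) × Fin (M + 1) ≃ Fin (K + 1))
    {a a' : Fin (N + 1) → Γ(T, ⊤)} {b b' : Fin (M + 1) → Γ(T, ⊤)} {i i' j j'} (hi : IsUnit (a i))
    (hi' : IsUnit (a' i')) (hj : IsUnit (b j)) (hj' : IsUnit (b' j'))
    (ha : pt a i hi = pt a' i' hi') (hb : pt b j hj = pt b' j' hj') {k k'}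
    (hk : IsUnit (prodCoords e a b k)) (hk' : IsUnit (prodCoords e a' b' k')) :
    pt (prodCoords e a b) k hk = pt (prodCoords e a' b') k' hk' := by
  obtain ⟨c, hc, hc'⟩ := exists_smul_of_pt_eq _ _ _ _ _ _ ha
  obtain ⟨d, hd, hd'⟩ := exists_smul_of_pt_eq _ _ _ _ _ _ hb
  have h (k) : prodCoords e a' b' k = (c * d) * prodCoords e a b k := by
    rw [prodCoords, prodCoords, hc', hd']; ring
  have hk'' : IsUnit (prodCoords e a' b' k) := by rw [h]; exact (hc.mul hd).mul hk
  rw [pt_index _ k' k hk' hk'', pt_smul _ _ _ hk hk'' _ (hc.mul hd) h]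

lemma isUnit_prodCoords {K : ℕ} (e : Fin (N + 1) × Fin (M + 1) ≃ Fin (K + 1)) (i : Fin (N + 1))
    (j : Fin (M + 1)) (u : T ⟶ Spec (CommRingCat.of (Away (stdGrading N) (MvPolynomial.X i))))
    (v : T ⟶ Spec (CommRingCat.of (Away (stdGrading M) (MvPolynomial.X j)))) :
    IsUnit (prodCoords e (coords i u) (coords j v) (e (i, j))) := by
  simp [prodCoords, coords_self]

/-- The product of two affine charts. -/
abbrev prodChart (i : Fin (N + 1)) (j : Fin (M + 1)) : Scheme.{0} :=
  pullback (chart i ≫ terminal.from _) (chart j ≫ terminal.from _)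

/-- The covering of the product of two projective spaces by products of charts. -/
def prodChartCover (N M : ℕ) :
    (pullback (terminal.from (Proj (stdGrading N)))
      (terminal.from (Proj (stdGrading M)))).OpenCover :=
  Scheme.Pullback.openCoverOfLeftRight (chartCover N) (chartCover M) _ _

/-- The inclusion of a product of charts. -/
def prodChartι (i : Fin (N + 1)) (j : Fin (M + 1)) : prodChart i j ⟶
    pullback (terminal.from (Proj (stdGrading N))) (terminal.from (Proj (stdGrading M))) :=
  (prodChartCover N M).f (i, j)

lemma prodChartι_fst (i : Fin (N + 1)) (j : Fin (M + 1)) :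
    prodChartι i j ≫ pullback.fst _ _ = pullback.fst _ _ ≫ chart i :=
  pullback.lift_fst _ _ _

lemma prodChartι_snd (i : Fin (N + 1)) (j : Fin (M + 1)) :
    prodChartι i j ≫ pullback.snd _ _ = pullback.snd _ _ ≫ chart j :=
  pullback.lift_snd _ _ _

instance (i : Fin (N + 1)) (j : Fin (M + 1)) : IsOpenImmersion (prodChartι i j) :=
  (prodChartCover N M).map_prop (i, j)

/-- The Segre morphism on a product of charts. -/
def segreChart {K : ℕ} (e : Fin (N + 1) × Fin (M + 1) ≃ Fin (K + 1)) (i : Fin (N + 1))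
    (j : Fin (M + 1)) : (prodChart i j : Scheme.{0}) ⟶ Proj (stdGrading K) :=
  pt (prodCoords e (coords i (pullback.fst _ _)) (coords j (pullback.snd _ _))) (e (i, j))
    (isUnit_prodCoords e i j _ _)

lemma comp_segreChart {K : ℕ} (e : Fin (N + 1) × Fin (M + 1) ≃ Fin (K + 1)) (i : Fin (N + 1))
    (j : Fin (M + 1)) (h : T ⟶ prodChart i j) : h ≫ segreChart e i j =
      pt (prodCoords e (coords i (h ≫ pullback.fst _ _)) (coords j (h ≫ pullback.snd _ _)))
        (e (i, j))
    (isUnit_prodCoords e i j _ _) := by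
  rw [segreChart, comp_pt]
  congr 1
  ext k
  simp [prodCoords, coords_comp]

lemma segreChart_glue {K : ℕ} (e : Fin (N + 1) × Fin (M + 1) ≃ Fin (K + 1)) (i i' : Fin (N + 1))
    (j j' : Fin (M + 1)) : pullback.fst (prodChartι i j) (prodChartι i' j') ≫ segreChart e i j =
      pullback.snd (prodChartι i j) (prodChartι i' j') ≫ segreChart e i' j' := by
  rw [comp_segreChart, comp_segreChart]
  have h : pullback.fst (prodChartι i j) (prodChartι i' j') ≫ prodChartι i j =
    pullback.snd (prodChartι i j) (prodChartι i' j') ≫ prodChartι i' j' := pullback.condition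
  refine pt_prodCoords_eq e (i := i) (i' := i') (j := j) (j' := j')
    (by rw [coords_self]; exact isUnit_one)
    (by rw [coords_self]; exact isUnit_one) (by rw [coords_self]; exact isUnit_one)
    (by rw [coords_self]; exact isUnit_one) ?_ ?_ _ _
  · rw [← comp_chart, ← comp_chart, Category.assoc, Category.assoc, ← prodChartι_fst,
      ← prodChartι_fst]
    exact (Category.assoc _ _ _).symm.trans (congr($h ≫ pullback.fst _ _).trans
      (Category.assoc _ _ _))
  · rw [← comp_chart, ← comp_chart, Category.assoc, Category.assoc, ← prodChartι_snd,
      ← prodChartι_snd]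
    exact (Category.assoc _ _ _).symm.trans (congr($h ≫ pullback.snd _ _).trans
      (Category.assoc _ _ _))

/-- The Segre embedding. -/
def segre {K : ℕ} (e : Fin (N + 1) × Fin (M + 1) ≃ Fin (K + 1)) :
    pullback (terminal.from (Proj (stdGrading N))) (terminal.from (Proj (stdGrading M))) ⟶
      Proj (stdGrading K) :=
  (prodChartCover N M).glueMorphisms (fun x => segreChart e x.1 x.2)
    fun x y => segreChart_glue e x.1 y.1 x.2 y.2

lemma prodChartι_segre {K : ℕ} (e : Fin (N + 1) × Fin (M + 1) ≃ Fin (K + 1)) (i : Fin (N + 1))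
    (j : Fin (M + 1)) : prodChartι i j ≫ segre e = segreChart e i j :=
  (prodChartCover N M).ι_glueMorphisms _ _ _

/-- The Segre embedding on affine charts. -/
def segreAffine {K : ℕ} (e : Fin (N + 1) × Fin (M + 1) ≃ Fin (K + 1)) (i : Fin (N + 1))
    (j : Fin (M + 1)) : (prodChart i j : Scheme.{0}) ⟶
      Spec (CommRingCat.of (Away (stdGrading K) (MvPolynomial.X (e (i, j))))) :=
  Scheme.toSpecΓ _ ≫ Spec.map (CommRingCat.ofHom (awayEval
    (prodCoords e (coords i (pullback.fst _ _)) (coords j (pullback.snd _ _)))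
      (by rw [coordEval_X]; exact isUnit_prodCoords e i j _ _)))

lemma segreAffine_chart {K : ℕ} (e : Fin (N + 1) × Fin (M + 1) ≃ Fin (K + 1)) (i : Fin (N + 1))
    (j : Fin (M + 1)) : segreAffine e i j ≫ chart (e (i, j)) = segreChart e i j := by
  rw [segreAffine, segreChart, pt, Category.assoc]

instance (i : Fin (N + 1)) (j : Fin (M + 1)) : IsAffine (prodChart i j : Scheme.{0}) := by
  dsimp only [prodChart]
  infer_instance

lemma spec_hom_ext {R : CommRingCat.{0}} {f g : T ⟶ Spec R} (h : f.appTop = g.appTop) : f = g :=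
  ext_of_isAffine h

lemma chartHom_ext {i : Fin (N + 1)} {f g : T ⟶ Spec (CommRingCat.of (Away (stdGrading N)
    (MvPolynomial.X i)))} (h : ∀ k, coords i f k = coords i g k) : f = g := by
  have h1 : f.appTop.hom.comp (Scheme.ΓSpecIso _).inv.hom =
    g.appTop.hom.comp (Scheme.ΓSpecIso _).inv.hom := away_hom_ext h
  refine spec_hom_ext ?_
  rw [← cancel_epi (Scheme.ΓSpecIso _).inv]
  exact CommRingCat.hom_ext h1

lemma toSpecΓ_map_appTop {R : CommRingCat.{0}} (φ : R ⟶ Γ(T, ⊤)) (r : R) :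
    (T.toSpecΓ ≫ Spec.map φ).appTop ((Scheme.ΓSpecIso R).inv r) = φ r := by
  have : (Scheme.ΓSpecIso _).inv ≫ (T.toSpecΓ ≫ Spec.map φ).appTop = φ := by
    simp only [Scheme.Hom.comp_appTop, Scheme.toSpecΓ_appTop, Scheme.ΓSpecIso_naturality,
      Iso.inv_hom_id_assoc]
  exact congr($this r)

lemma exists_coords (i : Fin (N + 1)) (a : Fin (N + 1) → Γ(T, ⊤)) (h : a i = 1) :
    ∃ f : T ⟶ Spec (CommRingCat.of (Away (stdGrading N) (MvPolynomial.X i))), coords i f = a := by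
  have hi : IsUnit (coordEval a (MvPolynomial.X i)) := by rw [coordEval_X, h]; exact isUnit_one
  refine ⟨T.toSpecΓ ≫ Spec.map (CommRingCat.ofHom (awayEval a hi)), funext fun k => ?_⟩
  have h1 := awayEval_coord a k hi
  rw [h, mul_one] at h1
  exact (toSpecΓ_map_appTop (CommRingCat.ofHom (awayEval a hi)) (coord i k)).trans h1

/-- On a chart the Segre morphism is affine and given by the products `x_k y_l` of affine
coordinates. As `x_i = 1` and `y_j = 1`, the coordinates `x_k = x_k y_j` and `y_l = x_i y_l` are
among them, and they generate the coordinate ring of the chart. -/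
lemma surjective_segreAffine {K : ℕ} (e : Fin (N + 1) × Fin (M + 1) ≃ Fin (K + 1))
    (i : Fin (N + 1)) (j : Fin (M + 1)) : Function.Surjective (segreAffine e i j).appTop := by
  let Q : Scheme.{0} := prodChart i j
  let a : Fin (N + 1) → Γ(Q, ⊤) := coords i (pullback.fst _ _)
  let b : Fin (M + 1) → Γ(Q, ⊤) := coords j (pullback.snd _ _)
  have ha : a i = 1 := coords_self _ _
  have hb : b j = 1 := coords_self _ _
  have hu : IsUnit (coordEval (prodCoords e a b) (MvPolynomial.X (e (i, j)))) := by
    rw [coordEval_X]; exact isUnit_prodCoords e i j _ _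
  let φ := awayEval (prodCoords e a b) hu
  have hφ (k) : φ (coord (e (i, j)) k) = prodCoords e a b k := by
    have := awayEval_coord (prodCoords e a b) k hu
    rwa [show prodCoords e a b (e (i, j)) = 1 by simp [prodCoords, ha, hb], mul_one] at this
  let R' : CommRingCat.{0} := CommRingCat.of φ.range
  let ι : R' ⟶ Γ(Q, ⊤) := CommRingCat.ofHom φ.range.subtype
  have ha' (k) : a k ∈ φ.range := ⟨coord _ (e (k, j)), by rw [hφ]; simp [prodCoords, hb]⟩
  have hb' (k) : b k ∈ φ.range := ⟨coord _ (e (i, k)), by rw [hφ]; simp [prodCoords, ha]⟩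
  obtain ⟨f, hf⟩ := exists_coords (T := Spec R') i
    (fun k => (Scheme.ΓSpecIso R').inv ⟨a k, ha' k⟩)
    (by rw [← map_one (Scheme.ΓSpecIso R').inv.hom]; congr 1; exact Subtype.ext ha)
  obtain ⟨g, hg⟩ := exists_coords (T := Spec R') j
    (fun k => (Scheme.ΓSpecIso R').inv ⟨b k, hb' k⟩)
    (by rw [← map_one (Scheme.ΓSpecIso R').inv.hom]; congr 1; exact Subtype.ext hb)
  let s : Q ⟶ Spec R' := Q.toSpecΓ ≫ Spec.map ι
  let t : Spec R' ⟶ Q := pullback.lift f g (terminal.hom_ext _ _)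
  -- The chart is a retract of the spectrum of the image of the coordinate ring.
  have hst : s ≫ t = 𝟙 Q := by
    apply pullback.hom_ext
    · rw [Category.assoc, pullback.lift_fst, Category.id_comp]
      refine chartHom_ext fun k => ?_
      rw [coords_comp, hf]
      exact toSpecΓ_map_appTop ι _
    · rw [Category.assoc, pullback.lift_snd, Category.id_comp]
      refine chartHom_ext fun k => ?_
      rw [coords_comp, hg]
      exact toSpecΓ_map_appTop ι _
  intro x
  have h1 : s.appTop (t.appTop x) = x := by
    have : t.appTop ≫ s.appTop = 𝟙 _ := by
      rw [← Scheme.Hom.comp_appTop, hst, Scheme.Hom.id_appTop]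
    exact congr($this x)
  obtain ⟨y, hy⟩ : ∃ y, (Scheme.ΓSpecIso R').inv y = t.appTop x :=
    ⟨(Scheme.ΓSpecIso R').hom (t.appTop x), congr($((Scheme.ΓSpecIso R').hom_inv_id) (t.appTop x))⟩
  obtain ⟨z, hz⟩ := y.2
  refine ⟨(Scheme.ΓSpecIso _).inv z, ?_⟩
  rw [← h1, ← hy]
  exact (toSpecΓ_map_appTop (CommRingCat.ofHom φ) z).trans
    (hz.trans (toSpecΓ_map_appTop ι y).symm)

lemma opensRange_prodChartι (i : Fin (N + 1)) (j : Fin (M + 1)) :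
    (prodChartι i j).opensRange =
      (pullback.fst (terminal.from (Proj (stdGrading N))) (terminal.from (Proj (stdGrading M)))) ⁻¹ᵁ
        Proj.basicOpen (stdGrading N) (MvPolynomial.X i) ⊓
      (pullback.snd (terminal.from (Proj (stdGrading N))) (terminal.from (Proj (stdGrading M)))) ⁻¹ᵁ
        Proj.basicOpen (stdGrading M) (MvPolynomial.X j) := by
  rw [← Proj.opensRange_awayι (stdGrading N) _ (X_mem_stdGrading i) one_pos,
    ← Proj.opensRange_awayι (stdGrading M) _ (X_mem_stdGrading j) one_pos]
  ext1
  exact Scheme.Pullback.range_map _ _ _ _ (chart i) (chart j) (𝟙 _) (Category.comp_id _)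
    (Category.comp_id _)

lemma segre_preimage {K : ℕ} (e : Fin (N + 1) × Fin (M + 1) ≃ Fin (K + 1)) (i : Fin (N + 1))
    (j : Fin (M + 1)) : segre e ⁻¹ᵁ (chart (e (i, j))).opensRange =
      (prodChartι i j).opensRange := by
  have h (i' : Fin (N + 1)) (j' : Fin (M + 1)) :
      prodChartι i' j' ⁻¹ᵁ (segre e ⁻¹ᵁ (chart (e (i, j))).opensRange) =
        prodChartι i' j' ⁻¹ᵁ (prodChartι i j).opensRange := by
    rw [opensRange_prodChartι, Proj.opensRange_awayι, Scheme.Hom.preimage_inf,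
      ← Scheme.Hom.comp_preimage, ← Scheme.Hom.comp_preimage, ← Scheme.Hom.comp_preimage,
      prodChartι_fst, prodChartι_snd, comp_chart, comp_chart, pt_preimage_basicOpen,
      pt_preimage_basicOpen, prodChartι_segre, segreChart, pt_preimage_basicOpen,
      ← Scheme.basicOpen_mul]
    simp [prodCoords]
  ext x
  obtain ⟨⟨i', j'⟩, y, rfl⟩ := (prodChartCover N M).exists_eq x
  exact (SetLike.ext_iff.1 (h i' j') y)

/-- Being a closed immersion is local on the target, and the preimage of each standard affine open
subscheme is a single product of charts. -/
lemma isClosedImmersion_segre {K : ℕ} (e : Fin (N + 1) × Fin (M + 1) ≃ Fin (K + 1)) :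
    IsClosedImmersion (segre e) := by
  refine IsZariskiLocalAtTarget.of_openCover (P := @IsClosedImmersion) (chartCover K) fun k => ?_
  obtain ⟨⟨i, j⟩, rfl⟩ := e.surjective k
  have h : IsPullback (prodChartι i j) (segreAffine e i j) (segre e) (chart (e (i, j))) :=
    (IsOpenImmersion.isPullback _ _ _ _ (by rw [segreAffine_chart, prodChartι_segre])
      (segre_preimage e i j)).flip
  have : IsClosedImmersion (segreAffine e i j) :=
    IsClosedImmersion.of_surjective_of_isAffine _ (surjective_segreAffine e i j)
  exact (MorphismProperty.cancel_left_of_respectsIso @IsClosedImmersion h.isoPullback.hom _).1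
    (by
      have : h.isoPullback.hom ≫ pullback.snd _ _ = segreAffine e i j := h.isoPullback_hom_snd
      erw [this]; assumption)

end

/-! ### Projective and quasi-projective morphisms -/

section

variable {N M : ℕ} {Y Z S S' T : Scheme.{0}}

/-- The morphism to projective space over a base, from the two components. -/
def ProjSpace.lift (f : T ⟶ S) (g : T ⟶ Proj (stdGrading N)) : T ⟶ ProjSpace N S :=
  pullback.lift f g (terminal.hom_ext _ _)

/-- The projection of projective space over a base to absolute projective space. -/
def ProjSpace.toProj (N : ℕ) (S : Scheme.{0}) : ProjSpace N S ⟶ Proj (stdGrading N) :=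
  pullback.snd _ _

@[simp]
lemma ProjSpace.lift_toBase (f : T ⟶ S) (g : T ⟶ Proj (stdGrading N)) :
    ProjSpace.lift f g ≫ ProjSpace.toBase N S = f :=
  pullback.lift_fst _ _ _

@[simp]
lemma ProjSpace.lift_toProj (f : T ⟶ S) (g : T ⟶ Proj (stdGrading N)) :
    ProjSpace.lift f g ≫ ProjSpace.toProj N S = g :=
  pullback.lift_snd _ _ _

@[simp]
lemma ProjSpace.lift_toBase_assoc (f : T ⟶ S) (g : T ⟶ Proj (stdGrading N)) {Z : Scheme.{0}}
    (h : S ⟶ Z) : ProjSpace.lift f g ≫ ProjSpace.toBase N S ≫ h = f ≫ h := by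
  rw [← Category.assoc, lift_toBase]

lemma ProjSpace.hom_ext {f g : T ⟶ ProjSpace N S}
    (h₁ : f ≫ ProjSpace.toBase N S = g ≫ ProjSpace.toBase N S)
    (h₂ : f ≫ ProjSpace.toProj N S = g ≫ ProjSpace.toProj N S) : f = g :=
  pullback.hom_ext h₁ h₂

/-- Functoriality of projective space in the base. -/
def ProjSpace.map (N : ℕ) (f : S' ⟶ S) : ProjSpace N S' ⟶ ProjSpace N S :=
  ProjSpace.lift (ProjSpace.toBase N S' ≫ f) (ProjSpace.toProj N S')

lemma ProjSpace.isPullback_map (N : ℕ) (f : S' ⟶ S) :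
    IsPullback (ProjSpace.map N f) (ProjSpace.toBase N S') (ProjSpace.toBase N S) f := by
  refine ⟨⟨by simp [map]⟩, ⟨PullbackCone.IsLimit.mk _
    (fun s => ProjSpace.lift s.snd (s.fst ≫ ProjSpace.toProj N S)) (fun s => ?_) (fun s => ?_)
    (fun s m h₁ h₂ => ?_)⟩⟩
  · apply ProjSpace.hom_ext
    · rw [map, Category.assoc, lift_toBase, ← Category.assoc, lift_toBase]
      exact s.condition.symm
    · rw [map, Category.assoc, lift_toProj, lift_toProj]
  · exact lift_toBase _ _
  · apply ProjSpace.hom_ext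
    · rw [lift_toBase, h₂]
    · rw [lift_toProj, ← h₁, map, Category.assoc, lift_toProj]

/-- The product of two projective spaces. -/
abbrev ProjProd (N M : ℕ) : Scheme.{0} :=
  pullback (terminal.from (Proj (stdGrading N))) (terminal.from (Proj (stdGrading M)))

/-- The two components of a morphism to an iterated projective space. -/
def ProjSpace.toProd (N M : ℕ) (S : Scheme.{0}) : ProjSpace M (ProjSpace N S) ⟶ ProjProd N M :=
  pullback.lift (ProjSpace.toBase _ _ ≫ ProjSpace.toProj _ _) (ProjSpace.toProj _ _)
    (terminal.hom_ext _ _)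

lemma ProjSpace.toProd_fst (N M : ℕ) (S : Scheme.{0}) : ProjSpace.toProd N M S ≫ pullback.fst _ _ =
    ProjSpace.toBase _ _ ≫ ProjSpace.toProj _ _ :=
  pullback.lift_fst _ _ _

lemma ProjSpace.toProd_snd (N M : ℕ) (S : Scheme.{0}) : ProjSpace.toProd N M S ≫ pullback.snd _ _ =
    ProjSpace.toProj _ _ :=
  pullback.lift_snd _ _ _

/-- The relative Segre morphism. -/
def relativeSegre {K : ℕ} (e : Fin (N + 1) × Fin (M + 1) ≃ Fin (K + 1)) (S : Scheme.{0}) :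
    ProjSpace M (ProjSpace N S) ⟶ ProjSpace K S :=
  ProjSpace.lift (ProjSpace.toBase _ _ ≫ ProjSpace.toBase _ _) (ProjSpace.toProd N M S ≫ segre e)

lemma isPullback_relativeSegre {K : ℕ} (e : Fin (N + 1) × Fin (M + 1) ≃ Fin (K + 1))
    (S : Scheme.{0}) : IsPullback (relativeSegre e S) (ProjSpace.toProd N M S)
      (ProjSpace.toProj K S) (segre e) := by
  have hl (s : PullbackCone (ProjSpace.toProj K S) (segre e)) :
      (ProjSpace.lift (ProjSpace.lift (s.fst ≫ ProjSpace.toBase _ _)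
      (s.snd ≫ pullback.fst _ _)) (s.snd ≫ pullback.snd _ _)) ≫ ProjSpace.toProd N M S =
        s.snd := by
    apply pullback.hom_ext
    · rw [Category.assoc, ProjSpace.toProd_fst]
      simp
    · rw [Category.assoc, ProjSpace.toProd_snd]
      simp
  refine ⟨⟨by simp [relativeSegre]⟩, ⟨PullbackCone.IsLimit.mk _
    (fun s => ProjSpace.lift (ProjSpace.lift (s.fst ≫ ProjSpace.toBase _ _)
      (s.snd ≫ pullback.fst _ _)) (s.snd ≫ pullback.snd _ _)) (fun s => ?_) (fun s => hl s)
    (fun s m h₁ h₂ => ?_)⟩⟩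
  · apply ProjSpace.hom_ext
    · simp [relativeSegre]
    · rw [s.condition, relativeSegre, Category.assoc, ProjSpace.lift_toProj, ← Category.assoc, hl]
  · apply ProjSpace.hom_ext
    · rw [ProjSpace.lift_toBase]
      apply ProjSpace.hom_ext
      · rw [ProjSpace.lift_toBase, ← h₁, relativeSegre, Category.assoc, Category.assoc,
          ProjSpace.lift_toBase]
      · rw [ProjSpace.lift_toProj, ← h₂, Category.assoc, Category.assoc, ProjSpace.toProd_fst]
    · rw [ProjSpace.lift_toProj, ← h₂, Category.assoc, ProjSpace.toProd_snd]

instance {K : ℕ} (e : Fin (N + 1) × Fin (M + 1) ≃ Fin (K + 1)) (S : Scheme.{0}) :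
    IsClosedImmersion (relativeSegre e S) :=
  MorphismProperty.of_isPullback (P := @IsClosedImmersion) (isPullback_relativeSegre e S).flip
    (isClosedImmersion_segre e)

/-- `f` factors as a morphism with the property `P` to a projective space over the target,
followed by the projection. -/
def EmbedsInProjSpace (P : MorphismProperty Scheme.{0}) (f : Y ⟶ S) : Prop :=
  ∃ (N : ℕ) (i : Y ⟶ ProjSpace N S), P i ∧ i ≫ ProjSpace.toBase N S = f

namespace EmbedsInProjSpace

variable {P : MorphismProperty Scheme.{0}}

lemma comp [P.IsStableUnderBaseChange] [P.IsStableUnderComposition]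
    (hP : @IsClosedImmersion ≤ P) {f : Y ⟶ S} {g : Z ⟶ Y} (hf : EmbedsInProjSpace P f)
    (hg : EmbedsInProjSpace P g) : EmbedsInProjSpace P (g ≫ f) := by
  obtain ⟨N, i, hi, rfl⟩ := hf
  obtain ⟨M, j, hj, rfl⟩ := hg
  have : Fintype.card (Fin (N + 1) × Fin (M + 1)) = (N * M + N + M) + 1 := by
    simp; ring
  let e := Fintype.equivFinOfCardEq this
  refine ⟨_, j ≫ ProjSpace.map M i ≫ relativeSegre e S, ?_, ?_⟩
  · exact P.comp_mem _ _ hj (P.comp_mem _ _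
      (P.of_isPullback (ProjSpace.isPullback_map M i).flip hi) (hP _ _ _
        (inferInstanceAs (IsClosedImmersion (relativeSegre e S)))))
  · simp [relativeSegre, ProjSpace.map]

lemma of_isPullback [P.IsStableUnderBaseChange] {f : Y ⟶ S} {f' : Z ⟶ S'} {g' : Z ⟶ Y}
    {g : S' ⟶ S} (h : IsPullback g' f' f g) (hf : EmbedsInProjSpace P f) :
    EmbedsInProjSpace P f' := by
  obtain ⟨N, i, hi, rfl⟩ := hf
  refine ⟨N, ProjSpace.lift f' (g' ≫ i ≫ ProjSpace.toProj N S), ?_, ProjSpace.lift_toBase _ _⟩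
  refine P.of_isPullback (IsPullback.of_right (h₁₁ := ProjSpace.lift f' (g' ≫ i ≫
    ProjSpace.toProj N S))
    (h₁₂ := ProjSpace.toBase N S') (h₂₁ := i) (h₂₂ := ProjSpace.toBase N S) (v₁₁ := g') ?_ ?_
    (ProjSpace.isPullback_map N g).flip).flip hi
  · rw [ProjSpace.lift_toBase]
    exact h.flip
  · apply ProjSpace.hom_ext
    · simp [ProjSpace.map, ← h.w]
    · simp [ProjSpace.map]

end EmbedsInProjSpace

instance : MorphismProperty.IsStableUnderComposition @IsClosedImmersion where
  comp_mem _ _ _ _ := IsClosedImmersion.comp _ _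

instance : MorphismProperty.IsStableUnderComposition @IsImmersion where
  comp_mem _ _ _ _ := inferInstance

lemma IsProjective.comp {f : Y ⟶ S} {g : Z ⟶ Y} (hf : IsProjective f) (hg : IsProjective g) :
    IsProjective (g ≫ f) :=
  EmbedsInProjSpace.comp (P := @IsClosedImmersion) le_rfl hf hg

lemma IsProjective.of_isPullback {f : Y ⟶ S} {f' : Z ⟶ S'} {g' : Z ⟶ Y}
    {g : S' ⟶ S} (h : IsPullback g' f' f g) (hf : IsProjective f) : IsProjective f' :=
  EmbedsInProjSpace.of_isPullback (P := @IsClosedImmersion) h hf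

lemma IsQuasiProjective.comp_isProjective {q : Y ⟶ SpecC} {g : Z ⟶ Y} (hq : IsQuasiProjective q)
    (hg : IsProjective g) : IsQuasiProjective (g ≫ q) := by
  have hg' : EmbedsInProjSpace @IsImmersion g := by
    obtain ⟨N, i, hi, rfl⟩ := hg
    exact ⟨N, i, inferInstance, rfl⟩
  exact EmbedsInProjSpace.comp (P := @IsImmersion) (fun _ _ f (hf : IsClosedImmersion f) =>
    inferInstance) hq hg'

lemma IsProjective.isQuasiProjective {q : Y ⟶ SpecC} (hq : IsProjective q) :
    IsQuasiProjective q := by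
  obtain ⟨N, i, hi, rfl⟩ := hq
  exact ⟨N, i, inferInstance, rfl⟩

lemma isProjective_toBase (N : ℕ) (S : Scheme.{0}) : IsProjective (ProjSpace.toBase N S) :=
  ⟨N, 𝟙 _, inferInstance, Category.id_comp _⟩

lemma isProjective_id (S : Scheme.{0}) : IsProjective (𝟙 S) := by
  refine ⟨0, ProjSpace.lift (𝟙 S) (pt (fun _ => 1) 0 isUnit_one), ?_, ProjSpace.lift_toBase _ _⟩
  have : IsSeparated (ProjSpace.toBase 0 S) := by
    dsimp only [ProjSpace.toBase, ProjSpace]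
    infer_instance
  have : IsClosedImmersion (ProjSpace.lift (𝟙 S) (pt (fun _ => 1) 0 isUnit_one) ≫
      ProjSpace.toBase 0 S) := by
    rw [ProjSpace.lift_toBase]; infer_instance
  exact IsClosedImmersion.of_comp _ (ProjSpace.toBase 0 S)

end

/-! ### Smoothness of projective space and coordinate hyperplanes -/

section

open HomogeneousLocalization

variable {N : ℕ} {Y S T W : Scheme.{0}}

instance isStandardSmoothOfRelativeDimension_mvPolynomial (ι : Type) [Finite ι] (R : Type*)
    [CommRing R] : Algebra.IsStandardSmoothOfRelativeDimension (Nat.card ι) R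
      (MvPolynomial ι R) := by
  have hb : (MvPolynomial.aeval (MvPolynomial.X : ι → MvPolynomial ι R)) = AlgHom.id R _ :=
    MvPolynomial.aeval_X_left
  let P : Algebra.PreSubmersivePresentation R (MvPolynomial ι R) ι PEmpty.{1} :=
    { toGenerators := .ofSurjective MvPolynomial.X (by rw [hb]; exact Function.surjective_id)
      relation := PEmpty.elim
      span_range_relation_eq_ker := by
        rw [Set.range_eq_empty, Ideal.span_empty, Algebra.Generators.ker_eq_ker_aeval_val]
        refine (Eq.symm ?_)
        rw [← RingHom.injective_iff_ker_eq_bot]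
        change Function.Injective (MvPolynomial.aeval (MvPolynomial.X : ι → MvPolynomial ι R))
        rw [hb]
        exact Function.injective_id
      map := PEmpty.elim
      map_inj := fun x => x.elim }
  let P' : Algebra.SubmersivePresentation R (MvPolynomial ι R) ι PEmpty.{1} :=
    { P with
      jacobian_isUnit := by
        rw [Algebra.PreSubmersivePresentation.jacobian_eq_jacobiMatrix_det, Matrix.det_isEmpty,
          map_one]
        exact isUnit_one }
  exact P'.isStandardSmoothOfRelativeDimension (by simp [Algebra.Presentation.dimension])

/-- A standard affine open subscheme of projective space is an affine space. -/
def awayEquiv (i : Fin (N + 1)) :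
    MvPolynomial {k : Fin (N + 1) // k ≠ i} ℤ ≃+* Away (stdGrading N) (MvPolynomial.X i) :=
  let a : Fin (N + 1) → MvPolynomial {k : Fin (N + 1) // k ≠ i} ℤ := fun k =>
    if h : k = i then 1 else MvPolynomial.X ⟨k, h⟩
  have ha : a i = 1 := dif_pos rfl
  have hu : IsUnit (coordEval a (MvPolynomial.X i)) := by
    rw [coordEval_X, ha]; exact isUnit_one
  have hc (k) : awayEval a hu (coord i k) = a k := by
    have := awayEval_coord a k hu
    rwa [ha, mul_one] at this
  RingEquiv.ofRingHom (MvPolynomial.eval₂Hom (Int.castRingHom _) fun k => coord i k.1)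
    (awayEval a hu)
    (away_hom_ext fun k => by
      rw [RingHom.comp_apply, hc]
      by_cases h : k = i
      · subst h
        rw [ha, map_one, coord_self, map_one]
      · simp [a, h])
    (MvPolynomial.ringHom_ext (by simp) fun k => by
      rw [RingHom.comp_apply, MvPolynomial.eval₂Hom_X', hc]
      simp [a, k.2])

lemma isStandardSmooth_away (i : Fin (N + 1)) : RingHom.IsStandardSmoothOfRelativeDimension N
    (Int.castRingHom (Away (stdGrading N) (MvPolynomial.X i))) := by
  have h1 : RingHom.IsStandardSmoothOfRelativeDimension N
      (algebraMap ℤ (MvPolynomial {k : Fin (N + 1) // k ≠ i} ℤ)) := by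
    rw [RingHom.isStandardSmoothOfRelativeDimension_algebraMap]
    have := isStandardSmoothOfRelativeDimension_mvPolynomial {k : Fin (N + 1) // k ≠ i} ℤ
    simpa using this
  have := (RingHom.IsStandardSmoothOfRelativeDimension.equiv (awayEquiv i)).comp h1
  rw [zero_add] at this
  convert this
  exact RingHom.ext_int _ _

lemma isZariskiLocalAtSource_smooth (n : ℕ) :
    IsZariskiLocalAtSource (@SmoothOfRelativeDimension.{0} n) :=
  HasRingHomProperty.instIsZariskiLocalAtSource

lemma smooth_iff_of_openCover (n : ℕ) {f : T ⟶ S} (𝒰 : T.OpenCover) :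
    SmoothOfRelativeDimension n f ↔ ∀ i, SmoothOfRelativeDimension n (𝒰.f i ≫ f) :=
  haveI := isZariskiLocalAtSource_smooth n
  IsZariskiLocalAtSource.iff_of_openCover (P := @SmoothOfRelativeDimension n) 𝒰

lemma smooth_of_isPullback (n : ℕ) {f : Y ⟶ S} {f' : W ⟶ T} {g' : W ⟶ Y}
    {g : T ⟶ S} (h : IsPullback g' f' f g) (hf : SmoothOfRelativeDimension n f) :
    SmoothOfRelativeDimension n f' :=
  (smoothOfRelativeDimension_isStableUnderBaseChange n).of_isPullback h hf

instance smoothOfRelativeDimension_proj : SmoothOfRelativeDimension N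
    (terminal.from (Proj (stdGrading N))) := by
  rw [smooth_iff_of_openCover N (chartCover N)]
  intro i
  let e := specZIsTerminal.uniqueUpToIso terminalIsTerminal
  change SmoothOfRelativeDimension N (chart (N := N) i ≫ terminal.from _)
  have h : SmoothOfRelativeDimension N (Spec.map (CommRingCat.ofHom
      (Int.castRingHom (Away (stdGrading N) (MvPolynomial.X i : MvPolynomial (Fin (N + 1)) ℤ))))) :=
    (HasRingHomProperty.Spec_iff (P := @SmoothOfRelativeDimension N)).2
      (RingHom.locally_of RingHom.isStandardSmoothOfRelativeDimension_respectsIso _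
        (isStandardSmooth_away (N := N) i))
  exact smooth_of_isPullback N
    (IsPullback.of_horiz_isIso (fst := 𝟙 _) (snd := chart (N := N) i ≫ terminal.from _)
      (f := Spec.map _) (g := e.inv) ⟨specZIsTerminal.hom_ext _ _⟩) h

instance smoothOfRelativeDimension_toBase : SmoothOfRelativeDimension N (ProjSpace.toBase N S) :=
  smooth_of_isPullback N (IsPullback.of_hasPullback _ _).flip inferInstance

/-- The open subscheme where the `i`-th coordinate does not vanish. -/
abbrev chartOpen (h : W ⟶ Proj (stdGrading N)) (i : Fin (N + 1)) : W.Opens :=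
  h ⁻¹ᵁ Proj.basicOpen (stdGrading N) (MvPolynomial.X i)

lemma exists_lift_chart (h : T ⟶ Proj (stdGrading N)) (i : Fin (N + 1))
    (hi : chartOpen h i = ⊤) : ∃ u, u ≫ chart i = h := by
  refine ⟨IsOpenImmersion.lift (chart i) h ?_, IsOpenImmersion.lift_fac _ _ _⟩
  rintro _ ⟨x, rfl⟩
  have : x ∈ chartOpen h i := hi ▸ trivial
  rw [← SetLike.mem_coe] at this
  have h2 := Proj.opensRange_awayι (stdGrading N) _ (X_mem_stdGrading i) one_pos
  change h x ∈ ((chart i).opensRange : Set _)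
  rw [h2]
  exact this

lemma chartOpen_comp (f : T ⟶ W) (h : W ⟶ Proj (stdGrading N)) (i : Fin (N + 1)) :
    chartOpen (f ≫ h) i = f ⁻¹ᵁ chartOpen h i := rfl

/-- The morphism to an affine chart of projective space. -/
def toChart (h : W ⟶ Proj (stdGrading N)) (i : Fin (N + 1)) : (chartOpen h i : Scheme.{0}) ⟶
    Spec (CommRingCat.of (Away (stdGrading N) (MvPolynomial.X i))) :=
  (exists_lift_chart ((chartOpen h i).ι ≫ h) i (by
    rw [chartOpen_comp]; simp)).choose

lemma toChart_chart (h : W ⟶ Proj (stdGrading N)) (i : Fin (N + 1)) :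
    toChart h i ≫ chart i = (chartOpen h i).ι ≫ h :=
  Exists.choose_spec (p := fun u => u ≫ chart i = (chartOpen h i).ι ≫ h) _

lemma coords_mul (i : Fin (N + 1)) (u : T ⟶ Spec (CommRingCat.of (Away (stdGrading N)
    (MvPolynomial.X i)))) (a : Fin (N + 1) → Γ(T, ⊤)) (j) (hj : IsUnit (a j))
    (h : u ≫ chart i = pt a j hj) (k) : coords i u k * a i = a k := by
  rw [comp_chart] at h
  obtain ⟨c, hc, hc'⟩ := exists_smul_of_pt_eq _ _ _ _ _ _ h
  rw [hc' i, hc' k, coords_self]; ring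

lemma iSup_chartOpen (h : W ⟶ Proj (stdGrading N)) : ⨆ i, chartOpen h i = ⊤ := by
  refine top_le_iff.1 fun x _ => ?_
  obtain ⟨i, y, hy⟩ := (chartCover N).exists_eq (h x)
  refine TopologicalSpace.Opens.mem_iSup.2 ⟨i, ?_⟩
  have h2 := Proj.opensRange_awayι (stdGrading N) _ (X_mem_stdGrading i) one_pos
  change h x ∈ Proj.basicOpen (stdGrading N) (MvPolynomial.X i)
  rw [← h2]
  exact ⟨y, hy⟩

/-- The zero divisor of `x₀` for a morphism to the projective line with coordinates `x₀, x₁`. -/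
def zeroDivisor (h : W ⟶ Proj (stdGrading 1)) : TwistDatum W where
  U₀ := chartOpen h 1
  U₁ := chartOpen h 0
  t := coords 1 (toChart h 1) 0
  isUnit := by
    have h2 : (chartOpen h 1).ι ⁻¹ᵁ chartOpen h 0 =
        (chartOpen h 1 : Scheme.{0}).basicOpen (coords 1 (toChart h 1) 0) := by
      rw [← chartOpen_comp, ← toChart_chart, comp_chart]
      exact pt_preimage_basicOpen _ _ _ _
    have h3 (V : (chartOpen h 1 : Scheme.{0}).Opens) (hV : V ≤ ⊤)
        (hV' : V = (chartOpen h 1 : Scheme.{0}).basicOpen (coords 1 (toChart h 1) 0)) :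
        IsUnit ((chartOpen h 1 : Scheme.{0}).presheaf.map (homOfLE hV).op
          (coords 1 (toChart h 1) 0)) := by
      subst hV'
      exact (chartOpen h 1 : Scheme.{0}).toRingedSpace.isUnit_res_basicOpen
        (coords 1 (toChart h 1) 0)
    exact h3 _ _ h2

lemma zeroDivisor_sup (h : W ⟶ Proj (stdGrading 1)) :
    (zeroDivisor h).U₀ ⊔ (zeroDivisor h).U₁ = ⊤ := by
  rw [← iSup_chartOpen h]
  refine le_antisymm (sup_le (le_iSup (chartOpen h) 1) (le_iSup (chartOpen h) 0)) ?_
  refine iSup_le fun i => ?_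
  fin_cases i
  · exact le_sup_right
  · exact le_sup_left

end

/-! ### The universal property of the cobordism groups -/

section

variable {D D' : BundleKind} {X : Scheme.{0}} {p : X ⟶ SpecC} {n : ℕ}

/-- The class of a cycle in `ω_n(X)`. -/
def Cycle.class (c : Cycle D p n) : CobordismGroup D p n :=
  QuotientAddGroup.mk c.clsPlus

lemma Cycle.cls_eq_of_rel {x y : Multiset (Cycle D p n)} (h : monoidRel D p n x y) :
    (addConGen (monoidRel D p n)).mk' x = (addConGen (monoidRel D p n)).mk' y :=
  (AddCon.eq _).2 (AddConGen.Rel.of _ _ h)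

lemma Cycle.IsIsomorphic.clsPlus_eq {a b : Cycle D p n} (h : a.IsIsomorphic b) :
    a.clsPlus = b.clsPlus :=
  congrArg Algebra.GrothendieckAddGroup.of (Cycle.cls_eq_of_rel (.iso a b h))

lemma Cycle.IsIsomorphic.class_eq {a b : Cycle D p n} (h : a.IsIsomorphic b) :
    a.class = b.class :=
  congrArg QuotientAddGroup.mk h.clsPlus_eq

lemma Cycle.IsDisjointUnion.clsPlus_eq {a b c : Cycle D p n} (h : c.IsDisjointUnion a b) :
    c.clsPlus = a.clsPlus + b.clsPlus := by
  rw [Cycle.clsPlus, Cycle.clsPlus, Cycle.clsPlus, ← map_add]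
  refine congrArg Algebra.GrothendieckAddGroup.of ((Cycle.cls_eq_of_rel (.add c a b h)).trans ?_)
  exact map_add (addConGen (monoidRel D p n)).mk' {a} {b}

lemma Cycle.IsDisjointUnion.class_eq {a b c : Cycle D p n} (h : c.IsDisjointUnion a b) :
    c.class = a.class + b.class :=
  congrArg QuotientAddGroup.mk h.clsPlus_eq

lemma Cycle.clsPlus_of_isEmpty (c : Cycle D p n) (h : IsEmpty c.Y) : c.clsPlus = 0 :=
  (congrArg Algebra.GrothendieckAddGroup.of (Cycle.cls_eq_of_rel (.zero c h))).trans (map_zero _)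

lemma Cycle.class_of_isEmpty (c : Cycle D p n) (h : IsEmpty c.Y) : c.class = 0 :=
  congrArg QuotientAddGroup.mk (c.clsPlus_of_isEmpty h)

lemma IsDoublePointRelation.class_eq {Yζ A B P : Cycle D p n} (h : IsDoublePointRelation Yζ A B P) :
    Yζ.class - A.class - B.class + P.class = 0 :=
  (QuotientAddGroup.eq_zero_iff _).2 (AddSubgroup.subset_closure ⟨Yζ, A, B, P, h, rfl⟩)

lemma CycleMonoid.hom_ext {A : Type*} [AddCommMonoid A] {f g : CycleMonoid D p n →+ A}
    (h : ∀ c : Cycle D p n, f c.cls = g c.cls) : f = g :=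
  AddCon.hom_ext (Multiset.addHom_ext h)

lemma CycleGroup.hom_ext {A : Type*} [AddCommGroup A] {f g : CycleGroup D p n →+ A}
    (h : ∀ c : Cycle D p n, f c.clsPlus = g c.clsPlus) : f = g := by
  have h1 : f.comp Algebra.GrothendieckAddGroup.of = g.comp Algebra.GrothendieckAddGroup.of :=
    CycleMonoid.hom_ext h
  exact Algebra.GrothendieckAddGroup.lift.symm.injective h1

lemma CobordismGroup.hom_ext {A : Type*} [AddCommGroup A] {f g : CobordismGroup D p n →+ A}
    (h : ∀ c : Cycle D p n, f c.class = g c.class) : f = g :=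
  QuotientAddGroup.addMonoidHom_ext _ (CycleGroup.hom_ext h)

section Lift

variable {A : Type*} [AddCommGroup A] (φ : Cycle D p n → A)
  (iso : ∀ a b : Cycle D p n, a.IsIsomorphic b → φ a = φ b)
  (add : ∀ c a b : Cycle D p n, c.IsDisjointUnion a b → φ c = φ a + φ b)
  (zero : ∀ c : Cycle D p n, IsEmpty c.Y → φ c = 0)

include iso add zero in
lemma addConGen_monoidRel_le_ker : addConGen (monoidRel D p n) ≤ AddCon.ker
    ((Multiset.sumAddMonoidHom).comp (Multiset.mapAddMonoidHom φ)) := by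
  refine AddCon.addConGen_le.2 fun x y h => ?_
  rw [AddCon.ker_rel]
  cases h with
  | iso a b h => simpa using iso a b h
  | add c a b h => simpa using add c a b h
  | zero c h => simpa using zero c h

/-- The homomorphism on `ℳ_n(X)⁺` given by an additive invariant of cycles. -/
def CycleGroup.lift : CycleGroup D p n →+ A :=
  Algebra.GrothendieckAddGroup.lift (AddCon.lift (addConGen (monoidRel D p n)) _
    (addConGen_monoidRel_le_ker φ iso add zero))

lemma CycleGroup.lift_clsPlus (c : Cycle D p n) :
    CycleGroup.lift φ iso add zero c.clsPlus = φ c := by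
  have h := Algebra.GrothendieckAddGroup.lift.symm_apply_apply
    (AddCon.lift (addConGen (monoidRel D p n)) _ (addConGen_monoidRel_le_ker φ iso add zero))
  refine (DFunLike.congr_fun h c.cls).trans ?_
  change Multiset.sum (Multiset.map φ {c}) = φ c
  simp

variable (rel : ∀ Yζ A B P : Cycle D p n, IsDoublePointRelation Yζ A B P →
      φ Yζ - φ A - φ B + φ P = 0)

include rel in
lemma relationSubgroup_le_ker_lift :
    relationSubgroup D p n ≤ (CycleGroup.lift φ iso add zero).ker := by
  rw [relationSubgroup, AddSubgroup.closure_le]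
  rintro _ ⟨Yζ, A, B, P, h, rfl⟩
  rw [SetLike.mem_coe, AddMonoidHom.mem_ker, map_add, map_sub, map_sub, CycleGroup.lift_clsPlus,
    CycleGroup.lift_clsPlus, CycleGroup.lift_clsPlus, CycleGroup.lift_clsPlus]
  exact rel _ _ _ _ h

/-- The homomorphism on `ω_n(X)` given by an additive invariant of cycles which satisfies the double
point relations. -/
def CobordismGroup.lift : CobordismGroup D p n →+ A :=
  QuotientAddGroup.lift _ (CycleGroup.lift φ iso add zero)
    (relationSubgroup_le_ker_lift φ iso add zero rel)

lemma CobordismGroup.lift_class (c : Cycle D p n) :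
    CobordismGroup.lift φ iso add zero rel c.class = φ c :=
  CycleGroup.lift_clsPlus φ iso add zero c

end Lift

end

/-! ### Deformation of a filtered bundle over the projective line -/

section

variable {N : ℕ} {Y S T W : Scheme.{0}}

/-- A morphism to `W` whose image in projective space has homogeneous coordinates `a`, the `i`-th of
which is invertible, factors through the complement of the `i`-th coordinate hyperplane. -/
lemma exists_lift_chartOpen (h : W ⟶ Proj (stdGrading N)) (s : Y ⟶ W) (a : Fin (N + 1) → Γ(Y, ⊤))
    (i : Fin (N + 1)) (hi : IsUnit (a i)) (hs : s ≫ h = pt a i hi) :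
    ∃ l : Y ⟶ chartOpen h i, l ≫ (chartOpen h i).ι = s ∧
      ∀ k, l.appTop (coords i (toChart h i) k) * a i = a k := by
  have hr : Set.range s ⊆ Set.range (chartOpen h i).ι := by
    rintro _ ⟨y, rfl⟩
    rw [Scheme.Opens.range_ι]
    have h1 : s ⁻¹ᵁ chartOpen h i = ⊤ := by
      rw [← chartOpen_comp, hs]
      exact (pt_preimage_basicOpen a i i hi).trans (Scheme.basicOpen_of_isUnit _ hi)
    have h2 : y ∈ s ⁻¹ᵁ chartOpen h i := by rw [h1]; trivial
    exact h2
  have hl : IsOpenImmersion.lift (chartOpen h i).ι s hr ≫ (chartOpen h i).ι = s :=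
    IsOpenImmersion.lift_fac _ _ _
  refine ⟨_, hl, fun k => ?_⟩
  rw [← coords_comp]
  refine coords_mul i _ a i hi ?_ k
  rw [Category.assoc, toChart_chart, ← Category.assoc, hl, hs]

lemma isUnit_zero_one : IsUnit ((![0, 1] : Fin (1 + 1) → Γ(T, ⊤)) 1) := isUnit_one

lemma isUnit_one_zero : IsUnit ((![1, 0] : Fin (1 + 1) → Γ(T, ⊤)) 0) := isUnit_one

lemma zero_toProj : P1.zero ≫ ProjSpace.toProj 1 SpecC = pt ![0, 1] 1 isUnit_zero_one := by
  have h0 : P1.zero ≫ ProjSpace.toProj 1 SpecC =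
      Proj.fromOfGlobalSections (stdGrading 1) evalZero map_evalZero_irrelevant :=
    pullback.lift_snd _ _ _
  rw [h0]
  have h1 (i : Fin 2) : chartOpen (Proj.fromOfGlobalSections (stdGrading 1) evalZero
      map_evalZero_irrelevant) i = SpecC.basicOpen (evalZero (MvPolynomial.X i)) :=
    Proj.fromOfGlobalSections_preimage_basicOpen _ _ _ one_pos (X_mem_stdGrading i)
  obtain ⟨u, hu⟩ := exists_lift_chart (Proj.fromOfGlobalSections (stdGrading 1) evalZero
    map_evalZero_irrelevant) 1 (by
      rw [h1]
      exact Scheme.basicOpen_of_isUnit _ (by simp [evalZero]))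
  have h2 : SpecC.basicOpen (coords 1 u 0) = ⊥ := by
    have := pt_preimage_basicOpen (coords 1 u) 1 0 (by rw [coords_self]; exact isUnit_one)
    rw [← this, ← comp_chart, hu]
    exact (h1 0).trans (by simp [evalZero])
  rw [basicOpen_eq_bot_iff] at h2
  rw [← hu, comp_chart]
  congr 1
  ext k
  fin_cases k
  · exact h2
  · exact coords_self 1 u

lemma zero_toSpecC : P1.zero ≫ P1.toSpecC = 𝟙 SpecC :=
  pullback.lift_fst _ _ _

/-- The point `∞ = [1 : 0]` of the projective line. -/
def P1.infty : SpecC ⟶ P1 :=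
  ProjSpace.lift (𝟙 SpecC) (pt ![1, 0] 0 isUnit_one_zero)

lemma infty_toSpecC : P1.infty ≫ P1.toSpecC = 𝟙 SpecC :=
  ProjSpace.lift_toBase _ _

/-- The product `Y × ℙ¹`. -/
abbrev timesP1 (q : Y ⟶ SpecC) : Scheme.{0} := pullback q P1.toSpecC

/-- The section of `Y × ℙ¹` over `Y` given by a point of `ℙ¹`. -/
def constSection (q : Y ⟶ SpecC) (ζ : SpecC ⟶ P1) (hζ : ζ ≫ P1.toSpecC = 𝟙 SpecC) :
    Y ⟶ timesP1 q :=
  pullback.lift (𝟙 Y) (q ≫ ζ) (by rw [Category.assoc, hζ, Category.comp_id, Category.id_comp])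

section
variable (q : Y ⟶ SpecC) (ζ : SpecC ⟶ P1) (hζ : ζ ≫ P1.toSpecC = 𝟙 SpecC)

lemma constSection_fst : constSection q ζ hζ ≫ pullback.fst _ _ = 𝟙 Y := pullback.lift_fst _ _ _

lemma constSection_snd : constSection q ζ hζ ≫ pullback.snd _ _ = q ≫ ζ := pullback.lift_snd _ _ _

lemma isPullback_constSection :
    IsPullback (constSection q ζ hζ) q (pullback.snd q P1.toSpecC) ζ := by
  refine IsPullback.of_right (h₁₂ := pullback.fst q P1.toSpecC) (h₂₂ := P1.toSpecC) (v₁₃ := q) ?_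
    (constSection_snd q ζ hζ) (IsPullback.of_hasPullback q P1.toSpecC)
  rw [constSection_fst, hζ]
  exact IsPullback.of_horiz_isIso ⟨by simp⟩

lemma isClosedImmersion_constSection : IsClosedImmersion (constSection q ζ hζ) := by
  have : IsSeparated P1.toSpecC := by
    exact inferInstanceAs (IsSeparated (pullback.fst (terminal.from SpecC)
      (terminal.from (Proj (stdGrading 1)))))
  have : IsClosedImmersion (constSection q ζ hζ ≫ pullback.fst q P1.toSpecC) := by
    rw [constSection_fst]; infer_instance
  exact IsClosedImmersion.of_comp _ (pullback.fst q P1.toSpecC)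

end

lemma constSection_zero_toProj (q : Y ⟶ SpecC) :
    constSection q P1.zero zero_toSpecC ≫ pullback.snd _ _ ≫ ProjSpace.toProj 1 SpecC =
      pt ![0, 1] 1 isUnit_zero_one := by
  rw [← Category.assoc, constSection_snd, Category.assoc, zero_toProj, comp_pt]
  congr 1
  ext k
  fin_cases k <;> simp

lemma constSection_infty_toProj (q : Y ⟶ SpecC) :
    constSection q P1.infty infty_toSpecC ≫ pullback.snd _ _ ≫ ProjSpace.toProj 1 SpecC =
      pt ![1, 0] 0 isUnit_one_zero := by
  rw [← Category.assoc, constSection_snd, Category.assoc, P1.infty, ProjSpace.lift_toProj, comp_pt]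
  congr 1
  ext k
  fin_cases k <;> simp

/-- Every filtered bundle `S` on `Y` degenerates to its modification along zero: the modification of
the pullback of `S` to `Y × ℙ¹` along the divisor `Y × 0` restricts to `S` over `∞`, and to the
modification of `S` along zero over `0`. -/
lemma exists_deformation {s : ℕ} {r : Fin s → ℕ} (q : Y ⟶ SpecC)
    (S : Fin s ⥤ Y.Modules) (hS : IsFiltered r S) (j : Fin s) :
    ∃ F : Fin s ⥤ (timesP1 q).Modules, IsFiltered r F ∧
      Nonempty (S ≅ F ⋙ Scheme.Modules.pullback (constSection q P1.infty infty_toSpecC)) ∧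
      Nonempty (modification (globalSMul (0 : Γ(Y, ⊤))) j S ≅
        F ⋙ Scheme.Modules.pullback (constSection q P1.zero zero_toSpecC)) := by
  let h := pullback.snd q P1.toSpecC ≫ ProjSpace.toProj 1 SpecC
  let Δ := zeroDivisor h
  let G := S ⋙ Scheme.Modules.pullback (pullback.fst q P1.toSpecC)
  have e (σ : Y ⟶ timesP1 q) (hσ : σ ≫ pullback.fst _ _ = 𝟙 Y) :
      S ≅ G ⋙ Scheme.Modules.pullback σ :=
    Functor.isoWhiskerLeft S ((Scheme.Modules.pullbackId Y).symm ≪≫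
      Scheme.Modules.pullbackCongr hσ.symm ≪≫ (Scheme.Modules.pullbackComp σ _).symm)
  obtain ⟨l₀, hl₀, hl₀'⟩ := exists_lift_chartOpen h (constSection q P1.zero zero_toSpecC) _ _ _
    (constSection_zero_toProj q)
  obtain ⟨l₁, hl₁, -⟩ := exists_lift_chartOpen h (constSection q P1.infty infty_toSpecC) _ _ _
    (constSection_infty_toProj q)
  have key (l : Y ⟶ Δ.U₀) (hl : l ≫ Δ.U₀.ι = constSection q P1.zero zero_toSpecC) (t : Γ(Y, ⊤))
      (ht : l.appTop Δ.t = t) : Nonempty (modification (globalSMul t) j S ≅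
        modification Δ.twistSection j G ⋙
          Scheme.Modules.pullback (constSection q P1.zero zero_toSpecC)) := by
    subst ht
    exact ⟨Δ.modificationPullback₀ j G l _ hl S (e _ (constSection_fst _ _ _))⟩
  exact ⟨modification Δ.twistSection j G, Δ.isFiltered_modification (zeroDivisor_sup h) j
    (hS.pullback _), ⟨e _ (constSection_fst _ _ _) ≪≫ Δ.modificationPullback₁ j G l₁ _ hl₁⟩,
    key l₀ hl₀ 0 ((mul_one _).symm.trans (hl₀' 0))⟩

end

/-! ### Homotopy invariance -/

section

variable {D : BundleKind} {X : Scheme.{0}} {p : X ⟶ SpecC} {n : ℕ}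

lemma isZero_modules_of_isEmpty {Y : Scheme.{0}} [IsEmpty Y] (M : Y.Modules) : IsZero M := by
  rw [IsZero.iff_id_eq_zero]
  refine Scheme.Modules.hom_ext _ _ fun U => ?_
  ext s
  have h : s = 0 := by
    rw [← one_smul Γ(Y, U) s, Subsingleton.elim (1 : Γ(Y, U)) 0, zero_smul]
  rw [h, map_zero, map_zero]

lemma isLocallyFreeOfRank_of_isEmpty {Y : Scheme.{0}} [IsEmpty Y] (r : ℕ) (M : Y.Modules) :
    IsLocallyFreeOfRank r M :=
  fun y => isEmptyElim y

lemma isNormalProjectiveBundle_of_isEmpty {P D A : Scheme.{0}} [IsEmpty P] [IsEmpty D] (u : P ⟶ D)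
    (i : D ⟶ A) : IsNormalProjectiveBundle u i := by
  refine ⟨structureModule P, 0, isLocallyFreeOfRank_of_isEmpty _ _,
    ⟨fun _ _ _ => (isZero_modules_of_isEmpty _).eq_of_src _ _⟩, fun T v L' q' _ _ => ?_⟩
  have : IsEmpty T := v.base.hom.1.isEmpty
  exact ⟨isInitialOfIsEmpty.to P, ⟨isInitialOfIsEmpty.hom_ext _ _,
    (isZero_modules_of_isEmpty _).iso (isZero_modules_of_isEmpty _),
    (isZero_modules_of_isEmpty _).eq_of_src _ _⟩, fun _ _ => isInitialOfIsEmpty.hom_ext _ _⟩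

lemma smoothOfRelativeDimension_of_isEmpty {Y S : Scheme.{0}} [IsEmpty Y] (f : Y ⟶ S) (n : ℕ) :
    SmoothOfRelativeDimension n f :=
  ⟨fun y => isEmptyElim y⟩

lemma isProjective_of_isEmpty {Y S : Scheme.{0}} [IsEmpty Y] (f : Y ⟶ S) : IsProjective f :=
  ⟨0, isInitialOfIsEmpty.to _, inferInstance, isInitialOfIsEmpty.hom_ext _ _⟩

/-- The empty cycle. -/
def emptyCycle (p : X ⟶ SpecC) (n : ℕ) (E : D.Obj ∅) : Cycle D p n where
  Y := ∅
  f := Scheme.emptyTo X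
  smooth := smoothOfRelativeDimension_of_isEmpty _ n
  quasiProjective := (isProjective_of_isEmpty _).isQuasiProjective
  projective := isProjective_of_isEmpty _
  E := E

/-- Replacement of the bundle data of a cycle. -/
def Cycle.withData (c : Cycle D p n) (E : D.Obj c.Y) : Cycle D p n where
  __ := c
  E := E

/-- Homotopy invariance: the cobordism class does not change under degenerations of the bundle data
parametrized by the projective line. The projection `Y × ℙ¹ ⟶ ℙ¹` is a double point degeneration
with `A = Y`, and with `B` and the intersection `A ∩ B` empty. -/
lemma class_withData_eq (hD : D.IsGeometric) (c : Cycle D p n) (F : D.Obj (timesP1 (c.f ≫ p)))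
    (E₀ E₁ : D.Obj c.Y)
    (h₀ : D.IsPullback (constSection (c.f ≫ p) P1.zero zero_toSpecC) E₀ F)
    (h₁ : D.IsPullback (constSection (c.f ≫ p) P1.infty infty_toSpecC) E₁ F) :
    (c.withData E₁).class = (c.withData E₀).class := by
  let q := c.f ≫ p
  let W := timesP1 q
  let s₀ := constSection q P1.zero zero_toSpecC
  have := isClosedImmersion_constSection q P1.zero zero_toSpecC
  obtain ⟨E, hE⟩ := hD.exists_pullback (Scheme.emptyTo W) F
  let B : Cycle D p n := emptyCycle p n E
  let g : W ⟶ pullback p P1.toSpecC := pullback.map _ _ _ _ c.f (𝟙 _) (𝟙 _) (Category.comp_id _)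
    (by simp)
  have hg₁ : g ≫ pullback.fst _ _ = pullback.fst _ _ ≫ c.f := pullback.lift_fst _ _ _
  have hg₂ : g ≫ pullback.snd _ _ = pullback.snd _ _ := (pullback.lift_snd _ _ _).trans
    (Category.comp_id _)
  have hg : IsPullback (pullback.fst q P1.toSpecC) g c.f (pullback.fst p P1.toSpecC) := by
    refine (IsPullback.of_bot (h₁₁ := pullback.fst q P1.toSpecC) (v₁₁ := g)
      (h₂₁ := pullback.fst p P1.toSpecC) (v₁₂ := c.f) (v₂₁ := pullback.snd _ _) (v₂₂ := p)
      (h₃₁ := P1.toSpecC) ?_ hg₁.symm (IsPullback.of_hasPullback p P1.toSpecC))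
    rw [hg₂]
    exact IsPullback.of_hasPullback q P1.toSpecC
  have hE0 : IsEmpty (pullback s₀ (Scheme.emptyTo W) : Scheme.{0}) :=
    (pullback.snd s₀ (Scheme.emptyTo W)).base.hom.1.isEmpty
  have hE1 : IsEmpty B.Y := inferInstanceAs (IsEmpty (∅ : Scheme.{0}))
  have hfst : IsProjective (pullback.fst q P1.toSpecC) :=
    (isProjective_toBase 1 SpecC).of_isPullback (IsPullback.of_hasPullback q P1.toSpecC).flip
  have hsmooth : SmoothOfRelativeDimension 1 (pullback.fst q P1.toSpecC) :=
    smooth_of_isPullback 1 (IsPullback.of_hasPullback q P1.toSpecC).flip inferInstance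
  have hq : g ≫ pullback.fst _ _ ≫ p = pullback.fst q P1.toSpecC ≫ q := by
    rw [← Category.assoc, hg₁, Category.assoc]
  have hs : SmoothOfRelativeDimension n q := c.smooth
  have hs₀ : s₀ ≫ pullback.fst q P1.toSpecC ≫ c.f = c.f := by
    rw [← Category.assoc, constSection_fst, Category.id_comp]
  have hs₁ : constSection q P1.infty infty_toSpecC ≫ pullback.fst q P1.toSpecC ≫ c.f = c.f := by
    rw [← Category.assoc, constSection_fst, Category.id_comp]
  have hker : (pullback.fst (pullback.snd q P1.toSpecC) P1.zero).ker =
      s₀.ker ⊓ (Scheme.emptyTo W).ker := by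
    rw [Scheme.ker_eq_top_of_isEmpty (Scheme.emptyTo W), inf_top_eq]
    have h := isPullback_constSection q P1.zero zero_toSpecC
    change _ = (constSection q P1.zero zero_toSpecC).ker
    rw [← h.isoPullback_hom_fst, Scheme.Hom.ker_comp_of_isIso]
  have hdeg : IsDoublePointDegeneration (pullback.fst q P1.toSpecC ≫ q) n
      (pullback.snd q P1.toSpecC)
      s₀ (Scheme.emptyTo W) := by
    refine ⟨pullback.condition.symm, ?_, c.quasiProjective.comp_isProjective hfst, this,
      inferInstance, ?_, smoothOfRelativeDimension_of_isEmpty _ n, hker, Or.inl hE0⟩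
    · rw [add_comm]
      exact smoothOfRelativeDimension_comp 1 n (pullback.fst q P1.toSpecC) q
    · have : s₀ ≫ pullback.fst q P1.toSpecC ≫ q = q := by
        rw [← Category.assoc, constSection_fst, Category.id_comp]
      rw [this]
      exact hs
  have hreg : IsRegularValue (pullback.snd q P1.toSpecC) P1.infty := by
    refine ⟨infty_toSpecC, ⊤, fun _ => trivial, ?_⟩
    have h1 : Smooth q := SmoothOfRelativeDimension.smooth n _
    have h2 : Smooth (pullback.snd q P1.toSpecC) :=
      smooth_isStableUnderBaseChange.of_isPullback (IsPullback.of_hasPullback q P1.toSpecC) h1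
    infer_instance
  have hempty (f : ∅ ⟶ W) : f = Scheme.emptyTo W := Scheme.empty_ext _ _
  have hP (f : ∅ ⟶ W) : D.IsPullback f E F := by rwa [hempty f]
  have rel : IsDoublePointRelation (c.withData E₁) (c.withData E₀) B B := by
    refine ⟨W, F, g, P1.infty, constSection q P1.infty infty_toSpecC, s₀, Scheme.emptyTo W,
      Scheme.emptyTo _, c.projective.of_isPullback hg, ?_, ?_, ?_,
      isNormalProjectiveBundle_of_isEmpty (P := ∅)
        (D := (pullback s₀ (Scheme.emptyTo W) : Scheme.{0})) _ _,
      ⟨?_, h₁⟩, ⟨?_, h₀⟩, ⟨Scheme.empty_ext _ _, hE⟩, ⟨Scheme.empty_ext _ _, hP _⟩⟩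
    · rw [hg₂, hq]
      exact hdeg
    · rw [hg₂]
      exact hreg
    · rw [hg₂]
      exact isPullback_constSection q P1.infty infty_toSpecC
    · rw [hg₁]
      exact hs₁.symm
    · rw [hg₁]
      exact hs₀.symm
  have h := rel.class_eq
  rw [B.class_of_isEmpty hE1, sub_zero, add_zero, sub_eq_zero] at h
  exact h

end

/-! ### Associated graded bundles and lists -/

section

variable {D D' : BundleKind} {X : Scheme.{0}} {p : X ⟶ SpecC} {n : ℕ}

lemma Cycle.class_withData_of_isPullback (c : Cycle D p n) {E₁ E₂ : D.Obj c.Y}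
    (h : D.IsPullback (𝟙 c.Y) E₁ E₂) : (c.withData E₁).class = (c.withData E₂).class :=
  Cycle.IsIsomorphic.class_eq ⟨Iso.refl c.Y, (Category.id_comp c.f).symm, h⟩

section Splitting

variable {s : ℕ} {r : Fin s → ℕ}

lemma filteredBundles_isPullback_id {Y : Scheme.{0}} {E E' : FilteredBundle r Y}
    (e : E.step ≅ E'.step) : (filteredBundles r).IsPullback (𝟙 Y) E E' :=
  ⟨e ≪≫ Functor.isoWhiskerLeft E'.step (Scheme.Modules.pullbackId Y).symm⟩

/-- Modification of the filtration along zero does not change the class in cobordism. -/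
lemma class_modification (hr : StrictMono r) (c : Cycle (filteredBundles r) p n)
    {S : Fin s ⥤ c.Y.Modules} (hS : IsFiltered r S) (j : Fin s) :
    (c.withData (hS.bundle hr.monotone)).class =
      (c.withData ((hS.modification (globalSMul (0 : Γ(c.Y, ⊤))) j).bundle hr.monotone)).class := by
  obtain ⟨F, hF, h₁, h₀⟩ := exists_deformation (c.f ≫ p) S hS j
  exact class_withData_eq (isGeometric_filteredBundles hr.monotone) c
    (hF.bundle hr.monotone) _ _ h₀ h₁

/-- Every cycle is cobordant to one with the same associated graded bundle and with a filtration
which is split in the first `m` steps: the steps are split one after the other. -/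
lemma exists_split_steps (hr : StrictMono r) (c : Cycle (filteredBundles r) p n) (m : ℕ) :
    ∃ (S : Fin s ⥤ c.Y.Modules) (hS : IsFiltered r S),
      (∀ k h, k < m → IsSplitMono (stepMap S k h)) ∧
      (∀ i, Nonempty (quotients S i ≅ quotients c.E.step i)) ∧
      c.class = (c.withData (hS.bundle hr.monotone)).class := by
  induction m with
  | zero => exact ⟨c.E.step, c.E.isFiltered, fun k h hk => absurd hk (Nat.not_lt_zero k),
      fun i => ⟨Iso.refl _⟩, rfl⟩
  | succ m ih =>
    obtain ⟨S, hS, h₁, h₂, h₃⟩ := ih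
    by_cases hm : m + 1 < s
    · let j : Fin s := ⟨m, Nat.lt_of_succ_lt hm⟩
      refine ⟨_, hS.modification (globalSMul (0 : Γ(c.Y, ⊤))) j, fun k h hk => ?_, fun i => ?_,
        h₃.trans (class_modification hr c hS j)⟩
      · obtain hk | rfl := Nat.lt_succ_iff_lt_or_eq.1 hk
        · have := h₁ k h hk
          exact isSplitMono_stepMap_modification _ j S k h
        · exact isSplitMono_modification _ globalSMul_zero_app j S _
      · exact ⟨(quotients_modification_iso _ j S i).some ≪≫ (h₂ i).some⟩
    · exact ⟨S, hS, fun k h hk => h₁ k h (by omega), h₂, h₃⟩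

/-- A filtered bundle is cobordant to the split filtration of its associated graded bundle. -/
lemma class_split_gr (hr : StrictMono r) (c : Cycle (filteredBundles r) p n) :
    ((c.map (grHom r)).map (splitHom hr.monotone)).class = c.class := by
  obtain ⟨S, hS, h₁, h₂, h₃⟩ := exists_split_steps hr c s
  obtain ⟨e⟩ := nonempty_splitFiltration_iso S fun k h => h₁ k h (by omega)
  rw [h₃]
  refine c.class_withData_of_isPullback (filteredBundles_isPullback_id (Iso.trans ?_ e))
  exact splitFiltrationIso (𝟭 _) (fun i => (h₂ i).some.symm)

lemma class_gr_split (hr : StrictMono r) (c : Cycle (gradedBundles (differences r)) p n) :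
    ((c.map (splitHom hr.monotone)).map (grHom r)).class = c.class := by
  refine c.class_withData_of_isPullback ((gradedBundles_isPullback_iff _ _ _).2 fun i => ?_)
  exact ⟨(quotients_splitFiltration_iso _ i).some ≪≫ ((Scheme.Modules.pullbackId _).app _).symm⟩

end Splitting

lemma class_graded_list {s : ℕ} {d : Fin s → ℕ} (c : Cycle (gradedBundles d) p n) :
    ((c.map (listHom d)).map (gradedHom d)).class = c.class :=
  c.class_withData_of_isPullback ((gradedBundles_isPullback_iff _ _ _).2
    ((isGeometric_bundleLists d).id c.E.list))

lemma class_list_graded {s : ℕ} {d : Fin s → ℕ} (c : Cycle (bundleLists d) p n) :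
    ((c.map (gradedHom d)).map (listHom d)).class = c.class := rfl

lemma Cycle.cobordismClass_eq (c : Cycle D p n) :
    c.cobordismClass = DirectSum.of (CobordismGroup D p) n c.class := rfl

lemma TotalCobordism.hom_ext {A : Type*} [AddCommGroup A] {f g : TotalCobordism D p →+ A}
    (h : ∀ (n : ℕ) (c : Cycle D p n), f c.cobordismClass = g c.cobordismClass) : f = g :=
  DirectSum.addHom_ext' fun n => CobordismGroup.hom_ext (h n)

lemma TotalCobordism.map_map (F : BundleKind.Hom D D') (G : BundleKind.Hom D' D)
    (h : ∀ (n : ℕ) (c : Cycle D p n), ((c.map F).map G).class = c.class) (x : TotalCobordism D p) :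
    TotalCobordism.map p G (TotalCobordism.map p F x) = x := by
  have : (TotalCobordism.map p G).comp (TotalCobordism.map p F) = AddMonoidHom.id _ := by
    refine TotalCobordism.hom_ext fun n c => ?_
    rw [AddMonoidHom.comp_apply, map_cobordismClass, map_cobordismClass, Cycle.cobordismClass_eq, h]
    rfl
  exact DFunLike.congr_fun this x

end

/-! ### Flat pullback of quasi-coherent modules on affine schemes -/

section

open Scheme.Modules
variable {R S : CommRingCat.{0}}

/-- The sections of a pushforward along `Spec S ⟶ Spec R` are obtained by restriction of
scalars. -/
def pushforwardΓIso (φ : R ⟶ S) :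
    Scheme.Modules.pushforward (Spec.map φ) ⋙ moduleSpecΓFunctor (R := R) ≅
      moduleSpecΓFunctor (R := S) ⋙ ModuleCat.restrictScalars φ.hom :=
  Functor.isoWhiskerRight (pushforwardCompModulesSpecToSheafIso φ)
    (TopCat.Sheaf.forget _ _ ⋙ (evaluation _ _).obj (.op ⊤))

/-- The pullback of the sheaf associated with a module along `Spec S ⟶ Spec R` is
associated with the extension of scalars. -/
def tildePullbackIso (φ : R ⟶ S) :
    tilde.functor R ⋙ Scheme.Modules.pullback (Spec.map φ) ≅
      ModuleCat.extendScalars φ.hom ⋙ tilde.functor S :=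
  ((tilde.adjunction (R := R)).comp (pullbackPushforwardAdjunction (Spec.map φ))).leftAdjointUniq
    (((ModuleCat.extendRestrictScalarsAdj φ.hom).comp
      (tilde.adjunction (R := S))).ofNatIsoRight (pushforwardΓIso φ).symm)

lemma section_ext_basicOpen {M : (Spec R).Modules} {U : (Spec R).Opens} (s t : Γ(M, U))
    (h : ∀ f (hf : PrimeSpectrum.basicOpen f ≤ U), M.presheaf.map (homOfLE hf).op s =
      M.presheaf.map (homOfLE hf).op t) : s = t := by
  refine section_ext _ _ fun x hx => ?_
  obtain ⟨_, ⟨_, ⟨f, rfl⟩, rfl⟩, hxf, hf⟩ :=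
    PrimeSpectrum.isBasis_basic_opens.exists_subset_of_mem_open hx U.isOpen
  exact ⟨_, hf, hxf, h f hf⟩

/-- Localization at `f` preserves injectivity, on sections over `D(f)`. -/
lemma tilde_map_app_basicOpen_injective {M N : ModuleCat R} (g : M ⟶ N) (hg : Function.Injective g)
    (f : R) : Function.Injective
      ((modulesSpecToSheaf.map (tilde.map g)).1.app (.op (PrimeSpectrum.basicOpen f))).hom := by
  refine (injective_iff_map_eq_zero _).2 fun s hs => ?_
  obtain ⟨⟨m, c⟩, hc⟩ := IsLocalizedModule.surj (.powers f)
    (tilde.toOpen M (PrimeSpectrum.basicOpen f)).hom s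
  have h2 : (tilde.toOpen N (PrimeSpectrum.basicOpen f)).hom (g.hom m) = 0 := by
    refine (congr($(tilde.toOpen_map_app g (PrimeSpectrum.basicOpen f)).hom m)).symm.trans ?_
    change ((modulesSpecToSheaf.map (tilde.map g)).1.app (.op (PrimeSpectrum.basicOpen f))).hom
      ((tilde.toOpen M (PrimeSpectrum.basicOpen f)).hom m) = 0
    refine (congrArg _ hc.symm).trans ((LinearMap.map_smul_of_tower _ c s).trans ?_)
    rw [hs, smul_zero]
  obtain ⟨c', hc'⟩ := (IsLocalizedModule.eq_zero_iff (.powers f) _).1 h2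
  have h3 : c' • m = 0 := hg <| by
    refine ((LinearMap.map_smul_of_tower g.hom c' m).trans hc').trans ?_
    exact (map_zero g.hom).symm
  have h4 : c' • c • s = 0 := by
    refine (congrArg (c' • ·) hc).trans ?_
    refine (LinearMap.map_smul_of_tower _ c' m).symm.trans ?_
    rw [h3, map_zero]
  have h5 (c : Submonoid.powers f) (x : (modulesSpecToSheaf.obj (tilde M)).presheaf.obj
      (.op (PrimeSpectrum.basicOpen f))) (h : c • x = 0) : x = 0 :=
    IsLocalizedModule.smul_injective (tilde.toOpen M (PrimeSpectrum.basicOpen f)).hom c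
      (h.trans (smul_zero c).symm)
  exact h5 c _ (h5 c' _ h4)

instance : (tilde.functor R).PreservesMonomorphisms where
  preserves {M N} g hg := by
    refine (mono_iff_injective _).2 fun U => (injective_iff_map_eq_zero _).2 fun s hs => ?_
    refine section_ext_basicOpen _ _ fun f hf => ?_
    refine tilde_map_app_basicOpen_injective g ((ModuleCat.mono_iff_injective g).1 hg) f ?_
    refine (app_map ((tilde.functor R).map g) hf s).trans
      (Eq.trans ?_ (app_map ((tilde.functor R).map g) hf 0).symm)
    exact congrArg _ (hs.trans (map_zero _).symm)

lemma preservesMonomorphisms_extendScalars (φ : R ⟶ S) (hφ : φ.hom.Flat) :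
    (ModuleCat.extendScalars.{_, _, 0} φ.hom).PreservesMonomorphisms where
  preserves {M N} g hg := by
    algebraize [φ.hom]
    rw [ModuleCat.mono_iff_injective] at hg ⊢
    exact Module.Flat.lTensor_preserves_injective_linearMap (M := S) g.hom hg

/-- A module on `Spec R` is associated with its global sections if its sections on `D(f)` are the
localizations of its global sections. -/
lemma isIso_fromTildeΓ_of_basicOpen (M : (Spec R).Modules)
    (h₁ : ∀ (f : R) (U : (Spec R).Opens), U = PrimeSpectrum.basicOpen f → ∀ s : Γ(M, U),
      ∃ (n : ℕ) (t : Γ(M, ⊤)), M.presheaf.map (homOfLE le_top).op t = f ^ n • s)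
    (h₂ : ∀ (f : R) (U : (Spec R).Opens), U = PrimeSpectrum.basicOpen f → ∀ t : Γ(M, ⊤),
      M.presheaf.map (homOfLE (le_top : U ≤ ⊤)).op t = 0 → ∃ n : ℕ, f ^ n • t = 0) :
    IsIso M.fromTildeΓ := by
  refine (isIso_fromTildeΓ_iff_isLocalizing M).2 fun f =>
    IsLocalizedModule.Away.mk_of_addCommGroup ?_ ?_ ?_
  · exact isUnit_algebraMap_end_of_le_basicOpen f le_rfl
  · intro x
    obtain ⟨n, t, ht⟩ := h₁ f _ rfl x
    exact ⟨n, t, ht.symm⟩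
  · intro x hx
    exact h₂ f _ rfl x hx

/-- Pullback along a flat morphism of affine schemes preserves monomorphisms between quasi-coherent
modules. -/
lemma mono_pullback_map_of_isIso_fromTildeΓ (φ : R ⟶ S) (hφ : φ.hom.Flat) {K M : (Spec R).Modules}
    [IsIso K.fromTildeΓ] [IsIso M.fromTildeΓ] (ι : K ⟶ M) [Mono ι] :
    Mono ((Scheme.Modules.pullback (Spec.map φ)).map ι) := by
  have := preservesMonomorphisms_extendScalars φ hφ
  let g := (moduleSpecΓFunctor (R := R)).map ι
  have : (moduleSpecΓFunctor (R := R)).IsRightAdjoint := tilde.adjunction.isRightAdjoint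
  have hg : Mono g := inferInstance
  have h1 : Mono ((Scheme.Modules.pullback (Spec.map φ)).map ((tilde.functor R).map g)) := by
    have e := (tildePullbackIso φ).hom.naturality g
    have : Mono ((tildePullbackIso φ).hom.app _ ≫
      (ModuleCat.extendScalars φ.hom ⋙ tilde.functor S).map g) := by
      refine mono_comp' inferInstance ?_
      change Mono ((tilde.functor S).map ((ModuleCat.extendScalars φ.hom).map g))
      infer_instance
    rw [← e] at this
    exact @mono_of_mono _ _ _ _ _ _ _ this
  let ε := (tilde.adjunction (R := R)).counit
  have hK : IsIso (ε.app K) := ‹IsIso K.fromTildeΓ›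
  have hM : IsIso (ε.app M) := ‹IsIso M.fromTildeΓ›
  have h2 : ι = inv (ε.app K) ≫ (tilde.functor R).map g ≫ ε.app M := by
    rw [IsIso.eq_inv_comp]
    exact (ε.naturality ι).symm
  rw [h2, Functor.map_comp, Functor.map_comp]
  infer_instance

end

/-! ### Flat pullback of ideal sheaves -/

section

open Scheme.Modules
variable {X Y : Scheme.{0}}

lemma exists_kernel_section {M N : Y.Modules} (φ : M ⟶ N) {U : Y.Opens} (s : Γ(M, U))
    (hs : φ.app U s = 0) : ∃ t : Γ(kernel φ, U), (kernel.ι φ).app U t = s := by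
  let G : Y.Modules ⥤ Ab := toPresheaf Y ⋙ (evaluation (TopologicalSpace.Opens Y)ᵒᵖ Ab.{0}).obj
    (.op U)
  have hG : PreservesLimits G := by
    have : PreservesLimits ((evaluation (TopologicalSpace.Opens Y)ᵒᵖ Ab.{0}).obj (.op U)) :=
      inferInstance
    exact comp_preservesLimits (toPresheaf Y) _
  have : G.PreservesZeroMorphisms := ⟨fun _ _ => rfl⟩
  have h1 : (ShortComplex.mk (kernel.ι φ) φ (kernel.condition φ)).Exact :=
    ShortComplex.exact_kernel φ
  have h2 := h1.map_of_mono_of_preservesKernel G inferInstance inferInstance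
  exact (ShortComplex.ab_exact_iff _).1 h2 s hs

/-- The inclusion of the ideal sheaf of `i`. -/
abbrev idealι (i : X ⟶ Y) : kernel (toPushforwardStructure i) ⟶ structureModule Y :=
  kernel.ι (toPushforwardStructure i)

/-- Sections of the ideal sheaf of `i`, as functions. -/
def idealValue (i : X ⟶ Y) (U : Y.Opens) :
    Γ(kernel (toPushforwardStructure i), U) →+ Γ(Y, U) :=
  AddMonoidHom.mk' (fun t => (idealι i).app U t) fun a b => map_add ((idealι i).app U).hom a b

lemma idealValue_smul (i : X ⟶ Y) (U : Y.Opens) (r : Γ(Y, U)) (t) :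
    idealValue i U (r • t) = r * idealValue i U t :=
  (idealι i).app_smul r t

lemma idealValue_map (i : X ⟶ Y) {U V : Y.Opens} (h : V ≤ U) (t) :
    idealValue i V ((kernel (toPushforwardStructure i)).presheaf.map (homOfLE h).op t) =
      Y.presheaf.map (homOfLE h).op (idealValue i U t) :=
  app_map (idealι i) h t

lemma idealValue_injective (i : X ⟶ Y) (U : Y.Opens) : Function.Injective (idealValue i U) :=
  (mono_iff_injective (idealι i)).1 inferInstance U

/-- Over affine open subschemes, the ideal sheaf is given by Mathlib's ideal sheaf data. -/
lemma mem_range_idealValue (i : X ⟶ Y) [QuasiCompact i] (U : Y.affineOpens) (s : Γ(Y, U)) :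
    (∃ t, idealValue i U.1 t = s) ↔ s ∈ i.ker.ideal U := by
  rw [Scheme.Hom.ker_apply, RingHom.mem_ker]
  constructor
  · rintro ⟨t, rfl⟩
    exact congr($(congrArg (fun k : _ ⟶ _ => Hom.app k U.1)
      (kernel.condition (toPushforwardStructure i))) t)
  · intro h
    exact exists_kernel_section (toPushforwardStructure i) (U := U.1) s h

section Affine

variable {R : CommRingCat.{0}}

/-- The global function on `Spec R` defined by an element of `R`. -/
abbrev specFunction (f : R) : Γ(Spec R, ⊤) := (Scheme.ΓSpecIso R).inv f

lemma specFunction_map_top (f : R) : (Spec R).presheaf.map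
    (homOfLE (le_top : (⊤ : (Spec R).Opens) ≤ ⊤)).op
    (specFunction f) = specFunction f :=
  congr($((Spec R).presheaf.map_id _) _)

lemma exists_pow_mul_of_mem_ideal (J : (Spec R).IdealSheafData) (f : R) (U : (Spec R).affineOpens)
    (hU : U.1 = PrimeSpectrum.basicOpen f) (x : Γ(Spec R, U)) (hx : x ∈ J.ideal U) :
    ∃ (n : ℕ), ∃ y ∈ J.ideal ⟨⊤, isAffineOpen_top _⟩,
      (Spec R).presheaf.map (homOfLE le_top).op y =
        (Spec R).presheaf.map (homOfLE (le_top : U.1 ≤ ⊤)).op (specFunction f) ^ n * x := by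
  have hb : PrimeSpectrum.basicOpen f = (Spec R).basicOpen (specFunction f) :=
    (basicOpen_eq_of_affine _).symm
  obtain rfl : U = (Spec R).affineBasicOpen (U := ⟨⊤, isAffineOpen_top _⟩) (specFunction f) :=
    Subtype.ext (hU.trans hb)
  rw [← J.map_ideal_basicOpen] at hx
  have := (isAffineOpen_top (Spec R)).isLocalization_basicOpen (specFunction f)
  obtain ⟨⟨y, ⟨_, n, rfl⟩⟩, hy⟩ := (IsLocalization.mem_map_algebraMap_iff
    (.powers (specFunction f)) Γ(Spec R, (Spec R).basicOpen (specFunction f))).1 hx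
  refine ⟨n, y.1, y.2, hy.symm.trans ?_⟩
  rw [mul_comm, map_pow]
  rfl

lemma exists_pow_mul_eq_zero (f : R) (U : (Spec R).Opens) (hU : U = PrimeSpectrum.basicOpen f)
    (x : Γ(Spec R, ⊤)) (hx : (Spec R).presheaf.map (homOfLE (le_top : U ≤ ⊤)).op x = 0) :
    ∃ n : ℕ, specFunction f ^ n * x = 0 := by
  have hb : PrimeSpectrum.basicOpen f = (Spec R).basicOpen (specFunction f) :=
    (basicOpen_eq_of_affine _).symm
  obtain rfl := hU.trans hb
  have := (isAffineOpen_top (Spec R)).isLocalization_basicOpen (specFunction f)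
  obtain ⟨⟨_, n, rfl⟩, hy⟩ := (IsLocalization.map_eq_zero_iff (.powers (specFunction f))
    Γ(Spec R, (Spec R).basicOpen (specFunction f)) x).1 hx
  exact ⟨n, hy⟩

/-- The ideal sheaf of a quasi-compact morphism is quasi-coherent. Its sections over affine open
subschemes are compared with the ideals of Mathlib's `IdealSheafData`, which localize well. -/
lemma isIso_fromTildeΓ_restrict_kernel (i : X ⟶ Y) [QuasiCompact i] (k : Spec R ⟶ Y)
    [IsOpenImmersion k] :
    IsIso ((kernel (toPushforwardStructure i)).restrict k).fromTildeΓ := by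
  let K := (kernel (toPushforwardStructure i)).restrict k
  let J := i.ker.comap k
  -- `j` embeds the sections of the ideal sheaf into the functions on `Spec R`.
  let j (U : (Spec R).Opens) (t : Γ(K, U)) : Γ(Spec R, U) :=
    (k.appIso U).hom (idealValue i (k ''ᵁ U) t)
  have hj (U) : Function.Injective (j U) :=
    (ConcreteCategory.injective_of_mono_of_preservesPullback (k.appIso U).hom).comp
      (idealValue_injective i (k ''ᵁ U))
  have hsmul' (U : (Spec R).Opens) (r : Γ(Spec R, U)) (t : Γ(K, U)) : j U (r • t) = r * j U t := by
    have h : j U (r • t) = (k.appIso U).hom ((k.appIso U).inv r * idealValue i (k ''ᵁ U) t) :=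
      congrArg (k.appIso U).hom (idealValue_smul i (k ''ᵁ U) ((k.appIso U).inv r) t)
    rw [h, map_mul]
    congr 1
    exact congr($((k.appIso U).inv_hom_id) r)
  have hsmul (f : R) (n : ℕ) (U : (Spec R).Opens) (t : Γ(K, U)) :
      j U (f ^ n • t) = (Spec R).presheaf.map (homOfLE (le_top : U ≤ ⊤)).op (specFunction f) ^ n
        * j U t := by
    refine (hsmul' U _ t).trans ?_
    rw [← map_pow, ← map_pow]
    rfl
  have hmap (U V : (Spec R).Opens) (h : V ≤ U) (t : Γ(K, U)) :
      j V (K.presheaf.map (homOfLE h).op t) = (Spec R).presheaf.map (homOfLE h).op (j U t) := by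
    have h' : j V (K.presheaf.map (homOfLE h).op t) = (k.appIso V).hom (Y.presheaf.map
        (homOfLE (Scheme.Hom.image_mono k h)).op (idealValue i (k ''ᵁ U) t)) :=
      congrArg (k.appIso V).hom (idealValue_map i (Scheme.Hom.image_mono k h) t)
    rw [h']
    exact congr($(k.appIso_hom_naturality (homOfLE h).op) (idealValue i (k ''ᵁ U) t))
  have hrange (U : (Spec R).affineOpens) (x : Γ(Spec R, U)) :
      (∃ t, j U.1 t = x) ↔ x ∈ J.ideal U := by
    have hU : IsAffineOpen (k ''ᵁ U.1) := U.2.image_of_isOpenImmersion k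
    rw [Scheme.IdealSheafData.ideal_comap_of_isOpenImmersion, Ideal.mem_comap,
      ← mem_range_idealValue]
    refine exists_congr fun t => ⟨?_, fun h => ?_⟩
    · rintro rfl
      exact congr($((k.appIso U).hom_inv_id) _).symm
    · change (k.appIso U).hom (idealValue i (k ''ᵁ U) t) = x
      refine (congrArg _ h).trans ?_
      exact congr($((k.appIso U).inv_hom_id) x)
  refine isIso_fromTildeΓ_of_basicOpen _ (fun f U hU s => ?_) (fun f U hU t ht => ?_)
  · have hU' : IsAffineOpen U := by
      rw [hU]
      exact (basicOpen_eq_of_affine f) ▸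
        (isAffineOpen_top (Spec R)).basicOpen (specFunction f)
    obtain ⟨n, y, hy, h⟩ := exists_pow_mul_of_mem_ideal J f ⟨U, hU'⟩ hU (j U s)
      ((hrange ⟨U, hU'⟩ _).1 ⟨s, rfl⟩)
    obtain ⟨t, rfl⟩ := (hrange ⟨⊤, isAffineOpen_top _⟩ y).2 hy
    exact ⟨n, t, hj U ((hmap _ _ _ _).trans (h.trans (hsmul f n U s).symm))⟩
  · have h0 (U) : j U 0 = 0 := by
      change (k.appIso U).hom (idealValue i (k ''ᵁ U) 0) = 0
      rw [map_zero, map_zero]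
    obtain ⟨n, hn⟩ := exists_pow_mul_eq_zero f U hU (j ⊤ t) (by
      rw [← hmap, ht, h0])
    refine ⟨n, hj ⊤ ((hsmul f n ⊤ t).trans ?_)⟩
    rw [specFunction_map_top, hn, h0]

lemma isIso_fromTildeΓ_restrict_structureModule (k : Spec R ⟶ Y) [IsOpenImmersion k] :
    IsIso ((structureModule Y).restrict k).fromTildeΓ := by
  rw [isIso_fromTildeΓ_iff]
  exact ⟨ModuleCat.of R R, ⟨tildeSelf ≪≫ (restrictUnitIso k).symm⟩⟩

end Affine

/-- Flat pullback preserves the inclusions of ideal sheaves. -/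
lemma mono_pullback_map_idealι {Y' : Scheme.{0}} (a : Y' ⟶ Y) [Flat a] (i : X ⟶ Y)
    [QuasiCompact i] :
    Mono ((Scheme.Modules.pullback a).map (idealι i)) := by
  refine mono_of_restrict _ fun y => ?_
  obtain ⟨U, hU, hyU, -⟩ := exists_isAffineOpen_mem_and_subset (x := a y) (U := ⊤) trivial
  obtain ⟨V, hV, hyV, hVU⟩ := exists_isAffineOpen_mem_and_subset (x := y) (U := a ⁻¹ᵁ U) hyU
  let φ := a.appLE U V hVU
  have hφ : φ.hom.Flat := a.flat_appLE hU hV hVU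
  refine ⟨_, hV.fromSpec, inferInstance, by rwa [hV.opensRange_fromSpec], ?_⟩
  have h : hV.fromSpec ≫ a = Spec.map φ ≫ hU.fromSpec := (hU.SpecMap_appLE_fromSpec a hV hVU).symm
  let e := pullbackRestrictIso a hV.fromSpec hU.fromSpec (Spec.map φ) h
  have := isIso_fromTildeΓ_restrict_kernel i hU.fromSpec
  have := isIso_fromTildeΓ_restrict_structureModule hU.fromSpec
  have hm : Mono ((restrictFunctor hU.fromSpec).map (idealι i)) := inferInstance
  have h1 := mono_pullback_map_of_isIso_fromTildeΓ φ hφ ((restrictFunctor hU.fromSpec).map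
    (idealι i))
  have h2 : Mono (e.hom.app _ ≫ (restrictFunctor hU.fromSpec ⋙ Scheme.Modules.pullback
    (Spec.map φ)).map
      (idealι i)) := mono_comp' inferInstance h1
  have h3 := e.hom.naturality (idealι i)
  rw [← h3] at h2
  exact @mono_of_mono _ _ _ _ _ _ _ h2

end

/-! ### Flat inverse images of ideals -/

section

open Scheme.Modules

/-- Extension of ideals along a flat homomorphism commutes with intersections: `I ⊓ J` is the kernel
of `R ⟶ R / I × R / J`, and flat base change preserves kernels. -/
lemma ideal_map_inf_of_flat {R S : Type} [CommRing R] [CommRing S] (φ : R →+* S) (hφ : φ.Flat)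
    (I J : Ideal R) : (I ⊓ J).map φ = I.map φ ⊓ J.map φ := by
  refine le_antisymm (Ideal.map_inf_le φ) fun x hx => ?_
  algebraize [φ]
  -- The extension of `K` vanishes in `S ⊗ R / K`.
  have h0 (K : Ideal R) (y : S) (hy : y ∈ K.map φ) :
      y ⊗ₜ[R] (Submodule.Quotient.mk 1 : R ⧸ K) = 0 := by
    refine Submodule.span_induction ?_ (TensorProduct.zero_tmul _ _) ?_ ?_ hy
    · rintro _ ⟨z, hz, rfl⟩
      change (algebraMap R S z) ⊗ₜ[R] _ = 0
      rw [Algebra.algebraMap_eq_smul_one, TensorProduct.smul_tmul, ← Submodule.Quotient.mk_smul,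
        smul_eq_mul, mul_one, (Submodule.Quotient.mk_eq_zero K).2 hz, TensorProduct.tmul_zero]
    · intro a b _ _ ha hb
      rw [TensorProduct.add_tmul, ha, hb, add_zero]
    · intro a b _ hb
      have := congrArg (fun t => a • t) hb
      simpa [TensorProduct.smul_tmul'] using this
  let f : R →ₗ[R] (R ⧸ I) × (R ⧸ J) := I.mkQ.prod J.mkQ
  have hf : LinearMap.ker f = I ⊓ J := by
    rw [LinearMap.ker_prod, Submodule.ker_mkQ, Submodule.ker_mkQ]
  have h1 : x ⊗ₜ[R] (1 : R) ∈ LinearMap.ker (f.lTensor S) := by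
    rw [LinearMap.mem_ker, LinearMap.lTensor_tmul]
    refine (TensorProduct.prodRight R R S _ _).injective ?_
    rw [TensorProduct.prodRight_tmul, map_zero]
    exact Prod.ext (h0 I x hx.1) (h0 J x hx.2)
  obtain ⟨t, ht⟩ := (Module.Flat.lTensor_exact S (LinearMap.exact_subtype_ker_map f) _).1 h1
  have h2 : x = TensorProduct.rid R S (x ⊗ₜ 1) := by simp
  rw [h2, ← ht]
  clear ht h2 h1
  induction t with
  | zero => rw [map_zero, map_zero]; exact zero_mem _
  | add a b ha hb => rw [map_add, map_add]; exact add_mem ha hb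
  | tmul s r =>
    rw [LinearMap.lTensor_tmul, TensorProduct.rid_tmul, Algebra.smul_def]
    exact Ideal.mul_mem_right _ _ (Ideal.mem_map_of_mem φ (hf ▸ r.2))

variable {X Y : Scheme.{0}}

lemma ideal_comap_top [IsAffine X] [IsAffine Y] (I : Y.IdealSheafData) (f : X ⟶ Y) :
    (I.comap f).ideal ⟨⊤, isAffineOpen_top X⟩ =
      (I.ideal ⟨⊤, isAffineOpen_top Y⟩).map f.appTop.hom := by
  refine le_antisymm ?_ ?_
  · let J : X.IdealSheafData :=
      .ofIdealTop ((I.ideal ⟨⊤, isAffineOpen_top Y⟩).map f.appTop.hom)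
    have h : I.comap f ≤ J := by
      rw [← Scheme.IdealSheafData.le_map_iff_comap_le]
      refine Scheme.IdealSheafData.le_of_isAffine ?_
      rw [Scheme.IdealSheafData.ideal_map_of_isAffineHom]
      refine Ideal.le_comap_map.trans (Ideal.comap_mono ?_)
      change _ ≤ J.ideal ⟨⊤, isAffineOpen_top X⟩
      rw [Scheme.IdealSheafData.ofIdealTop_ideal]
      simp only [homOfLE_leOfHom, homOfLE_refl, op_id, CategoryTheory.Functor.map_id,
        CommRingCat.hom_id, Ideal.map_id]
      exact le_rfl
    refine (h _).trans ?_
    rw [Scheme.IdealSheafData.ofIdealTop_ideal]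
    simp
  · rw [Ideal.map_le_iff_le_comap]
    have h : I ≤ (I.comap f).map f := Scheme.IdealSheafData.le_map_comap _ _
    have h' := h ⟨⊤, isAffineOpen_top Y⟩
    rwa [Scheme.IdealSheafData.ideal_map_of_isAffineHom] at h'

lemma comap_inv_eq_map_hom {A B : CommRingCat.{0}} (e : A ≅ B) (I : Ideal A) :
    I.comap e.inv.hom = I.map e.hom.hom :=
  Ideal.comap_symm e.commRingCatIsoToRingEquiv

lemma appLE_comp_appLE_of_comm {X' Y' : Scheme.{0}} {f : X ⟶ Y} {k : X' ⟶ X} {l : Y' ⟶ Y}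
    {g : X' ⟶ Y'} (h : k ≫ f = g ≫ l) {U : Y.Opens} {V : X.Opens} {S : Y'.Opens} {T : X'.Opens}
    (h₁ : S ≤ l ⁻¹ᵁ U) (h₂ : T ≤ k ⁻¹ᵁ V) (h₃ : V ≤ f ⁻¹ᵁ U) (h₄ : T ≤ g ⁻¹ᵁ S) :
    l.appLE U S h₁ ≫ g.appLE S T h₄ = f.appLE U V h₃ ≫ k.appLE V T h₂ := by
  rw [Scheme.Hom.appLE_comp_appLE, Scheme.Hom.appLE_comp_appLE]
  have hc (m n : X' ⟶ Y) (e : m = n) (e' : T ≤ m ⁻¹ᵁ U) (e'') :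
    n.appLE U T e'' = m.appLE U T e' := by subst e; rfl
  exact hc _ _ h _ _

/-- Locally on the source, the inverse image of ideal sheaves is the extension of ideals. The affine
open subschemes are images of spectra, so that the statement reduces to morphisms of affine
schemes. -/
lemma exists_ideal_comap_eq (f : X ⟶ Y) (W : X.Opens) (x : X) (hx : x ∈ W) :
    ∃ (U : Y.affineOpens) (V : X.affineOpens) (h : V.1 ≤ f ⁻¹ᵁ U.1), x ∈ V.1 ∧ V.1 ≤ W ∧
      ∀ I : Y.IdealSheafData, (I.comap f).ideal V = (I.ideal U).map (f.appLE U V h).hom := by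
  obtain ⟨U, hU, hyU, -⟩ := exists_isAffineOpen_mem_and_subset (x := f x) (U := ⊤) trivial
  obtain ⟨V, hV, hyV, hVU⟩ := exists_isAffineOpen_mem_and_subset (x := x) (U := f ⁻¹ᵁ U ⊓ W)
    ⟨hyU, hx⟩
  let k := hV.fromSpec
  let l := hU.fromSpec
  let g := Spec.map (f.appLE U V (hVU.trans inf_le_left))
  have h : k ≫ f = g ≫ l := (hU.SpecMap_appLE_fromSpec f hV _).symm
  have hk : k ''ᵁ ⊤ = V := by
    rw [Scheme.Hom.image_top_eq_opensRange, hV.opensRange_fromSpec]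
  have hl : l ''ᵁ ⊤ = U := by
    rw [Scheme.Hom.image_top_eq_opensRange, hU.opensRange_fromSpec]
  have hkl : k ''ᵁ ⊤ ≤ f ⁻¹ᵁ l ''ᵁ ⊤ := by
    rw [hk, hl]
    exact hVU.trans inf_le_left
  refine ⟨⟨l ''ᵁ ⊤, (isAffineOpen_top _).image_of_isOpenImmersion l⟩,
    ⟨k ''ᵁ ⊤, (isAffineOpen_top _).image_of_isOpenImmersion k⟩, hkl, by rwa [← hk] at hyV,
    hk.trans_le (hVU.trans inf_le_right), fun I => ?_⟩
  have h1 : ((I.comap f).comap k).ideal ⟨⊤, isAffineOpen_top _⟩ =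
      ((I.comap l).comap g).ideal ⟨⊤, isAffineOpen_top _⟩ := by
    rw [← Scheme.IdealSheafData.comap_comp, ← Scheme.IdealSheafData.comap_comp, h]
  have e1 := Scheme.IdealSheafData.ideal_comap_of_isOpenImmersion (I.comap f) k
    ⟨⊤, isAffineOpen_top _⟩
  have e2 := ideal_comap_top (I.comap l) g
  have e3 := Scheme.IdealSheafData.ideal_comap_of_isOpenImmersion I l ⟨⊤, isAffineOpen_top _⟩
  rw [comap_inv_eq_map_hom] at e1 e3
  rw [e3] at e2
  have h2 := congrArg (Ideal.map (k.appIso ⊤).inv.hom) (e1.symm.trans (h1.trans e2))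
  rw [Ideal.map_map, Ideal.map_map, Ideal.map_map, ← CommRingCat.hom_comp, ← CommRingCat.hom_comp,
    ← CommRingCat.hom_comp, Iso.hom_inv_id] at h2
  have h3 : (l.appIso ⊤).hom ≫ g.appTop ≫ (k.appIso ⊤).inv = f.appLE _ _ hkl := by
    rw [← Category.assoc, Iso.comp_inv_eq, Scheme.Hom.appIso_hom', Scheme.Hom.appIso_hom']
    have hg : g.appTop = g.appLE ⊤ ⊤ (show ⊤ ≤ g ⁻¹ᵁ ⊤ from le_top) := g.app_eq_appLE
    exact (congrArg _ hg).trans (appLE_comp_appLE_of_comm h _ _ _ _)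
  rw [← h3]
  exact (Ideal.map_id _).symm.trans h2

/-- Flat inverse images of closed subschemes commute with unions. -/
lemma comap_inf_of_flat (f : X ⟶ Y) [Flat f] (I J : Y.IdealSheafData) :
    (I ⊓ J).comap f = I.comap f ⊓ J.comap f := by
  choose U V h hx _ hI using fun x : X => exists_ideal_comap_eq f ⊤ x trivial
  refine Scheme.IdealSheafData.ext_of_iSup_eq_top V ?_ fun x => ?_
  · exact eq_top_iff.2 fun x _ => TopologicalSpace.Opens.mem_iSup.2 ⟨x, hx x⟩
  · rw [hI, Scheme.IdealSheafData.ideal_inf, Scheme.IdealSheafData.ideal_inf, Pi.inf_apply,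
      Pi.inf_apply, hI, hI]
    exact ideal_map_inf_of_flat _ (f.flat_appLE (U x).2 (V x).2 (h x)) _ _

end

/-! ### Base change of conormal sheaves -/

section

open Scheme.Modules

variable {D A D' A' : Scheme.{0}} {i' : D' ⟶ A'} {d : D' ⟶ D} {a : A' ⟶ A} {i : D ⟶ A}

/-- The transpose of the inclusion of an ideal sheaf: `a^* I ⟶ 𝒪`. -/
def pullbackIdealι (a : A' ⟶ A) (i : D ⟶ A) :
    (Scheme.Modules.pullback a).obj (kernel (toPushforwardStructure i)) ⟶ structureModule A' :=
  (Scheme.Modules.pullback a).map (idealι i) ≫ (pullbackUnitIso a).hom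

lemma pullbackIdealι_eq (a : A' ⟶ A) (i : D ⟶ A) : pullbackIdealι a i =
    ((pullbackPushforwardAdjunction a).homEquiv _ _).symm (idealι i ≫
      toPushforwardStructure a) := by
  rw [Adjunction.homEquiv_naturality_left_symm]
  rfl

/-- A function in the ideal of `i` defines a section of `a^* I`. -/
def pullbackSection (a : A' ⟶ A) (i : D ⟶ A) (U : A.Opens)
    (t : Γ(kernel (toPushforwardStructure i), U)) :
    Γ((Scheme.Modules.pullback a).obj (kernel (toPushforwardStructure i)), a ⁻¹ᵁ U) :=
  ((pullbackPushforwardAdjunction a).unit.app (kernel (toPushforwardStructure i))).app U t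

lemma pullbackIdealι_pullbackSection (U : A.Opens) (t) :
    (pullbackIdealι a i).app (a ⁻¹ᵁ U) (pullbackSection a i U t) = a.app U (idealValue i U t) := by
  have h : (pullbackPushforwardAdjunction a).unit.app _ ≫
      (Scheme.Modules.pushforward a).map (pullbackIdealι a i) =
      idealι i ≫ toPushforwardStructure a := by
    rw [pullbackIdealι_eq]
    refine (Adjunction.homEquiv_unit _ _ _ _).symm.trans ?_
    exact Equiv.apply_symm_apply _ _
  exact congr($(congrArg (fun k : _ ⟶ _ => Hom.app k U) h) t)

lemma pullbackIdealι_comp_toPushforwardStructure (h : i' ≫ a = d ≫ i) :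
    pullbackIdealι a i ≫ toPushforwardStructure i' = 0 := by
  apply ((pullbackPushforwardAdjunction a).homEquiv _ _).injective
  rw [Adjunction.homEquiv_naturality_right, pullbackIdealι_eq, Equiv.apply_symm_apply,
    Adjunction.homEquiv_unit, Functor.map_zero, comp_zero]
  refine Scheme.Modules.hom_ext _ _ fun U => ?_
  ext t
  change i'.app (a ⁻¹ᵁ U) (a.app U (idealValue i U t)) = 0
  have h1 : i.app U (idealValue i U t) = 0 := congr($(congrArg (fun k : _ ⟶ _ => Hom.app k U)
      (kernel.condition (toPushforwardStructure i))) t)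
  have h2 : (i' ≫ a).app U (idealValue i U t) = 0 := by
    rw [Scheme.Hom.congr_app h, Scheme.Hom.comp_app]
    change (D'.presheaf.map _) (d.app _ (i.app U (idealValue i U t))) = 0
    rw [h1, map_zero, map_zero]
  exact h2

/-- The comparison of the inverse image of the ideal sheaf with the ideal sheaf of the inverse
image. -/
def idealComparison (h : i' ≫ a = d ≫ i) :
    (Scheme.Modules.pullback a).obj (kernel (toPushforwardStructure i)) ⟶
      kernel (toPushforwardStructure i') :=
  kernel.lift _ (pullbackIdealι a i) (pullbackIdealι_comp_toPushforwardStructure h)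

lemma idealComparison_ι (h : i' ≫ a = d ≫ i) :
    idealComparison h ≫ idealι i' = pullbackIdealι a i :=
  kernel.lift_ι _ _ _

/-- Ideal sheaves of closed subschemes are compatible with flat base change: injectivity of the
comparison is flatness, and surjectivity holds for all base changes. -/
lemma isIso_idealComparison [Flat a] [IsClosedImmersion i]
    (h : CategoryTheory.IsPullback i' d a i) :
    IsIso (idealComparison h.w) := by
  have : IsClosedImmersion i' := MorphismProperty.of_isPullback h.flip inferInstance
  have hm : Mono (idealComparison h.w) := by
    have h1 : Mono (pullbackIdealι a i) :=
      mono_comp' (mono_pullback_map_idealι a i) inferInstance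
    rw [← idealComparison_ι h.w] at h1
    exact @mono_of_mono _ _ _ _ _ _ _ h1
  have hker : i'.ker = i.ker.comap a := by
    rw [← Scheme.IdealSheafData.ker_fst_of_isClosedImmersion, ← h.isoPullback_hom_fst,
      Scheme.Hom.ker_comp_of_isIso]
  have he : Epi (idealComparison h.w) := by
    refine IsLocallySurj.epi fun W s x hx => ?_
    obtain ⟨U, V, hVU, hxV, hVW, hI⟩ := exists_ideal_comap_eq a W x hx
    let s' := (kernel (toPushforwardStructure i')).presheaf.map (homOfLE hVW).op s
    have h1 : idealValue i' V.1 s' ∈ (i.ker.ideal U).map (a.appLE U V hVU).hom := by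
      rw [← hI, ← hker, ← mem_range_idealValue]
      exact ⟨s', rfl⟩
    suffices H : ∀ y ∈ (i.ker.ideal U).map (a.appLE U V hVU).hom,
        ∃ t, (pullbackIdealι a i).app V.1 t = y by
      obtain ⟨t, ht⟩ := H _ h1
      refine ⟨V.1, hVW, t, hxV, idealValue_injective i' V.1 ?_⟩
      rw [← idealComparison_ι h.w] at ht
      exact ht
    intro y hy
    refine Submodule.span_induction ?_ ⟨0, map_zero _⟩ ?_ ?_ hy
    · rintro _ ⟨z, hz, rfl⟩
      obtain ⟨t, rfl⟩ := (mem_range_idealValue i U z).2 hz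
      refine ⟨((Scheme.Modules.pullback a).obj _).presheaf.map (homOfLE hVU).op
        (pullbackSection a i U.1 t), ?_⟩
      refine (app_map (pullbackIdealι a i) hVU _).trans ?_
      refine (congrArg _ (pullbackIdealι_pullbackSection U.1 t)).trans ?_
      rfl
    · rintro _ _ _ _ ⟨u, rfl⟩ ⟨v, rfl⟩
      exact ⟨u + v, map_add _ _ _⟩
    · rintro r _ _ ⟨u, rfl⟩
      exact ⟨r • u, (pullbackIdealι a i).app_smul r u⟩
  exact isIso_of_mono_of_epi _

/-- The conormal sheaf is compatible with flat base change. -/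
def conormalPullbackIso [Flat a] [IsClosedImmersion i] (h : CategoryTheory.IsPullback i' d a i) :
    conormal i' ≅ (Scheme.Modules.pullback d).obj (conormal i) :=
  haveI := isIso_idealComparison h
  (Scheme.Modules.pullback i').mapIso (asIso (idealComparison h.w)).symm ≪≫
    (pullbackComp i' a).app _ ≪≫ (pullbackCongr h.w).app _ ≪≫ ((pullbackComp d i).app _).symm

end

/-! ### Base change of projective bundles -/

section

open Scheme.Modules

section Coherence

variable {T X Y Z : Scheme.{0}}

/-- The isomorphism `w^* u^* ≅ v^*` of a factorization `w ≫ u = v`. -/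
def pullbackFac (w : X ⟶ Y) (u : Y ⟶ Z) (v : X ⟶ Z) (h : w ≫ u = v) :
    Scheme.Modules.pullback u ⋙ Scheme.Modules.pullback w ≅ Scheme.Modules.pullback v :=
  pullbackComp w u ≪≫ pullbackCongr h

lemma pullbackFac_assoc (x : T ⟶ X) (y : X ⟶ Y) (z : Y ⟶ Z) {xy : T ⟶ Y} {yz : X ⟶ Z} {xyz : T ⟶ Z}
    (h₁ : x ≫ y = xy) (h₂ : y ≫ z = yz) (h₃ : x ≫ yz = xyz) (h₄ : xy ≫ z = xyz) (F : Z.Modules) :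
    (Scheme.Modules.pullback x).map ((pullbackFac y z yz h₂).hom.app F) ≫
        (pullbackFac x yz xyz h₃).hom.app F =
      (pullbackFac x y xy h₁).hom.app ((Scheme.Modules.pullback z).obj F) ≫
        (pullbackFac xy z xyz h₄).hom.app F := by
  subst h₁ h₂ h₃
  have h : (pullbackComp x (y ≫ z)).inv.app F ≫
      (Scheme.Modules.pullback x).map ((pullbackComp y z).inv.app F) ≫ 𝟙 _ ≫
        (pullbackComp x y).hom.app ((Scheme.Modules.pullback z).obj F) ≫
          (pullbackComp (x ≫ y) z).hom.app F = _ :=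
    NatTrans.congr_app (pseudofunctor_associativity x y z) F
  have e (w : T ⟶ Z) (hw : x ≫ y ≫ z = w) (h' : w = x ≫ y ≫ z)
      (h'' : Scheme.Modules.pullback (x ≫ y ≫ z) = Scheme.Modules.pullback w) :
      (eqToHom h'').app F ≫ (pullbackCongr h').hom.app F = 𝟙 _ := by
    subst hw
    exact Category.comp_id _
  have h1 := congrArg (· ≫ (pullbackCongr h₄).hom.app F) h
  beta_reduce at h1
  rw [e _ (Category.assoc _ _ _).symm, Category.id_comp] at h1
  have e1 : (pullbackFac (x ≫ y) z (x ≫ y ≫ z) h₄).hom.app F =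
    (pullbackComp (x ≫ y) z).hom.app F ≫ (pullbackCongr h₄).hom.app F := rfl
  have e2 : (pullbackFac x y (x ≫ y) rfl).hom = (pullbackComp x y).hom := Category.comp_id _
  have e3 : (pullbackFac y z (y ≫ z) rfl).hom = (pullbackComp y z).hom := Category.comp_id _
  have e4 : (pullbackFac x (y ≫ z) (x ≫ y ≫ z) rfl).hom = (pullbackComp x (y ≫ z)).hom :=
    Category.comp_id _
  rw [e1, e2, e3, e4]
  have i1 : (pullbackComp x (y ≫ z)).inv.app F = inv ((pullbackComp x (y ≫ z)).hom.app F) :=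
    (IsIso.inv_eq_of_hom_inv_id ((pullbackComp x (y ≫ z)).hom_inv_id_app F)).symm
  have i2 : (pullbackComp y z).inv.app F = inv ((pullbackComp y z).hom.app F) :=
    (IsIso.inv_eq_of_hom_inv_id ((pullbackComp y z).hom_inv_id_app F)).symm
  rw [i1, i2, Functor.map_inv, Category.assoc, IsIso.inv_comp_eq, Category.assoc,
    IsIso.inv_comp_eq, Category.comp_id, Category.assoc] at h1
  exact h1.symm

lemma pullbackFac_naturality (w : X ⟶ Y) (u : Y ⟶ Z) (v : X ⟶ Z) (h : w ≫ u = v) {F G : Z.Modules}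
    (φ : F ⟶ G) : (Scheme.Modules.pullback w).map ((Scheme.Modules.pullback u).map φ) ≫
      (pullbackFac w u v h).hom.app G = (pullbackFac w u v h).hom.app F ≫
        (Scheme.Modules.pullback v).map φ :=
  (pullbackFac w u v h).hom.naturality φ

end Coherence

section

variable {P D P' D' : Scheme.{0}}

/-- The pullback of a quotient of `u^* F` to a base change `u'` of `u`. -/
def pullbackQuotient {u : P ⟶ D} {u' : P' ⟶ D'} {d : D' ⟶ D} {w₀ : P' ⟶ P} (h : w₀ ≫ u = u' ≫ d)
    {F : D.Modules} {F' : D'.Modules} (φ : F' ≅ (Scheme.Modules.pullback d).obj F) {L : P.Modules}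
    (q : (Scheme.Modules.pullback u).obj F ⟶ L) :
    (Scheme.Modules.pullback u').obj F' ⟶ (Scheme.Modules.pullback w₀).obj L :=
  (Scheme.Modules.pullback u').map φ.hom ≫ (pullbackFac u' d (u' ≫ d) rfl).hom.app F ≫
    (pullbackFac w₀ u (u' ≫ d) h).inv.app F ≫ (Scheme.Modules.pullback w₀).map q

/-- The pullback along `w : T ⟶ P'` of the quotient on `P'` is the pullback along `T ⟶ P` of the
quotient on `P`. -/
lemma pullback_pullbackQuotient {u : P ⟶ D} {u' : P' ⟶ D'} {d : D' ⟶ D} {w₀ : P' ⟶ P}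
    (h : w₀ ≫ u = u' ≫ d) {F : D.Modules} {F' : D'.Modules}
    (φ : F' ≅ (Scheme.Modules.pullback d).obj F) {L : P.Modules}
    (q : (Scheme.Modules.pullback u).obj F ⟶ L) {T : Scheme.{0}} {v : T ⟶ D'} {w : T ⟶ P'}
    {x : T ⟶ P} (hw : w ≫ u' = v) (hx : w ≫ w₀ = x) (hn : x ≫ u = v ≫ d) :
    (pullbackFac w u' v hw).inv.app F' ≫
        (Scheme.Modules.pullback w).map (pullbackQuotient h φ q) ≫
          (pullbackFac w w₀ x hx).hom.app L =
      (Scheme.Modules.pullback v).map φ.hom ≫ (pullbackFac v d (v ≫ d) rfl).hom.app F ≫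
        (pullbackFac x u (v ≫ d) hn).inv.app F ≫ (Scheme.Modules.pullback x).map q := by
  have hm : w ≫ u' ≫ d = v ≫ d := by rw [← hw, Category.assoc]
  have a1 := pullbackFac_assoc w u' d hw rfl hm rfl F
  have a2 := pullbackFac_assoc w w₀ u hx h hm hn F
  have n1 := pullbackFac_naturality w w₀ x hx q
  have n2 := pullbackFac_naturality w u' v hw φ.hom
  have i1 : (Scheme.Modules.pullback w).map ((pullbackFac w₀ u (u' ≫ d) h).inv.app F) ≫
      (pullbackFac w w₀ x hx).hom.app ((Scheme.Modules.pullback u).obj F) =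
      (pullbackFac w (u' ≫ d) (v ≫ d) hm).hom.app F ≫ (pullbackFac x u (v ≫ d) hn).inv.app F := by
    have j1 := IsIso.inv_eq_of_hom_inv_id ((pullbackFac w₀ u (u' ≫ d) h).hom_inv_id_app F)
    have j2 := IsIso.inv_eq_of_hom_inv_id ((pullbackFac x u (v ≫ d) hn).hom_inv_id_app F)
    rw [← j1, ← j2, Functor.map_inv, IsIso.inv_comp_eq, ← Category.assoc, IsIso.eq_comp_inv, a2]
  have i2 := IsIso.inv_eq_of_hom_inv_id ((pullbackFac w u' v hw).hom_inv_id_app F')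
  rw [← i2, IsIso.inv_comp_eq, pullbackQuotient]
  simp only [Functor.map_comp, Category.assoc]
  rw [n1, ← reassoc_of% n2, reassoc_of% i1, reassoc_of% a1]

/-- Bundles of rank one quotients are stable under base change. -/
lemma IsBundleOfQuotientLines.of_isPullback {u : P ⟶ D} {u' : P' ⟶ D'} {d : D' ⟶ D} {w₀ : P' ⟶ P}
    (h : CategoryTheory.IsPullback w₀ u' u d) {F : D.Modules} {F' : D'.Modules}
    (φ : F' ≅ (Scheme.Modules.pullback d).obj F) (H : IsBundleOfQuotientLines u F) :
    IsBundleOfQuotientLines u' F' := by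
  obtain ⟨L, q, hL, hq, H⟩ := H
  refine ⟨(Scheme.Modules.pullback w₀).obj L, pullbackQuotient h.w φ q, hL.pullback w₀, ?_,
    fun T v L' q' hL' hq' => ?_⟩
  · unfold pullbackQuotient
    have : Epi ((Scheme.Modules.pullback w₀).map q) := inferInstance
    infer_instance
  · let ψ := (Scheme.Modules.pullback v).map φ.hom ≫ (pullbackFac v d (v ≫ d) rfl).hom.app F
    obtain ⟨x, ⟨hx, e, he⟩, hxu⟩ := H T (v ≫ d) L' (inv ψ ≫ q') hL' inferInstance
    -- A morphism `T ⟶ P'` over `D'` induces the quotient `q'` if and only if the corresponding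
    -- morphism `T ⟶ P` over `D` does.
    have key (w : T ⟶ P') (x : T ⟶ P) (hw : w ≫ u' = v) (hx : w ≫ w₀ = x) (hn : x ≫ u = v ≫ d)
        (e : (Scheme.Modules.pullback x).obj L ≅ L') :
        (q' = (pullbackCongr hw).inv.app F' ≫ (pullbackComp w u').inv.app F' ≫
          (Scheme.Modules.pullback w).map (pullbackQuotient h.w φ q) ≫
            ((pullbackFac w w₀ x hx).app L ≪≫ e).hom) ↔
        (inv ψ ≫ q' = (pullbackCongr hn).inv.app F ≫ (pullbackComp x u).inv.app F ≫
          (Scheme.Modules.pullback x).map q ≫ e.hom) := by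
      have k := pullback_pullbackQuotient h.w φ q hw hx hn
      have k' := congrArg (· ≫ e.hom) k
      simp only [Category.assoc] at k'
      rw [IsIso.inv_comp_eq]
      have r1 : (pullbackCongr hw).inv.app F' ≫ (pullbackComp w u').inv.app F' ≫
          (Scheme.Modules.pullback w).map (pullbackQuotient h.w φ q) ≫
            ((pullbackFac w w₀ x hx).app L ≪≫ e).hom = (pullbackFac w u' v hw).inv.app F' ≫
          (Scheme.Modules.pullback w).map (pullbackQuotient h.w φ q) ≫
            (pullbackFac w w₀ x hx).hom.app L ≫ e.hom := (Category.assoc _ _ _).symm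
      have r2 : ψ ≫ (pullbackCongr hn).inv.app F ≫ (pullbackComp x u).inv.app F ≫
          (Scheme.Modules.pullback x).map q ≫ e.hom = (Scheme.Modules.pullback v).map φ.hom ≫
          (pullbackFac v d (v ≫ d) rfl).hom.app F ≫ (pullbackFac x u (v ≫ d) hn).inv.app F ≫
            (Scheme.Modules.pullback x).map q ≫ e.hom :=
        (Category.assoc _ _ _).trans (congrArg _ (congrArg _ (Category.assoc _ _ _).symm))
      rw [r1, r2, k']
    have hw' : x ≫ u = v ≫ d := hx
    refine ⟨h.lift x v hx, ⟨h.lift_snd _ _ _, (pullbackFac _ w₀ x (h.lift_fst _ _ _)).app L ≪≫ e,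
      (key _ x (h.lift_snd _ _ _) (h.lift_fst _ _ _) hx e).2 he⟩, ?_⟩
    rintro w ⟨hw, e', he'⟩
    have hn : (w ≫ w₀) ≫ u = v ≫ d := by rw [Category.assoc, h.w, reassoc_of% hw]
    refine h.hom_ext ?_ (hw.trans (h.lift_snd _ _ _).symm)
    rw [h.lift_fst]
    refine hxu _ ⟨hn, ((pullbackFac w w₀ _ rfl).app L).symm ≪≫ e', ?_⟩
    refine (key w _ hw rfl hn _).1 ?_
    rw [Iso.self_symm_id_assoc]
    exact he'

/-- The projective bundle of the normal bundle is compatible with flat base change. -/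
lemma IsNormalProjectiveBundle.of_isPullback {A A' : Scheme.{0}} {u : P ⟶ D} {u' : P' ⟶ D'}
    {d : D' ⟶ D} {w₀ : P' ⟶ P} (h : CategoryTheory.IsPullback w₀ u' u d) {i : D ⟶ A} {i' : D' ⟶ A'}
    {a : A' ⟶ A} [Flat a] [IsClosedImmersion i] (h' : CategoryTheory.IsPullback i' d a i)
    (H : IsNormalProjectiveBundle u i) : IsNormalProjectiveBundle u' i' :=
  IsBundleOfQuotientLines.of_isPullback h
    (biprod.mapIso (pullbackUnitIso d).symm (conormalPullbackIso h') ≪≫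
      (haveI := preservesBinaryBiproducts_of_preservesBinaryCoproducts (Scheme.Modules.pullback d)
      (Scheme.Modules.pullback d).mapBiprod (structureModule D) (conormal i)).symm) H

end

end

/-! ### Smooth base change of double point relations -/

section

section BaseChange

variable {W W' A A' B B' : Scheme.{0}} {r : W' ⟶ W} {iA : A ⟶ W} {iB : B ⟶ W} {iA' : A' ⟶ W'}
  {iB' : B' ⟶ W'} {a : A' ⟶ A} {b : B' ⟶ B}

lemma ker_eq_comap_of_isPullback (h : CategoryTheory.IsPullback iA' a r iA) [IsClosedImmersion iA] :
    iA'.ker = iA.ker.comap r := by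
  rw [← Scheme.IdealSheafData.ker_fst_of_isClosedImmersion, ← h.isoPullback_hom_fst,
    Scheme.Hom.ker_comp_of_isIso]

/-- The morphism between the intersections of divisors which is induced by a base change. -/
def intersectionMap (hA : CategoryTheory.IsPullback iA' a r iA)
    (hB : CategoryTheory.IsPullback iB' b r iB) : pullback iA' iB' ⟶ pullback iA iB :=
  pullback.map _ _ _ _ a b r hA.w hB.w

lemma isPullback_intersectionMap (hA : CategoryTheory.IsPullback iA' a r iA)
    (hB : CategoryTheory.IsPullback iB' b r iB) : CategoryTheory.IsPullback (pullback.fst iA' iB')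
      (intersectionMap hA hB) a (pullback.fst iA iB) := by
  have h1 := (IsPullback.of_hasPullback iA' iB').flip.paste_horiz hB.flip
  rw [hA.w] at h1
  have e : intersectionMap hA hB ≫ pullback.snd iA iB = pullback.snd iA' iB' ≫ b :=
    pullback.lift_snd _ _ _
  rw [← e] at h1
  exact (h1.of_right (pullback.lift_fst _ _ _) (IsPullback.of_hasPullback iA iB).flip).flip

lemma isSeparated_toSpecC : IsSeparated P1.toSpecC :=
  inferInstanceAs (IsSeparated (pullback.fst (terminal.from SpecC)
    (terminal.from (Proj (stdGrading 1)))))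

lemma isClosedImmersion_zero : IsClosedImmersion P1.zero := by
  have := isSeparated_toSpecC
  have : IsClosedImmersion (P1.zero ≫ P1.toSpecC) := by
    rw [zero_toSpecC]; infer_instance
  exact IsClosedImmersion.of_comp _ P1.toSpecC

/-- Double point degenerations are stable under smooth base change. -/
lemma IsDoublePointDegeneration.of_isPullback {n k N : ℕ} (hN : N = k + n) {q : W ⟶ SpecC}
    {π : W ⟶ P1} (H : IsDoublePointDegeneration q n π iA iB)
    (hA : CategoryTheory.IsPullback iA' a r iA) (hB : CategoryTheory.IsPullback iB' b r iB)
    (hr : SmoothOfRelativeDimension k r) (hq : IsQuasiProjective (r ≫ q)) :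
    IsDoublePointDegeneration (r ≫ q) N (r ≫ π) iA' iB' := by
  subst hN
  have := H.closedA
  have := H.closedB
  have := H.smooth
  have := H.smoothA
  have := H.smoothB
  have ha : SmoothOfRelativeDimension k a := smooth_of_isPullback k hA hr
  have hb : SmoothOfRelativeDimension k b := smooth_of_isPullback k hB hr
  have hd := smooth_of_isPullback k (isPullback_intersectionMap hA hB) ha
  refine ⟨by rw [Category.assoc, H.comp_toSpecC], smoothOfRelativeDimension_comp k (n + 1) r q, hq,
    MorphismProperty.of_isPullback hA.flip H.closedA,
    MorphismProperty.of_isPullback hB.flip H.closedB, ?_, ?_, ?_, ?_⟩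
  · rw [← Category.assoc, hA.w, Category.assoc]
    exact smoothOfRelativeDimension_comp k n a (iA ≫ q)
  · rw [← Category.assoc, hB.w, Category.assoc]
    exact smoothOfRelativeDimension_comp k n b (iB ≫ q)
  · have := isClosedImmersion_zero
    have hs : Smooth r := SmoothOfRelativeDimension.smooth k r
    rw [Scheme.IdealSheafData.ker_fst_of_isClosedImmersion, Scheme.IdealSheafData.comap_comp,
      ← Scheme.IdealSheafData.ker_fst_of_isClosedImmersion, H.fibre, comap_inf_of_flat,
      ker_eq_comap_of_isPullback hA, ker_eq_comap_of_isPullback hB]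
  · obtain h | ⟨m, hm, h⟩ := H.transverse
    · exact Or.inl (intersectionMap hA hB).base.hom.1.isEmpty
    · refine Or.inr ⟨k + m, by omega, ?_⟩
      have e : pullback.fst iA' iB' ≫ iA' ≫ r ≫ q =
          intersectionMap hA hB ≫ pullback.fst iA iB ≫ iA ≫ q := by
        rw [reassoc_of% hA.w, ← Category.assoc, (isPullback_intersectionMap hA hB).w,
          Category.assoc]
      rw [e]
      exact smoothOfRelativeDimension_comp k m _ _

/-- Regular values of `π` are regular values of `r ≫ π` if `r` is smooth. -/
lemma IsRegularValue.comp_smooth {π : W ⟶ P1} {ζ : SpecC ⟶ P1} (H : IsRegularValue π ζ)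
    [Smooth r] : IsRegularValue (r ≫ π) ζ := by
  obtain ⟨h, U, hU, hs⟩ := H
  refine ⟨h, r ⁻¹ᵁ U, fun x => ?_, ?_⟩
  · let l : pullback (r ≫ π) ζ ⟶ pullback π ζ := pullback.lift (pullback.fst (r ≫ π) ζ ≫ r)
      (pullback.snd (r ≫ π) ζ) (by rw [Category.assoc]; exact pullback.condition)
    have e : l ≫ pullback.fst π ζ = pullback.fst (r ≫ π) ζ ≫ r := pullback.lift_fst _ _ _
    change (pullback.fst (r ≫ π) ζ ≫ r) x ∈ U
    rw [← e]
    exact hU (l x)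
  · have e : (r ⁻¹ᵁ U).ι ≫ r ≫ π = (r ∣_ U) ≫ U.ι ≫ π := by
      rw [← Category.assoc, ← Category.assoc, morphismRestrict_ι]
    rw [e]
    have : Smooth (r ∣_ U) := inferInstance
    infer_instance

end BaseChange

/-- Double point relations are stable under smooth base change: if `W` defines a double point
relation, possibly over another base, then so does every `W'` which is smooth over `W` and
projective over `X × ℙ¹`, with the base changes of the four terms. -/
lemma isDoublePointRelation_of_isPullback {D : BundleKind} {X : Scheme.{0}} {p : X ⟶ SpecC}
    {n k N : ℕ} (hN : N = k + n) {W W' Y A B P : Scheme.{0}} {q : W ⟶ SpecC} {π : W ⟶ P1}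
    {iA : A ⟶ W} {iB : B ⟶ W} {ζ : SpecC ⟶ P1} {j : Y ⟶ W} {y : Y ⟶ SpecC} {u : P ⟶ pullback iA iB}
    (hdeg : IsDoublePointDegeneration q n π iA iB) (hreg : IsRegularValue π ζ)
    (hζ : CategoryTheory.IsPullback j y π ζ) (hP : IsNormalProjectiveBundle u (pullback.fst iA iB))
    {r : W' ⟶ W} (hr : SmoothOfRelativeDimension k r) {g' : W' ⟶ pullback p P1.toSpecC}
    (hg : IsProjective g') (hπ : g' ≫ pullback.snd _ _ = r ≫ π) (hq : IsQuasiProjective (r ≫ q))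
    {Y' A' B' P' : Cycle D p N} {E : D.Obj W'}
    {jY : Y'.Y ⟶ W'} {cY : Y'.Y ⟶ Y} (hY : CategoryTheory.IsPullback jY cY r j)
    {jA : A'.Y ⟶ W'} {cA : A'.Y ⟶ A} (hA : CategoryTheory.IsPullback jA cA r iA)
    {jB : B'.Y ⟶ W'} {cB : B'.Y ⟶ B} (hB : CategoryTheory.IsPullback jB cB r iB)
    {jP : P'.Y ⟶ W'} {cP : P'.Y ⟶ P}
    (hP' : CategoryTheory.IsPullback jP cP r (u ≫ pullback.fst iA iB ≫ iA))
    (rY : Y'.IsRestriction jY (g' ≫ pullback.fst _ _) E)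
    (rA : A'.IsRestriction jA (g' ≫ pullback.fst _ _) E)
    (rB : B'.IsRestriction jB (g' ≫ pullback.fst _ _) E)
    (rP : P'.IsRestriction jP (g' ≫ pullback.fst _ _) E) :
    IsDoublePointRelation Y' A' B' P' := by
  have hs : Smooth r := SmoothOfRelativeDimension.smooth k r
  have := hdeg.closedA
  have := hdeg.closedB
  have e : g' ≫ pullback.fst _ _ ≫ p = r ≫ q := by
    rw [pullback.condition, reassoc_of% hπ, hdeg.comp_toSpecC]
  let d := intersectionMap hA hB
  have hd := isPullback_intersectionMap hA hB
  have hd' : CategoryTheory.IsPullback (pullback.fst jA jB ≫ jA) d r (pullback.fst iA iB ≫ iA) :=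
    hd.paste_horiz hA
  let u' : P'.Y ⟶ pullback jA jB := hd'.lift jP (cP ≫ u) (by rw [hP'.w, Category.assoc])
  have hu₁ : u' ≫ pullback.fst jA jB ≫ jA = jP := hd'.lift_fst _ _ _
  have hu₂ : u' ≫ d = cP ≫ u := hd'.lift_snd _ _ _
  have hu : CategoryTheory.IsPullback cP u' u d := by
    rw [← hu₁] at hP'
    exact (IsPullback.of_right hP' hu₂ hd').flip
  have ha : Smooth cA := smooth_isStableUnderBaseChange.of_isPullback hA hs
  refine ⟨W', E, g', ζ, jY, jA, jB, u', hg, ?_, ?_, ?_, hP.of_isPullback hu hd, rY, rA, rB, ?_⟩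
  · rw [e, hπ]
    exact hdeg.of_isPullback hN hA hB hr hq
  · rw [hπ]
    exact hreg.comp_smooth
  · have e' : Y'.f ≫ p = cY ≫ y := by
      rw [rY.1, Category.assoc, Category.assoc, e, ← hdeg.comp_toSpecC, reassoc_of% hY.w,
        reassoc_of% hζ.w, hreg.1, Category.comp_id]
    rw [hπ, e']
    exact hY.paste_vert hζ
  · rw [hu₁]
    exact rP

end

/-! ### Products of cycles -/

section

variable {D : BundleKind} {X : Scheme.{0}} {p : X ⟶ SpecC} {n m k : ℕ}

lemma isProjective_of_isIso {Y S : Scheme.{0}} (f : Y ⟶ S) [IsIso f] : IsProjective f :=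
  IsProjective.of_isPullback (g' := f) (g := 𝟙 S) (IsPullback.of_vert_isIso ⟨by simp⟩)
    (isProjective_id S)

lemma Cycle.smooth_point (z : Cycle noBundle (𝟙 SpecC) n) : SmoothOfRelativeDimension n z.f := by
  have := z.smooth
  rwa [Category.comp_id] at this

section Product

variable (hD : D.IsGeometric) (hk : n + m = k)

/-- The product `Z × Y` of cycles, with the bundle data pulled back from `Y`. -/
def productCycle (z : Cycle noBundle (𝟙 SpecC) n) (y : Cycle D p m) : Cycle D p k where
  Y := pullback z.f (y.f ≫ p)
  f := pullback.snd _ _ ≫ y.f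
  smooth := by
    subst hk
    have := y.smooth
    have : SmoothOfRelativeDimension n (pullback.snd z.f (y.f ≫ p)) :=
      smooth_of_isPullback n (IsPullback.of_hasPullback _ _) z.smooth_point
    rw [Category.assoc]
    exact smoothOfRelativeDimension_comp n m _ _
  quasiProjective := by
    rw [Category.assoc]
    exact y.quasiProjective.comp_isProjective
      (.of_isPullback (IsPullback.of_hasPullback _ _) z.projective)
  projective := y.projective.comp (.of_isPullback (IsPullback.of_hasPullback _ _) z.projective)
  E := (hD.exists_pullback (pullback.snd z.f (y.f ≫ p)) y.E).choose

lemma isRestriction_productCycle (z : Cycle noBundle (𝟙 SpecC) n) (y : Cycle D p m) :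
    (productCycle hD hk z y).IsRestriction (pullback.snd z.f (y.f ≫ p)) y.f y.E :=
  ⟨rfl, (hD.exists_pullback (pullback.snd z.f (y.f ≫ p)) y.E).choose_spec⟩

lemma isProduct_productCycle (z : Cycle noBundle (𝟙 SpecC) n) (y : Cycle D p m) :
    (productCycle hD hk z y).IsProduct z y :=
  ⟨_, _, IsPullback.of_hasPullback _ _, isRestriction_productCycle hD hk z y⟩

end Product

section Functoriality

/-- The map to `X` and the bundle data of a product `Z × Y`, along a morphism which covers a
morphism of the second factor. -/
lemma Cycle.IsRestriction.of_comp_eq (hD : D.IsGeometric) {c : Cycle D p k} {y : Cycle D p m}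
    {p₂ : c.Y ⟶ y.Y} (r : c.IsRestriction p₂ y.f y.E) {V W : Scheme.{0}} {b : y.Y ⟶ V} {g : V ⟶ X}
    {F : D.Obj V} (hb : y.IsRestriction b g F) {q : W ⟶ V} {E : D.Obj W} (hE : D.IsPullback q E F)
    {j : c.Y ⟶ W} (hj : j ≫ q = p₂ ≫ b) : c.IsRestriction j (q ≫ g) E := by
  refine ⟨by rw [r.1, hb.1, reassoc_of% hj], hD.cancel (j := q) (E := F) ?_ hE⟩
  rw [hj]
  exact hD.comp r.2 hb.2

variable {z : Cycle noBundle (𝟙 SpecC) n} {y : Cycle D p m} {c : Cycle D p k} {p₁ : c.Y ⟶ z.Y}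
  {p₂ : c.Y ⟶ y.Y} (h : CategoryTheory.IsPullback p₁ p₂ z.f (y.f ≫ p))
include h

/-- A product `Z × Y` is the base change along `Z ⟶ T` of any product `T × Y`. -/
lemma exists_isPullback_left {T W : Scheme.{0}} {f : T ⟶ SpecC} {a : z.Y ⟶ T} (ha : a ≫ f = z.f)
    {q₁ : W ⟶ T} {q₂ : W ⟶ y.Y} (hW : CategoryTheory.IsPullback q₁ q₂ f (y.f ≫ p)) :
    ∃ j : c.Y ⟶ W, j ≫ q₂ = p₂ ∧ CategoryTheory.IsPullback j p₁ q₁ a := by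
  have hw : (p₁ ≫ a) ≫ f = p₂ ≫ y.f ≫ p := by rw [Category.assoc, ha, h.w]
  have e := hW.lift_snd _ _ hw
  refine ⟨hW.lift _ _ hw, e, ?_⟩
  have h' := h.flip
  rw [← e, ← ha] at h'
  exact IsPullback.of_right h' (hW.lift_fst _ _ hw) hW.flip

/-- A product `Z × Y` is the base change along `Y ⟶ T` of any product `Z × T`. -/
lemma exists_isPullback_right {T W : Scheme.{0}} {f : T ⟶ SpecC} {b : y.Y ⟶ T}
    (hb : b ≫ f = y.f ≫ p) {q₁ : W ⟶ z.Y} {q₂ : W ⟶ T}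
    (hW : CategoryTheory.IsPullback q₁ q₂ z.f f) :
    ∃ j : c.Y ⟶ W, j ≫ q₂ = p₂ ≫ b ∧ CategoryTheory.IsPullback j p₂ q₂ b := by
  have hw : p₁ ≫ z.f = (p₂ ≫ b) ≫ f := by rw [Category.assoc, hb, h.w]
  have e := hW.lift_fst _ _ hw
  refine ⟨hW.lift _ _ hw, hW.lift_snd _ _ hw, ?_⟩
  rw [← e, ← hb] at h
  exact IsPullback.of_right h (hW.lift_snd _ _ hw) hW

end Functoriality

section Relations

variable {z z₁ z₂ : Cycle noBundle (𝟙 SpecC) n} {y y₁ y₂ : Cycle D p m}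
  {c c₁ c₂ : Cycle D p k}

/-- Products are unique up to isomorphism. -/
lemma Cycle.IsProduct.isIsomorphic (hD : D.IsGeometric)
    (h₁ : c₁.IsProduct z₁ y₁) (h₂ : c₂.IsProduct z₂ y₂)
    (hz : z₁.IsIsomorphic z₂) (hy : y₁.IsIsomorphic y₂) : c₁.IsIsomorphic c₂ := by
  obtain ⟨p₁, p₂, h, r⟩ := h₁
  obtain ⟨q₁, q₂, h', r'⟩ := h₂
  obtain ⟨φ, hφ, -⟩ := hz
  obtain ⟨ψ, hψ⟩ := hy
  have h₂ : CategoryTheory.IsPullback (p₁ ≫ φ.hom) (p₂ ≫ ψ.hom) z₂.f (y₂.f ≫ p) := by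
    refine IsPullback.of_iso h (Iso.refl _) φ ψ (Iso.refl _) (by simp) (by simp) ?_ ?_
    · rw [hφ]; simp
    · rw [hψ.1]; simp
  refine ⟨h₂.isoIsPullback _ _ h', ?_⟩
  have := r.of_comp_eq hD hψ r'.2 (h₂.isoIsPullback_hom_snd _ _ h')
  rwa [← r'.1] at this

/-- Products distribute over disjoint unions, as coproducts of schemes are universal. -/
lemma Cycle.IsProduct.isDisjointUnion_left (hD : D.IsGeometric) (h : c.IsProduct z y)
    (h₁ : c₁.IsProduct z₁ y) (h₂ : c₂.IsProduct z₂ y) (H : z.IsDisjointUnion z₁ z₂) :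
    c.IsDisjointUnion c₁ c₂ := by
  obtain ⟨p₁, p₂, h, r⟩ := h
  obtain ⟨q₁, q₂, h₁, r₁⟩ := h₁
  obtain ⟨q₁', q₂', h₂, r₂⟩ := h₂
  obtain ⟨i, j, ⟨hij⟩, hi, hj⟩ := H
  obtain ⟨k₁, e₁, hk₁⟩ := exists_isPullback_left h₁ hi.1.symm h
  obtain ⟨k₂, e₂, hk₂⟩ := exists_isPullback_left h₂ hj.1.symm h
  have hy : y.IsRestriction (𝟙 _) y.f y.E := ⟨(Category.id_comp _).symm, hD.id _⟩
  refine ⟨k₁, k₂, ((BinaryCofan.isVanKampen_iff _).1 (FinitaryExtensive.vanKampen _ hij)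
    (BinaryCofan.mk k₁ k₂) q₁ q₁' p₁ hk₁.w.symm hk₂.w.symm).2 ⟨hk₁, hk₂⟩, ?_, ?_⟩
  · have := r₁.of_comp_eq hD hy r.2 (e₁.trans (Category.comp_id _).symm)
    rwa [← r.1] at this
  · have := r₂.of_comp_eq hD hy r.2 (e₂.trans (Category.comp_id _).symm)
    rwa [← r.1] at this

lemma Cycle.IsProduct.isDisjointUnion_right (hD : D.IsGeometric) (h : c.IsProduct z y)
    (h₁ : c₁.IsProduct z y₁) (h₂ : c₂.IsProduct z y₂) (H : y.IsDisjointUnion y₁ y₂) :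
    c.IsDisjointUnion c₁ c₂ := by
  obtain ⟨p₁, p₂, h, r⟩ := h
  obtain ⟨q₁, q₂, h₁, r₁⟩ := h₁
  obtain ⟨q₁', q₂', h₂, r₂⟩ := h₂
  obtain ⟨i, j, ⟨hij⟩, hi, hj⟩ := H
  obtain ⟨k₁, e₁, hk₁⟩ := exists_isPullback_right h₁ (b := i) (by rw [hi.1, Category.assoc]) h
  obtain ⟨k₂, e₂, hk₂⟩ := exists_isPullback_right h₂ (b := j) (by rw [hj.1, Category.assoc]) h
  refine ⟨k₁, k₂, ((BinaryCofan.isVanKampen_iff _).1 (FinitaryExtensive.vanKampen _ hij)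
    (BinaryCofan.mk k₁ k₂) q₂ q₂' p₂ hk₁.w.symm hk₂.w.symm).2 ⟨hk₁, hk₂⟩, ?_, ?_⟩
  · have := r₁.of_comp_eq hD hi r.2 e₁
    rwa [← r.1] at this
  · have := r₂.of_comp_eq hD hj r.2 e₂
    rwa [← r.1] at this

/-- The product of a cycle over the point with a double point relation is a double point relation,
by smooth base change along `Z × W ⟶ W`. -/
lemma IsDoublePointRelation.product_right (hD : D.IsGeometric) {Yζ A B P : Cycle D p m}
    {Yζ' A' B' P' : Cycle D p k}
    (hk : n + m = k) (hY : Yζ'.IsProduct z Yζ) (hA : A'.IsProduct z A) (hB : B'.IsProduct z B)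
    (hP : P'.IsProduct z P) (H : IsDoublePointRelation Yζ A B P) :
    IsDoublePointRelation Yζ' A' B' P' := by
  obtain ⟨W, E, g, ζ, jζ, iA, iB, u, hg, hdeg, hreg, hζ, hN, rY, rA, rB, rP⟩ := H
  let q := g ≫ pullback.fst p P1.toSpecC ≫ p
  have hW := IsPullback.of_hasPullback z.f q
  obtain ⟨E', hE⟩ := hD.exists_pullback (pullback.snd z.f q) E
  have hr : SmoothOfRelativeDimension n (pullback.snd z.f q) :=
    smooth_of_isPullback n hW z.smooth_point
  have hr' : IsProjective (pullback.snd z.f q) := .of_isPullback hW z.projective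
  have key {c : Cycle D p m} {c' : Cycle D p k} (h : c'.IsProduct z c) {j : c.Y ⟶ W}
      (r : c.IsRestriction j (g ≫ pullback.fst _ _) E) :
      ∃ (j' : c'.Y ⟶ pullback z.f q) (p₂ : c'.Y ⟶ c.Y),
        CategoryTheory.IsPullback j' p₂ (pullback.snd z.f q) j ∧
        c'.IsRestriction j' ((pullback.snd z.f q ≫ g) ≫ pullback.fst _ _) E' := by
    obtain ⟨p₁, p₂, h, r'⟩ := h
    obtain ⟨j', e, hj⟩ := exists_isPullback_right h (b := j) (by rw [r.1]; simp [q]) hW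
    refine ⟨j', p₂, hj, ?_⟩
    rw [Category.assoc]
    exact r'.of_comp_eq hD r hE e
  obtain ⟨j₁, p₁, h₁, r₁⟩ := key hY rY
  obtain ⟨j₂, p₂, h₂, r₂⟩ := key hA rA
  obtain ⟨j₃, p₃, h₃, r₃⟩ := key hB rB
  obtain ⟨j₄, p₄, h₄, r₄⟩ := key hP rP
  exact isDoublePointRelation_of_isPullback hk.symm hdeg hreg hζ hN hr (hg.comp hr')
    (Category.assoc _ _ _) (hdeg.quasiProjective.comp_isProjective hr') h₁ h₂ h₃ h₄ r₁ r₂ r₃ r₄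

/-- If `W ⟶ ℙ¹` and `Y ⟶ X` are projective, then so is `W × Y ⟶ X × ℙ¹`, as the composition of
base changes of these morphisms. -/
lemma exists_isProjective_lift {W V Y : Scheme.{0}} {π : W ⟶ P1} {f : Y ⟶ X} {q₁ : V ⟶ W}
    {q₂ : V ⟶ Y} {q : W ⟶ SpecC} (hq : q = π ≫ P1.toSpecC)
    (hV : CategoryTheory.IsPullback q₁ q₂ q (f ≫ p))
    (hπ : IsProjective π) (hf : IsProjective f) :
    ∃ g : V ⟶ pullback p P1.toSpecC, IsProjective g ∧ g ≫ pullback.fst _ _ = q₂ ≫ f ∧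
      g ≫ pullback.snd _ _ = q₁ ≫ π := by
  subst hq
  have hY := IsPullback.of_hasPullback (f ≫ p) P1.toSpecC
  have hX := IsPullback.of_hasPullback p P1.toSpecC
  have hw : q₂ ≫ f ≫ p = (q₁ ≫ π) ≫ P1.toSpecC := by rw [Category.assoc, hV.w]
  have hw' : (pullback.fst (f ≫ p) P1.toSpecC ≫ f) ≫ p =
      pullback.snd (f ≫ p) P1.toSpecC ≫ P1.toSpecC := by rw [Category.assoc, hY.w]
  let g₁ := hY.lift _ _ hw
  let g₂ := hX.lift _ _ hw'
  have h₁ : g₁ ≫ pullback.fst _ _ = q₂ := hY.lift_fst _ _ hw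
  have h₁' : g₁ ≫ pullback.snd _ _ = q₁ ≫ π := hY.lift_snd _ _ hw
  have h₂ : g₂ ≫ pullback.fst _ _ = pullback.fst _ _ ≫ f := hX.lift_fst _ _ hw'
  have h₂' : g₂ ≫ pullback.snd _ _ = pullback.snd _ _ := hX.lift_snd _ _ hw'
  have hg₁ : IsProjective g₁ := by
    refine .of_isPullback (f := π) (g' := q₁) (g := pullback.snd (f ≫ p) P1.toSpecC) ?_ hπ
    have h := hV.flip
    rw [← h₁] at h
    exact (IsPullback.of_right h h₁' hY).flip
  have hg₂ : IsProjective g₂ := by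
    refine .of_isPullback (f := f) (g' := pullback.fst (f ≫ p) P1.toSpecC)
      (g := pullback.fst p P1.toSpecC) ?_ hf
    have h := hY.flip
    rw [← h₂'] at h
    exact (IsPullback.of_right h.flip.flip h₂ hX.flip).flip
  refine ⟨g₁ ≫ g₂, hg₂.comp hg₁, ?_, ?_⟩
  · rw [Category.assoc, h₂, reassoc_of% h₁]
  · rw [Category.assoc, h₂', h₁']

/-- The product of a double point relation over the point with a cycle is a double point relation,
by smooth base change along `W × Y ⟶ W`. -/
lemma IsDoublePointRelation.product_left (hD : D.IsGeometric)
    {Yζ A B P : Cycle noBundle (𝟙 SpecC) n}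
    {Yζ' A' B' P' : Cycle D p k} (hk : n + m = k) (hY : Yζ'.IsProduct Yζ y)
    (hA : A'.IsProduct A y) (hB : B'.IsProduct B y) (hP : P'.IsProduct P y)
    (H : IsDoublePointRelation Yζ A B P) : IsDoublePointRelation Yζ' A' B' P' := by
  obtain ⟨W, E, g, ζ, jζ, iA, iB, u, hg, hdeg, hreg, hζ, hN, rY, rA, rB, rP⟩ := H
  let π := g ≫ pullback.snd (𝟙 SpecC) P1.toSpecC
  let q := g ≫ pullback.fst (𝟙 SpecC) P1.toSpecC ≫ 𝟙 SpecC
  have hW := IsPullback.of_hasPullback q (y.f ≫ p)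
  obtain ⟨E', hE⟩ := hD.exists_pullback (pullback.snd q (y.f ≫ p)) y.E
  have hr : SmoothOfRelativeDimension m (pullback.fst q (y.f ≫ p)) :=
    smooth_of_isPullback m hW.flip y.smooth
  -- The projection of `Spec ℂ × ℙ¹` to `ℙ¹` is an isomorphism. Hence `W` is projective over `ℂ`.
  have hπ : IsProjective π := (isProjective_of_isIso _).comp hg
  have hq : q = π ≫ P1.toSpecC := hdeg.comp_toSpecC.symm
  have hq' : IsProjective q := by
    rw [hq]
    exact (isProjective_toBase 1 SpecC).comp hπ
  have hr' : IsProjective (pullback.snd q (y.f ≫ p)) := .of_isPullback hW hq'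
  obtain ⟨g', hg', hg₁, hg₂⟩ := exists_isProjective_lift hq hW hπ y.projective
  have key {c : Cycle noBundle (𝟙 SpecC) n} {c' : Cycle D p k} (h : c'.IsProduct c y)
      {j : c.Y ⟶ W} (r : c.f = j ≫ g ≫ pullback.fst _ _) :
      ∃ (j' : c'.Y ⟶ pullback q (y.f ≫ p)) (p₁ : c'.Y ⟶ c.Y),
        CategoryTheory.IsPullback j' p₁ (pullback.fst q (y.f ≫ p)) j ∧
        c'.IsRestriction j' (g' ≫ pullback.fst _ _) E' := by
    obtain ⟨p₁, p₂, h, r'⟩ := h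
    obtain ⟨j', e, hj⟩ := exists_isPullback_left h (a := j) (by rw [r]; simp [q]) hW
    refine ⟨j', p₁, hj, ?_⟩
    rw [hg₁]
    exact r'.of_comp_eq hD ⟨(Category.id_comp _).symm, hD.id _⟩ hE
      (e.trans (Category.comp_id _).symm)
  obtain ⟨j₁, p₁, h₁, r₁⟩ := key hY rY.1
  obtain ⟨j₂, p₂, h₂, r₂⟩ := key hA rA.1
  obtain ⟨j₃, p₃, h₃, r₃⟩ := key hB rB.1
  obtain ⟨j₄, p₄, h₄, r₄⟩ := key hP rP.1
  have hqp : IsQuasiProjective (pullback.fst q (y.f ≫ p) ≫ q) := by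
    rw [pullback.condition]
    exact y.quasiProjective.comp_isProjective hr'
  exact isDoublePointRelation_of_isPullback (by omega) hdeg hreg hζ hN hr hg' hg₂ hqp h₁ h₂ h₃ h₄
    r₁ r₂ r₃ r₄

end Relations

end

/-! ### The product on cobordism groups -/

section

variable {D : BundleKind} {X : Scheme.{0}} {p : X ⟶ SpecC} {n m k : ℕ}

lemma CobordismGroup.induction {P : CobordismGroup D p n → Prop} (h : ∀ c : Cycle D p n, P c.class)
    (zero : P 0) (add : ∀ x y, P x → P y → P (x + y)) (neg : ∀ x, P x → P (-x)) (x) : P x := by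
  let S := AddSubgroup.closure (Set.range (Cycle.class : Cycle D p n → _))
  have hS : QuotientAddGroup.mk' S = 0 := CobordismGroup.hom_ext fun c =>
    (QuotientAddGroup.eq_zero_iff _).2 (AddSubgroup.subset_closure ⟨c, rfl⟩)
  have hx : x ∈ S := (QuotientAddGroup.eq_zero_iff _).1 (DFunLike.congr_fun hS x)
  induction hx using AddSubgroup.closure_induction with
  | mem x hx => obtain ⟨c, rfl⟩ := hx; exact h c
  | zero => exact zero
  | add x y _ _ hx hy => exact add x y hx hy
  | neg x _ hx => exact neg x hx

lemma Cycle.IsIsomorphic.refl (hD : D.IsGeometric) (c : Cycle D p n) : c.IsIsomorphic c :=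
  ⟨Iso.refl _, (Category.id_comp _).symm, hD.id _⟩

section Pairing

variable (hD : D.IsGeometric) (hk : n + m = k)

/-- Multiplication by a cycle over the point. -/
def productHom (z : Cycle noBundle (𝟙 SpecC) n) : CobordismGroup D p m →+ CobordismGroup D p k :=
  CobordismGroup.lift (fun y => (productCycle hD hk z y).class)
    (fun a b h => ((isProduct_productCycle hD hk z a).isIsomorphic hD
      (isProduct_productCycle hD hk z b) (.refl isGeometric_noBundle z) h).class_eq)
    (fun c a b h => ((isProduct_productCycle hD hk z c).isDisjointUnion_right hD
      (isProduct_productCycle hD hk z a) (isProduct_productCycle hD hk z b) h).class_eq)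
    (fun c _ => Cycle.class_of_isEmpty _ (pullback.snd z.f (c.f ≫ p)).base.hom.1.isEmpty)
    (fun Yζ A B P h => (h.product_right hD hk (isProduct_productCycle hD hk z Yζ)
      (isProduct_productCycle hD hk z A) (isProduct_productCycle hD hk z B)
      (isProduct_productCycle hD hk z P)).class_eq)

lemma productHom_class (z : Cycle noBundle (𝟙 SpecC) n) (y : Cycle D p m) :
    productHom hD hk z y.class = (productCycle hD hk z y).class :=
  CobordismGroup.lift_class ..

/-- The pairing `[Z] · [Y ⟶ X, E] = [Z × Y ⟶ Y ⟶ X, pr₂^* E]` of cobordism groups. -/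
def pairing : PointCobordism n →+ CobordismGroup D p m →+ CobordismGroup D p k :=
  CobordismGroup.lift (productHom hD hk)
    (fun a b h => CobordismGroup.hom_ext fun c => by
      rw [productHom_class, productHom_class]
      exact ((isProduct_productCycle hD hk a c).isIsomorphic hD
        (isProduct_productCycle hD hk b c) h (.refl hD c)).class_eq)
    (fun c a b h => CobordismGroup.hom_ext fun d => by
      rw [AddMonoidHom.add_apply, productHom_class, productHom_class, productHom_class]
      exact ((isProduct_productCycle hD hk c d).isDisjointUnion_left hD
        (isProduct_productCycle hD hk a d) (isProduct_productCycle hD hk b d) h).class_eq)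
    (fun c _ => CobordismGroup.hom_ext fun d => by
      rw [productHom_class]
      exact Cycle.class_of_isEmpty _ (pullback.fst c.f (d.f ≫ p)).base.hom.1.isEmpty)
    (fun Yζ A B P h => CobordismGroup.hom_ext fun d => by
      rw [AddMonoidHom.add_apply, AddMonoidHom.sub_apply, AddMonoidHom.sub_apply, productHom_class,
        productHom_class, productHom_class, productHom_class]
      exact (h.product_left hD hk (isProduct_productCycle hD hk Yζ d)
        (isProduct_productCycle hD hk A d) (isProduct_productCycle hD hk B d)
        (isProduct_productCycle hD hk P d)).class_eq)

variable {z : Cycle noBundle (𝟙 SpecC) n} {y : Cycle D p m} {c : Cycle D p k}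

lemma pairing_class (h : c.IsProduct z y) : pairing hD hk z.class y.class = c.class := by
  refine (DFunLike.congr_fun (CobordismGroup.lift_class ..) _).trans ?_
  rw [productHom_class]
  exact ((isProduct_productCycle hD hk z y).isIsomorphic hD h (.refl isGeometric_noBundle z)
    (.refl hD y)).class_eq

end Pairing

/-- The point, as a cycle over itself. -/
def pointCycle : Cycle noBundle (𝟙 SpecC) 0 where
  Y := SpecC
  f := 𝟙 SpecC
  smooth := by
    rw [Category.comp_id]
    infer_instance
  quasiProjective := by
    rw [Category.comp_id]
    exact (isProjective_id _).isQuasiProjective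
  projective := isProjective_id _
  E := ⟨⟩

lemma isProduct_pointCycle (hD : D.IsGeometric) (y : Cycle D p n) : y.IsProduct pointCycle y :=
  ⟨y.f ≫ p, 𝟙 _, IsPullback.id_vert (y.f ≫ p), (Category.id_comp _).symm, hD.id _⟩

lemma Cycle.IsProduct.comm {z : Cycle noBundle (𝟙 SpecC) n} {z' : Cycle noBundle (𝟙 SpecC) m}
    {c : Cycle noBundle (𝟙 SpecC) k} (h : c.IsProduct z z') : c.IsProduct z' z := by
  obtain ⟨p₁, p₂, h, r⟩ := h
  refine ⟨p₂, p₁, ?_, ?_, trivial⟩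
  · rw [Category.comp_id] at h ⊢
    exact h.flip
  · rw [Category.comp_id] at h
    rw [r.1, h.w]

/-- Associativity of products: `(Z × Z') × Y` is a product of `Z` with `Z' × Y`. -/
lemma Cycle.IsProduct.assoc (hD : D.IsGeometric) {l N : ℕ} {z : Cycle noBundle (𝟙 SpecC) n}
    {z' : Cycle noBundle (𝟙 SpecC) m} {y : Cycle D p k} {c : Cycle noBundle (𝟙 SpecC) l}
    {e : Cycle D p N} (h : c.IsProduct z z') {l' : ℕ} {d : Cycle D p l'} (h' : d.IsProduct z' y)
    (H : e.IsProduct c y) : e.IsProduct z d := by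
  obtain ⟨p₁, p₂, h, r⟩ := h
  obtain ⟨q₁, q₂, h', r'⟩ := h'
  obtain ⟨t₁, t₂, H, R⟩ := H
  rw [Category.comp_id] at h
  have hw : (t₁ ≫ p₂) ≫ z'.f = t₂ ≫ y.f ≫ p := by rw [← H.w, r.1, Category.assoc]
  have e₁ := h'.lift_fst _ _ hw
  have e₂ := h'.lift_snd _ _ hw
  refine ⟨t₁ ≫ p₁, h'.lift _ _ hw, ?_, ?_⟩
  · have h₁ : CategoryTheory.IsPullback (h'.lift _ _ hw) t₁ q₁ p₂ := by
      have H' := H.flip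
      rw [← e₂, r.1] at H'
      exact IsPullback.of_right H' e₁ h'.flip
    have h₂ := h₁.flip.paste_horiz h
    rwa [h'.w, ← Category.assoc, ← r'.1] at h₂
  · have := R.of_comp_eq hD ⟨(Category.id_comp _).symm, hD.id _⟩ r'.2
      (e₂.trans (Category.comp_id _).symm)
    rwa [← r'.1] at this

end

/-! ### Ring and module structures -/

section

variable {D D' : BundleKind} {X : Scheme.{0}} {p : X ⟶ SpecC}

lemma pairing_point (hD : D.IsGeometric) {n : ℕ} (hn : 0 + n = n) (x : CobordismGroup D p n) :
    pairing hD hn pointCycle.class x = x := by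
  have : pairing hD hn pointCycle.class = AddMonoidHom.id (CobordismGroup D p n) :=
    CobordismGroup.hom_ext fun y => pairing_class hD hn (isProduct_pointCycle hD y)
  exact DFunLike.congr_fun this x

lemma pairing_comm {n m k : ℕ} (h : n + m = k) (h' : m + n = k) (x : PointCobordism n)
    (y : PointCobordism m) :
    pairing isGeometric_noBundle h x y =
      (pairing isGeometric_noBundle h' y x : PointCobordism k) := by
  have : pairing isGeometric_noBundle h =
      (pairing isGeometric_noBundle h' : _ →+ _ →+ PointCobordism k).flip :=
    CobordismGroup.hom_ext fun a => CobordismGroup.hom_ext fun b => by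
      have H := isProduct_productCycle isGeometric_noBundle h a b
      rw [pairing_class _ _ H, AddMonoidHom.flip_apply, pairing_class _ _ H.comm]
  exact congr($this x y)

lemma pairing_assoc (hD : D.IsGeometric) {n m k a b N : ℕ} (h₁ : n + m = a) (h₂ : a + k = N)
    (h₃ : m + k = b) (h₄ : n + b = N) (x : PointCobordism n) (y : PointCobordism m)
    (w : CobordismGroup D p k) :
    pairing hD h₂ (pairing isGeometric_noBundle h₁ x y) w =
      pairing hD h₄ x (pairing hD h₃ y w) := by
  induction x using CobordismGroup.induction with
  | zero => simp only [map_zero, AddMonoidHom.zero_apply]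
  | add x₁ x₂ e₁ e₂ => simp only [map_add, AddMonoidHom.add_apply, e₁, e₂]
  | neg x₁ e₁ => simp only [map_neg, AddMonoidHom.neg_apply, e₁]
  | h x => ?_
  induction y using CobordismGroup.induction with
  | zero => simp only [map_zero, AddMonoidHom.zero_apply]
  | add x₁ x₂ e₁ e₂ => simp only [map_add, AddMonoidHom.add_apply, e₁, e₂]
  | neg x₁ e₁ => simp only [map_neg, AddMonoidHom.neg_apply, e₁]
  | h y => ?_
  induction w using CobordismGroup.induction with
  | zero => simp only [map_zero]
  | add x₁ x₂ e₁ e₂ => simp only [map_add, e₁, e₂]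
  | neg x₁ e₁ => simp only [map_neg, e₁]
  | h w => ?_
  have H₁ := isProduct_productCycle isGeometric_noBundle h₁ x y
  have H₂ := isProduct_productCycle hD h₂ (productCycle isGeometric_noBundle h₁ x y) w
  have H₃ := isProduct_productCycle hD h₃ y w
  rw [pairing_class _ _ H₁, pairing_class _ _ H₂, pairing_class _ _ H₃,
    pairing_class _ _ (H₁.assoc hD H₃ H₂)]

/-- The degree `k` of a product matters only up to propositional equality; this turns identities of
the pairing into identities of graded monoids. -/
lemma gradedMonoid_mk_pairing (hD : D.IsGeometric) {n m k k' : ℕ} (h : n + m = k) (h' : n + m = k')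
    (x : PointCobordism n) (y : CobordismGroup D p m) :
    GradedMonoid.mk k (pairing hD h x y) = GradedMonoid.mk k' (pairing hD h' x y) := by
  subst h; subst h'; rfl

lemma mk_pairing_point (hD : D.IsGeometric) {n : ℕ} (x : CobordismGroup D p n) :
    GradedMonoid.mk (0 + n) (pairing hD rfl pointCycle.class x) = GradedMonoid.mk n x := by
  rw [gradedMonoid_mk_pairing hD rfl (zero_add n), pairing_point]

lemma mk_pairing_comm {n m : ℕ} (x : PointCobordism n) (y : PointCobordism m) :
    GradedMonoid.mk (n + m) (pairing isGeometric_noBundle rfl x y : PointCobordism (n + m)) =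
      GradedMonoid.mk (m + n) (pairing isGeometric_noBundle rfl y x : PointCobordism (m + n)) := by
  rw [gradedMonoid_mk_pairing _ rfl (add_comm n m), pairing_comm _ rfl]

lemma mk_pairing_assoc (hD : D.IsGeometric) {n m k : ℕ} (x : PointCobordism n)
    (y : PointCobordism m) (w : CobordismGroup D p k) :
    GradedMonoid.mk (n + m + k) (pairing hD rfl (pairing isGeometric_noBundle rfl x y) w) =
      GradedMonoid.mk (n + (m + k)) (pairing hD rfl x (pairing hD rfl y w)) := by
  rw [gradedMonoid_mk_pairing hD rfl (add_assoc n m k), pairing_assoc hD rfl _ rfl rfl]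

/-- The unit of the cobordism ring, the class of the point. -/
abbrev gOnePointCobordism : GradedMonoid.GOne PointCobordism where
  one := pointCycle.class

attribute [local instance] gOnePointCobordism

/-- The multiplication of the cobordism ring, by products of cycles. -/
abbrev gMulPointCobordism : GradedMonoid.GMul PointCobordism where
  mul x y := pairing isGeometric_noBundle rfl x y

attribute [local instance] gMulPointCobordism

/-- The multiplicative structure of the cobordism ring. -/
abbrev gMonoidPointCobordism : GradedMonoid.GMonoid PointCobordism where
  one_mul x := mk_pairing_point isGeometric_noBundle x.2
  mul_one x := (mk_pairing_comm _ _).trans (mk_pairing_point isGeometric_noBundle x.2)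
  mul_assoc x y w := mk_pairing_assoc isGeometric_noBundle x.2 y.2 w.2

attribute [local instance] gMonoidPointCobordism

/-- The cobordism ring of the point. -/
abbrev gCommRingPointCobordism : DirectSum.GCommRing PointCobordism where
  __ := gMonoidPointCobordism
  mul_zero _ := map_zero _
  zero_mul x := DFunLike.congr_fun (map_zero (pairing isGeometric_noBundle rfl)) x
  mul_add _ _ _ := map_add _ _ _
  add_mul _ _ x := DFunLike.congr_fun (map_add (pairing isGeometric_noBundle rfl) _ _) x
  mul_comm x y := mk_pairing_comm x.2 y.2
  natCast n := n • pointCycle.class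
  natCast_zero := zero_smul _ _
  natCast_succ _ := succ_nsmul _ _
  intCast n := n • pointCycle.class
  intCast_ofNat _ := natCast_zsmul _ _
  intCast_negSucc_ofNat _ := negSucc_zsmul _ _

attribute [local instance] gCommRingPointCobordism

/-- The action of the cobordism ring of the point by products of cycles. -/
abbrev gmoduleCobordismGroup (hD : D.IsGeometric) (p : X ⟶ SpecC) :
    DirectSum.Gmodule PointCobordism (CobordismGroup D p) where
  smul x y := pairing hD rfl x y
  smul_zero _ := map_zero _
  zero_smul x := DFunLike.congr_fun (map_zero (pairing hD rfl)) x
  smul_add _ _ _ := map_add _ _ _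
  add_smul _ _ x := DFunLike.congr_fun (map_add (pairing hD rfl) _ _) x
  one_smul x := mk_pairing_point hD x.2
  mul_smul x y w := mk_pairing_assoc hD x.2 y.2 w.2

lemma mulIsProduct : MulIsProduct := by
  intro n m z z'
  have H := isProduct_productCycle isGeometric_noBundle rfl z z'
  refine ⟨_, H, ?_⟩
  rw [Cycle.cobordismClass_eq, Cycle.cobordismClass_eq, Cycle.cobordismClass_eq,
    DirectSum.of_mul_of, ← pairing_class isGeometric_noBundle rfl H]
  rfl

lemma cobordismClass_smul (hD : D.IsGeometric) {n m : ℕ} {z : Cycle noBundle (𝟙 SpecC) n}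
    {y : Cycle D p m} {c : Cycle D p (n + m)} (h : c.IsProduct z y) :
    letI := gmoduleCobordismGroup hD p
    z.cobordismClass • y.cobordismClass = c.cobordismClass := by
  let := gmoduleCobordismGroup hD p
  rw [Cycle.cobordismClass_eq, Cycle.cobordismClass_eq, Cycle.cobordismClass_eq,
    DirectSum.Gmodule.of_smul_of, ← pairing_class hD rfl h]
  rfl

lemma actionIsProduct (hD : D.IsGeometric) (p : X ⟶ SpecC) :
    letI := gmoduleCobordismGroup hD p
    ActionIsProduct D p := by
  intro n m z y
  have H := isProduct_productCycle hD rfl z y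
  exact ⟨_, H, cobordismClass_smul hD H⟩

/-- Operations on bundle data induce linear maps of cobordism groups. -/
lemma TotalCobordism.map_smul (hD : D.IsGeometric) (hD' : D'.IsGeometric) (F : BundleKind.Hom D D')
    (a : DirectSum ℕ PointCobordism) (x : TotalCobordism D p) :
    letI := gmoduleCobordismGroup hD p
    letI := gmoduleCobordismGroup hD' p
    TotalCobordism.map p F (a • x) = a • TotalCobordism.map p F x := by
  let := gmoduleCobordismGroup hD p
  let := gmoduleCobordismGroup hD' p
  let f : DirectSum ℕ PointCobordism →+ TotalCobordism D p →+ TotalCobordism D' p :=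
    AddMonoidHom.mk' (fun a => (TotalCobordism.map p F).comp (DistribSMul.toAddMonoidHom _ a))
      fun a b => by ext; simp [add_smul]
  let g : DirectSum ℕ PointCobordism →+ TotalCobordism D p →+ TotalCobordism D' p :=
    AddMonoidHom.mk' (fun a => (DistribSMul.toAddMonoidHom _ a).comp (TotalCobordism.map p F))
      fun a b => by ext; simp [add_smul]
  have : f = g := TotalCobordism.hom_ext fun n z => TotalCobordism.hom_ext fun m y => by
    have H := isProduct_productCycle hD rfl z y
    have H' : ((productCycle hD rfl z y).map F).IsProduct z (y.map F) := by
      obtain ⟨p₁, p₂, h, r⟩ := H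
      exact ⟨p₁, p₂, h, r.map F⟩
    change TotalCobordism.map p F (z.cobordismClass • y.cobordismClass) =
      z.cobordismClass • TotalCobordism.map p F y.cobordismClass
    rw [cobordismClass_smul hD H, TotalCobordism.map_cobordismClass,
      TotalCobordism.map_cobordismClass, cobordismClass_smul hD' H']
  exact congr($this a x)

/-- Operations on bundle data which are inverse to each other up to cobordism induce linear
equivalences of cobordism groups. -/
lemma exists_linearEquiv (hD : D.IsGeometric) (hD' : D'.IsGeometric) (F : BundleKind.Hom D D')
    (G : BundleKind.Hom D' D)
    (hFG : ∀ (n : ℕ) (c : Cycle D p n), ((c.map F).map G).class = c.class)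
    (hGF : ∀ (n : ℕ) (c : Cycle D' p n), ((c.map G).map F).class = c.class) :
    letI := gmoduleCobordismGroup hD p
    letI := gmoduleCobordismGroup hD' p
    ∃ e : TotalCobordism D p ≃ₗ[DirectSum ℕ PointCobordism] TotalCobordism D' p,
      ∀ x, e x = TotalCobordism.map p F x := by
  let := gmoduleCobordismGroup hD p
  let := gmoduleCobordismGroup hD' p
  exact ⟨{ toFun := TotalCobordism.map p F
           map_add' := map_add _
           map_smul' := TotalCobordism.map_smul hD hD' F
           invFun := TotalCobordism.map p G
           left_inv := TotalCobordism.map_map F G hFG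
           right_inv := TotalCobordism.map_map G F hGF }, fun _ => rfl⟩

end

end DoublePoint

end

theorem lemma1p2p1 (X : Scheme.{0}) (p : X ⟶ SpecC)
    [LocallyOfFiniteType p] [QuasiCompact p] [IsSeparated p]
    (s : ℕ) (r : Fin s → ℕ) (hpos : ∀ i, 0 < r i) (hmono : StrictMono r) :
    ∃ (_ : DirectSum.GCommRing PointCobordism)
      (_ : DirectSum.Gmodule PointCobordism (CobordismGroup (filteredBundles r) p))
      (_ : DirectSum.Gmodule PointCobordism (CobordismGroup (gradedBundles (differences r)) p))
      (_ : DirectSum.Gmodule PointCobordism (CobordismGroup (bundleLists (differences r)) p)),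
      MulIsProduct ∧
      ActionIsProduct (filteredBundles r) p ∧
      ActionIsProduct (gradedBundles (differences r)) p ∧
      ActionIsProduct (bundleLists (differences r)) p ∧
      (∃ gr : TotalCobordism (filteredBundles r) p
          ≃ₗ[DirectSum ℕ PointCobordism] TotalCobordism (gradedBundles (differences r)) p,
        ∀ x, gr x = TotalCobordism.map p (grHom r) x) ∧
      (∃ list : TotalCobordism (gradedBundles (differences r)) p
          ≃ₗ[DirectSum ℕ PointCobordism] TotalCobordism (bundleLists (differences r)) p,
        ∀ x, list x = TotalCobordism.map p (listHom (differences r)) x) := by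
  refine ⟨gCommRingPointCobordism,
    gmoduleCobordismGroup (isGeometric_filteredBundles hmono.monotone) p,
    gmoduleCobordismGroup (isGeometric_gradedBundles _) p,
    gmoduleCobordismGroup (isGeometric_bundleLists _) p, mulIsProduct, actionIsProduct _ p,
    actionIsProduct _ p, actionIsProduct _ p, ?_, ?_⟩
  · exact exists_linearEquiv _ _ (grHom r) (splitHom hmono.monotone)
      (fun _ c => class_split_gr hmono c) (fun _ c => class_gr_split hmono c)
  · exact exists_linearEquiv _ _ (listHom (differences r)) (gradedHom (differences r))
      (fun _ c => class_graded_list c) (fun _ c => class_list_graded c)
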